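/- **Setting.** Let $A(\xi)$ be a real homogeneous polynomial on $\mathbb R^N$ of even degree $m=2l\ge 2$ with $A(\xi)>0$ for $\xi\ne0$. For $f\in L_2(\mathbb R^N)$ let $\hat f(\xi)=(2\pi)^{-N}\int f(x)e^{-ix\xi}dx$ (in the $L_2$ sense), and for $\sigma>0$ let $\hat A^\sigma$ be the operator given by $\widehat{\hat A^\sigma f}(\xi)=A(\xi)^\sigma\hat f(\xi)$ on all $f\in L_2$ for which the right-hand side is in $L_2$. Values $\hat f(\xi)$ at a single point are taken at Lebesgue points: $\hat f(\xi)=c$ means that the averages of $|\hat f-c|$ over balls centred at $\xi$ tend to $0$ as the radius tends to $0$. Let $E_\rho(z)=\sum_{k\ge0}z^k/\Gamma(\rho k+1)$ and $D_t^\rho h(t)=\frac1{\Gamma(1-\rho)}\int_0^t(t-s)^{-\rho}h'(s)\,ds$. Let $\tau>N/2$ and let $\varphi$ be a continuous function in $L_2^\tau(\mathbb R^N)$, i.e. $\varphi\in L_2$ and $\int(1+|\xi|^2)^\tau|\hat\varphi(\xi)|^2d\xi<\infty$. Let $T>0$. For $\rho,\sigma\in(0,1)$ consider $$D_t^\rho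 v+\hat A^\sigma v=0\ \ (x\in\mathbb R^N,\ 0<t\le T),\qquad \lim_{|x|\to\infty}v(x,t)=0\ \ (0<t\le T),\qquad v(x,0)=\varphi(x).\tag{1}$$ A solution of (1) is a function $v$ on $\mathbb R^N\times[0,T]$ such that: for each $x$, $v(x,\cdot)$ is continuous on $[0,T]$ and differentiable on $(0,T)$ with integrable derivative, and the integral defining $D_t^\rho v(x,t)$ converges absolutely for $0<t\le T$; for $0<t\le T$, $v(\cdot,t)$ is in the domain of $\hat A^\sigma$ and $\hat v(\cdot,t)\in L_1$; $D_t^\rho v$ and $\hat A^\sigma v$ are continuous on $\mathbb R^N\times(0,T]$; $\int_0^T\|\hat A^\sigma v(\cdot,t)\|_{L_2}dt<\infty$; and (1) holds pointwise. Fix $\rho_0,\sigma_0\in(0,1)$. Let $T_0=e^k$ with some $k\ge\frac1{\rho_0}\max\{\frac{B_1}{B_2},\ln(2B_2k)\}$, $B_1=43$, $B_2=4.6$; if $\rho_0>0.0075$, $T_0=2$ is also allowed. Let $T_0\le t_0\le T$, let $\xi_0$ be such that $A(\xi_0)=1$ and $\hat\varphi(\xi_0)\neq0$ (at a Lebesgue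 point), and let $d_0\in\mathbb R$. **Theorem 1.4.** For all $\rho\in[\rho_0,1)$ and $\sigma\in(0,1)$ problem (1) has exactly one solution $v=v_{\rho,\sigma}$, and whether $|\hat v(\xi_0,t_0)|=d_0$ holds does not depend on $\sigma$. 1. A unique $\rho^\star\in[\rho_0,1)$ with $|\hat v(\xi_0,t_0)|=d_0$ exists if and only if $$e^{-t_0}<\frac{d_0}{|\hat\varphi(\xi_0)|}\le E_{\rho_0}(-t_0^{\rho_0});$$ the same condition is also necessary and sufficient for the existence of some such $\rho^\star$. 2. Let $\rho^\star\in[\rho_0,1)$ satisfy $|\hat v(\xi_0,t_0)|=d_0$. Let $\xi_1$ be such that $\hat\varphi(\xi_1)\ne0$ (at a Lebesgue point) and $A(\xi_1)=\lambda_1\ge\Lambda_1$, where $\Lambda_1=e^n$ with some $n\ge\ln(5\,\Gamma(1-\rho^\star))/\sigma_0$; let $0<t_1\le T$ and $d_1\in\mathbb R$. Then $\sigma^\star\in[\sigma_0,1)$ with $|\hat v(\xi_1,t_1)|=d_1$ for the solution $v=v_{\rho^\star,\sigma^\star}$ exists if and only if $$E_{\rho^\star}(-\lambda_1t_1^{\rho^\star})<\frac{d_1}{|\hat\varphi(\xi_1)|}\le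 E_{\rho^\star}(-\lambda_1^{\sigma_0}t_1^{\rho^\star}),$$ and $\sigma^\star\in(\sigma_0,1)$ with this property exists if and only if the same holds with both inequalities strict. In either case $\sigma^\star$ is unique. -/

import Mathlib

open MeasureTheory Set Filter Topology
open scoped FourierTransform ENNReal

noncomputable section

namespace Subdiffusion

/-- The Mittag-Leffler function `E_ρ(z) = ∑ z ^ k / Γ(ρ k + 1)`. -/
def mittagLeffler (ρ z : ℝ) : ℝ :=
  ∑' k : ℕ, z ^ k / Real.Gamma (ρ * k + 1)

/-- The value at `ξ` of a real polynomial in `N` variables (the symbol of the operator). -/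
def symbol {N : ℕ} (A : MvPolynomial (Fin N) ℝ) (ξ : EuclideanSpace ℝ (Fin N)) : ℝ :=
  MvPolynomial.eval (fun j => ξ j) A

open Classical in
/-- The Fourier transform `f̂(ξ) = (2π)^{-N} ∫ f(x) e^{-i x ξ} dx` of a function in `L²(ℝ^N)`, in the
`L²` sense. Mathlib's `𝓕` has the kernel `e^{-2π i x ξ}`, hence the rescaling of the argument. As
usual, the result is meaningful up to null sets only; it is set to `0` outside `L²`. -/
def hat {N : ℕ} (f : EuclideanSpace ℝ (Fin N) → ℂ) (ξ : EuclideanSpace ℝ (Fin N)) : ℂ :=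
  if h : MemLp f 2 volume then
    (((2 * Real.pi) ^ N)⁻¹ : ℝ) • (𝓕 (h.toLp f) : Lp ℂ 2 volume) ((2 * Real.pi)⁻¹ • ξ)
  else 0

/-- `ξ` is a Lebesgue point of `f`, with value `c`: the averages of `|f - c|` over the balls around
`ξ` tend to zero. The value is unique, depends only on the almost-everywhere class of `f`, is `f ξ`
for almost every `ξ` if `f` is locally integrable, and is `f ξ` if `f` is continuous at `ξ`. -/
def HasLebesgueValue {N : ℕ} (f : EuclideanSpace ℝ (Fin N) → ℂ)
    (ξ : EuclideanSpace ℝ (Fin N)) (c : ℂ) : Prop :=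
  Tendsto (fun r : ℝ => ⨍⁻ η in Metric.ball ξ r, ‖f η - c‖ₑ ∂volume) (𝓝[>] 0) (𝓝 0)

/-- The Sobolev class `L₂^τ(ℝ^N)`: functions `f ∈ L²` with `∫ (1 + |ξ|²)^τ |f̂(ξ)|² dξ < ∞`. -/
def MemSobolevClass {N : ℕ} (τ : ℝ) (f : EuclideanSpace ℝ (Fin N) → ℂ) : Prop :=
  MemLp f 2 volume ∧
    MemLp (fun ξ => (((1 + ‖ξ‖ ^ 2) ^ (τ / 2) : ℝ) : ℂ) * hat f ξ) 2 volume

/-- `f` lies in the domain of the power `Â^σ` of the selfadjoint operator with symbol `A`, and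
`Â^σ f = g`: both are in `L²` and `ĝ(ξ) = A(ξ)^σ f̂(ξ)`. -/
def IsFractionalPower {N : ℕ} (A : MvPolynomial (Fin N) ℝ) (σ : ℝ)
    (f g : EuclideanSpace ℝ (Fin N) → ℂ) : Prop :=
  MemLp f 2 volume ∧ MemLp g 2 volume ∧
    hat g =ᵐ[volume] fun ξ => ((symbol A ξ ^ σ : ℝ) : ℂ) * hat f ξ

/-- The Caputo derivative
`D_t^ρ h(t) = Γ(1 - ρ)⁻¹ ∫_0^t (t - s)^{-ρ} h'(s) ds` of order `ρ ∈ (0, 1)`. -/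
def caputo (ρ : ℝ) (h : ℝ → ℂ) (t : ℝ) : ℂ :=
  ((Real.Gamma (1 - ρ))⁻¹ : ℝ) • ∫ s in (0 : ℝ)..t, ((t - s) ^ (-ρ) : ℝ) • deriv h s

/-- The Caputo derivative of order `ρ` of `h` exists on `(0, T]`: `h` is continuous on `[0, T]`,
differentiable inside with integrable derivative, and the integrals that define the Caputo
derivative converge absolutely. -/
structure HasCaputo (ρ T : ℝ) (h : ℝ → ℂ) : Prop where
  continuousOn : ContinuousOn h (Icc 0 T)
  differentiableAt : ∀ t ∈ Ioo 0 T, DifferentiableAt ℝ h t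
  integrable_deriv : IntegrableOn (deriv h) (Ioo 0 T)
  integrable_kernel : ∀ t ∈ Ioc 0 T,
    IntegrableOn (fun s => ((t - s) ^ (-ρ) : ℝ) • deriv h s) (Ioo 0 t)

/-- `v(x, t)` is a (classical) solution of
`D_t^ρ v + Â^σ v = 0` on `ℝ^N × (0, T]`, `v(x, t) → 0` as `|x| → ∞`, `v(x, 0) = φ(x)`.
The function `w` is `Â^σ v`. -/
structure IsSolution {N : ℕ} (A : MvPolynomial (Fin N) ℝ) (ρ σ T : ℝ)
    (φ : EuclideanSpace ℝ (Fin N) → ℂ) (v : EuclideanSpace ℝ (Fin N) → ℝ → ℂ) : Prop where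
  initial : ∀ x, v x 0 = φ x
  boundary : ∀ t ∈ Ioc 0 T, Tendsto (fun x => v x t) (cocompact _) (𝓝 0)
  hasCaputo : ∀ x, HasCaputo ρ T (v x)
  continuousOn_caputo : ContinuousOn
    (fun p : EuclideanSpace ℝ (Fin N) × ℝ => caputo ρ (v p.1) p.2) (univ ×ˢ Ioc 0 T)
  integrable_hat : ∀ t ∈ Ioc 0 T, Integrable (hat fun x => v x t) volume
  equation : ∃ w : EuclideanSpace ℝ (Fin N) → ℝ → ℂ,
    ContinuousOn (fun p : EuclideanSpace ℝ (Fin N) × ℝ => w p.1 p.2) (univ ×ˢ Ioc 0 T) ∧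
    (∀ t ∈ Ioc 0 T, IsFractionalPower A σ (fun x => v x t) (fun x => w x t)) ∧
    (∫⁻ t in Ioc 0 T, eLpNorm (fun x => w x t) 2 volume) < ∞ ∧
    ∀ x, ∀ t ∈ Ioc 0 T, caputo ρ (v x) t + w x t = 0

/-- `|v̂(ξ, t)| = d` for the solution `v` with orders `ρ`, `σ` and initial function `φ`. -/
def Observed {N : ℕ} (A : MvPolynomial (Fin N) ℝ) (ρ σ T : ℝ)
    (φ : EuclideanSpace ℝ (Fin N) → ℂ) (ξ : EuclideanSpace ℝ (Fin N)) (t d : ℝ) : Prop :=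
  ∃ v, IsSolution A ρ σ T φ v ∧ ∃ c : ℂ, HasLebesgueValue (hat fun x => v x t) ξ c ∧ ‖c‖ = d

/-- The admissible thresholds `T₀(lam, ρ₀)` for the time of the first observation: `e^k` with
`k ≥ ρ₀⁻¹ max {B₁ / B₂, ln (2 B₂ k / lam)}`, `B₁ = 43`, `B₂ = 4.6`; if `ρ₀ lam > 0.0075`, also `2`. -/
def IsTimeThreshold (lam ρ₀ T₀ : ℝ) : Prop :=
  (∃ k : ℝ, T₀ = Real.exp k ∧
    1 / ρ₀ * max (43 / 4.6) (Real.log (2 * 4.6 * k / lam)) ≤ k) ∨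
  (0.0075 < ρ₀ * lam ∧ T₀ = 2)

/-- The admissible thresholds `Λ₁(ρ, σ₀)`: `e^n` with `n ≥ ln (5 Γ(1 - ρ)) / σ₀`. -/
def IsSymbolThreshold (ρ σ₀ Λ₁ : ℝ) : Prop :=
  ∃ n : ℝ, Λ₁ = Real.exp n ∧ Real.log (5 * Real.Gamma (1 - ρ)) / σ₀ ≤ n

end Subdiffusion

end

/-! On the Fourier side problem (1) splits into the scalar equations D_t^ρ e = -λe, e(0) = 1, with λ
= A(ξ)^σ, so that v̂(ξ,t) = E_ρ(-A(ξ)^σ t^ρ) φ̂(ξ). At ξ₀ one has A^σ = 1: the first observation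
reads E_ρ(-t₀^ρ) = d₀/|φ̂(ξ₀)| and σ has disappeared. At ξ₁ the second reads E_ρ⋆(-λ₁^σ t₁^ρ) =
d₁/|φ̂(ξ₁)|. Both claims then follow from strict monotonicity, continuity and the intermediate value
theorem, applied in ρ and in σ respectively.

The scalar facts come from a positive density K_ρ (`relaxDensity`) with E_ρ(-τ^ρ) = ∫ exp(-τ e^y)
K_ρ(y) dy (`mittagLeffler_neg_rpow`). The two sides have the same Laplace transform: that of the
series is computed termwise, that of the integral from the Stieltjes transform of K_ρ, which is a
contour integral. Positivity of K_ρ makes the function decrease in τ, hence in σ as soon as λ₁ > 1.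

Monotonicity in ρ (`strictAntiOn_relaxation_order`) is a single-crossing argument. The K_ρ are even
probability densities; for α < β the difference K_β - K_α changes sign once on the half-line, from
plus to minus, so the smaller order has its mass further out. For t ≥ 1 the function exp(-t e^y) +
exp(-t e^{-y}) increases on the half-line, hence has the larger integral against K_α. Continuity up
to ρ = 1, where E_1(-t) = e^{-t}, is read off the series. The thresholds enter through t₀ ≥ 1 and λ₁
> 1.

Existence (`isSolution_evolution`): φ̂ is integrable since τ > N/2, and the bound λ E_ρ(-λt^ρ) ≤ C
t^{-ρ}, uniform in λ, controls Â^σ v for t > 0. Uniqueness (`IsSolution.eq`): the difference u of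
two solutions satisfies u = -I^ρ Â^σ u with the fractional integral I^ρ. On frequencies with A^σ ≤ R
the operator has norm at most R, while I^ρ has norm at most μ^{-ρ} on L¹(0,T) with weight e^{-μt};
with μ^ρ = 2R, iteration forces Â^σ u = 0. Finally E_ρ(-A^σ t^ρ) is continuous in ξ and bounded by
1, so multiplication by it preserves Lebesgue points (`HasLebesgueValue.mul`). -/

namespace Subdiffusion

/-! ### The density of the measure representing E_ρ(-τ^ρ). -/

section

/-- The density (in the logarithmic variable) of the measure whose Laplace transform is the
function `E_ρ(-τ ^ ρ)`. -/
noncomputable def relaxDensity (ρ y : ℝ) : ℝ :=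
  Real.sin (Real.pi * ρ) / (2 * Real.pi * (Real.cosh (ρ * y) + Real.cos (Real.pi * ρ)))

lemma sin_pi_mul_pos {ρ : ℝ} (hρ : ρ ∈ Ioo (0 : ℝ) 1) : 0 < Real.sin (Real.pi * ρ) := by
  apply Real.sin_pos_of_pos_of_lt_pi
  · exact mul_pos Real.pi_pos hρ.1
  · nlinarith [hρ.2, Real.pi_pos]

lemma neg_one_lt_cos_pi_mul {ρ : ℝ} (hρ : ρ ∈ Ioo (0 : ℝ) 1) : -1 < Real.cos (Real.pi * ρ) := by
  have h := sin_pi_mul_pos hρ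
  have h2 := Real.sin_sq_add_cos_sq (Real.pi * ρ)
  nlinarith [Real.neg_one_le_cos (Real.pi * ρ), h, h2]

lemma cosh_add_cos_pos {ρ : ℝ} (hρ : ρ ∈ Ioo (0 : ℝ) 1) (y : ℝ) :
    0 < Real.cosh (ρ * y) + Real.cos (Real.pi * ρ) := by
  linarith [neg_one_lt_cos_pi_mul hρ, Real.one_le_cosh (ρ * y)]

lemma relaxDensity_pos {ρ : ℝ} (hρ : ρ ∈ Ioo (0 : ℝ) 1) (y : ℝ) : 0 < relaxDensity ρ y :=
  div_pos (sin_pi_mul_pos hρ)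
    (mul_pos (mul_pos two_pos Real.pi_pos) (cosh_add_cos_pos hρ y))

lemma relaxDensity_neg (ρ y : ℝ) : relaxDensity ρ (-y) = relaxDensity ρ y := by
  simp [relaxDensity]

lemma continuous_relaxDensity {ρ : ℝ} (hρ : ρ ∈ Ioo (0 : ℝ) 1) : Continuous (relaxDensity ρ) := by
  unfold relaxDensity
  refine continuous_const.div (by fun_prop) fun y => ?_
  have := cosh_add_cos_pos hρ y
  have := Real.pi_pos
  positivity

/-- Of use for y → -∞; evenness turns it into decay at +∞. It also governs the decay τ^{-ρ} of the
Laplace transform of the density. -/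
lemma exists_relaxDensity_le {ρ : ℝ} (hρ : ρ ∈ Ioo (0 : ℝ) 1) :
    ∃ C, 0 < C ∧ ∀ y, relaxDensity ρ y ≤ C * Real.exp (ρ * y) := by
  -- Since cosh ≥ 1, this c gives c cosh ≤ cosh + cos(πρ) for either sign of the cosine.
  set c := min 1 (1 + Real.cos (Real.pi * ρ)) with hc
  have hc0 : 0 < c := lt_min one_pos (by linarith [neg_one_lt_cos_pi_mul hρ])
  refine ⟨Real.sin (Real.pi * ρ) / (Real.pi * c), div_pos (sin_pi_mul_pos hρ)
    (mul_pos Real.pi_pos hc0), fun y => ?_⟩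
  have h1 : c * (Real.exp (-(ρ * y)) / 2) ≤ Real.cosh (ρ * y) + Real.cos (Real.pi * ρ) := by
    have h2 : Real.exp (-(ρ * y)) / 2 ≤ Real.cosh (ρ * y) := by
      rw [Real.cosh_eq]; linarith [Real.exp_pos (ρ * y)]
    have h3 : c * Real.cosh (ρ * y) ≤ Real.cosh (ρ * y) + Real.cos (Real.pi * ρ) := by
      have h1 := Real.one_le_cosh (ρ * y)
      rcases le_total 0 (Real.cos (Real.pi * ρ)) with h | h
      · nlinarith [min_le_left 1 (1 + Real.cos (Real.pi * ρ))]
      · nlinarith [min_le_right 1 (1 + Real.cos (Real.pi * ρ))]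
    nlinarith
  have h4 : 0 < c * (Real.exp (-(ρ * y)) / 2) := by positivity
  calc relaxDensity ρ y ≤ Real.sin (Real.pi * ρ) / (2 * Real.pi * (c * (Real.exp (-(ρ * y)) / 2))) := by
        unfold relaxDensity
        have := Real.pi_pos
        have := sin_pi_mul_pos hρ
        gcongr
    _ = _ := by
        rw [Real.exp_neg]
        have := Real.pi_pos
        field_simp

lemma integrable_relaxDensity {ρ : ℝ} (hρ : ρ ∈ Ioo (0 : ℝ) 1) : Integrable (relaxDensity ρ) := by
  obtain ⟨C, hC, h⟩ := exists_relaxDensity_le hρ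
  have hm := (continuous_relaxDensity hρ).aestronglyMeasurable (μ := volume)
  rw [← integrableOn_univ, ← Iic_union_Ioi (a := (0 : ℝ))]
  refine IntegrableOn.union ?_ ?_
  · refine Integrable.mono' ((integrableOn_exp_mul_Iic hρ.1 0).const_mul C) hm.restrict
      (Eventually.of_forall fun y => ?_)
    rw [Real.norm_of_nonneg (relaxDensity_pos hρ y).le]
    exact h y
  · refine Integrable.mono' ((integrableOn_exp_mul_Ioi (a := -ρ) (by linarith [hρ.1]) 0).const_mul C)
      hm.restrict (Eventually.of_forall fun y => ?_)
    rw [Real.norm_of_nonneg (relaxDensity_pos hρ y).le, ← relaxDensity_neg]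
    simpa using h (-y)

/-! ### The Stieltjes transform of the density by contour integration. -/

section Stieltjes

variable {ρ : ℝ}

/-- The scaled logistic function. -/
noncomputable def logistic (ρ : ℝ) (z : ℂ) : ℂ := (1 + Complex.exp (-(ρ * z)))⁻¹

lemma one_add_exp_ne_zero {w : ℂ} (h : |w.im| < Real.pi) : 1 + Complex.exp w ≠ 0 := by
  intro h0
  have h1 : Complex.exp w = -1 := by linear_combination h0
  have h2 := Complex.log_exp (x := w) (by linarith [(abs_lt.1 h).1]) (abs_lt.1 h).2.le
  rw [h1, Complex.log_neg_one] at h2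
  rw [← h2] at h
  simp [abs_of_pos Real.pi_pos] at h

lemma one_sub_exp_neg_ne_zero {w : ℂ} (h : |w.im| < 2 * Real.pi) (hw : w ≠ 0) :
    1 - Complex.exp (-w) ≠ 0 := by
  intro h0
  have h1 : Complex.exp (-w) = 1 := by linear_combination -h0
  obtain ⟨n, hn⟩ := Complex.exp_eq_one_iff.1 h1
  have him : -w.im = n * (2 * Real.pi) := by
    have := congrArg Complex.im hn
    simpa using this
  have hn0 : n = 0 := by
    have : |(n : ℝ)| < 1 := by
      have h3 : |(n : ℝ)| * (2 * Real.pi) < 1 * (2 * Real.pi) := by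
        rw [← abs_of_pos (by positivity : (0 : ℝ) < 2 * Real.pi), ← abs_mul, ← him, abs_neg,
          abs_of_pos (by positivity : (0 : ℝ) < 2 * Real.pi)]
        linarith
      exact lt_of_mul_lt_mul_right h3 (by positivity)
    exact Int.abs_lt_one_iff.1 (by exact_mod_cast this)
  apply hw
  have : -w = 0 := by rw [hn, hn0]; simp
  simpa using this

lemma differentiableOn_logistic (ρ : ℝ) :
    DifferentiableOn ℂ (logistic ρ) {z | |ρ * z.im| < Real.pi} := by
  intro z hz
  refine DifferentiableAt.differentiableWithinAt ?_
  unfold logistic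
  refine DifferentiableAt.inv (by fun_prop) (one_add_exp_ne_zero ?_)
  simpa using hz

/-- The difference of the boundary values of the logistic function on the strip. -/
lemma logistic_sub_logistic (hρ : ρ ∈ Ioo (0 : ℝ) 1) (y : ℝ) :
    logistic ρ (y + (-Real.pi : ℝ) * Complex.I) - logistic ρ (y + (Real.pi : ℝ) * Complex.I) =
      -(2 * Real.pi * Complex.I) * relaxDensity ρ y := by
  have e1 : Complex.exp (-(ρ * (y + (-Real.pi : ℝ) * Complex.I))) =
      Complex.exp (-(ρ * y)) * Complex.exp ((Real.pi * ρ) * Complex.I) := by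
    rw [← Complex.exp_add]; congr 1; push_cast; ring
  have e2 : Complex.exp (-(ρ * (y + (Real.pi : ℝ) * Complex.I))) =
      Complex.exp (-(ρ * y)) * Complex.exp (-(Real.pi * ρ) * Complex.I) := by
    rw [← Complex.exp_add]; congr 1; ring
  have hb : ∀ s : ℝ, |s| = Real.pi → 1 + Complex.exp (-(ρ * (y + (s : ℝ) * Complex.I))) ≠ 0 := by
    intro s hs
    apply one_add_exp_ne_zero
    simp [abs_mul, hs, abs_of_pos hρ.1]
    nlinarith [hρ.2, Real.pi_pos]
  have n1 := hb (-Real.pi) (by rw [abs_neg, abs_of_pos Real.pi_pos])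
  have n2 := hb Real.pi (abs_of_pos Real.pi_pos)
  unfold logistic
  rw [inv_sub_inv n1 n2, div_eq_iff (mul_ne_zero n1 n2), e1, e2]
  have hc : (Real.cosh (ρ * y) + Real.cos (Real.pi * ρ) : ℂ) ≠ 0 := by
    exact_mod_cast (cosh_add_cos_pos hρ y).ne'
  have hpi : (Real.pi : ℂ) ≠ 0 := by exact_mod_cast Real.pi_ne_zero
  have hexp := Complex.exp_ne_zero (ρ * y)
  simp only [relaxDensity]
  push_cast at hc ⊢
  rw [Complex.exp_mul_I, Complex.exp_mul_I, Complex.cos_neg, Complex.sin_neg, Complex.exp_neg]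
  rw [Complex.cosh, Complex.exp_neg] at hc ⊢
  have hsc := Complex.sin_sq_add_cos_sq (Real.pi * ρ)
  set S := Complex.sin (Real.pi * ρ)
  set K := Complex.cos (Real.pi * ρ)
  set X := Complex.exp (ρ * y)
  have key : (1 + X⁻¹ * (K + S * Complex.I)) * (1 + X⁻¹ * (K + -S * Complex.I)) =
      X⁻¹ * (2 * ((X + X⁻¹) / 2 + K)) := by
    field_simp
    linear_combination hsc - S ^ 2 * Complex.I_sq
  rw [key]
  generalize (X + X⁻¹) / 2 + K = q at *
  field_simp
  ring

/-- `(L(ρ z) - L(ρ x)) / (1 - e^{x - z})` with the singularity at `x` removed. -/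
noncomputable def contourFun (ρ x : ℝ) (z : ℂ) : ℂ :=
  dslope (logistic ρ) x z / dslope (fun w : ℂ => 1 - Complex.exp (-(w - x))) x z

lemma contourFun_of_ne {x : ℝ} {z : ℂ} (h : z ≠ x) :
    contourFun ρ x z = (logistic ρ z - logistic ρ x) * (1 - Complex.exp (-(z - x)))⁻¹ := by
  have h' : z - x ≠ 0 := sub_ne_zero.2 h
  rw [contourFun, dslope_of_ne _ h, dslope_of_ne _ h, slope_def_field, slope_def_field]
  simp
  by_cases h0 : 1 - Complex.exp (x - z) = 0
  · simp [h0]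
  · field_simp

/-- The lower difference quotient has no zeros here: at x it is the derivative 1, and elsewhere 1 -
e^{-w} vanishes in |Im w| < 2π only at w = 0. -/
lemma differentiableOn_contourFun (ρ x : ℝ) :
    DifferentiableOn ℂ (contourFun ρ x) {z | |ρ * z.im| < Real.pi ∧ |z.im| < 2 * Real.pi} := by
  have hopen : IsOpen {z : ℂ | |ρ * z.im| < Real.pi ∧ |z.im| < 2 * Real.pi} := by
    apply IsOpen.and <;> exact isOpen_lt (by fun_prop) (by fun_prop)
  have hx : {z : ℂ | |ρ * z.im| < Real.pi ∧ |z.im| < 2 * Real.pi} ∈ 𝓝 (x : ℂ) :=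
    hopen.mem_nhds (by simp [Real.pi_pos])
  have hd : Differentiable ℂ (fun w : ℂ => 1 - Complex.exp (-(w - x))) := by fun_prop
  refine DifferentiableOn.div ?_ ?_ ?_
  · exact (Complex.differentiableOn_dslope hx).2
      ((differentiableOn_logistic ρ).mono fun z hz => hz.1)
  · exact (Complex.differentiableOn_dslope hx).2 hd.differentiableOn
  · intro z hz
    by_cases h : z = x
    · rw [h, dslope_same]
      have : HasDerivAt (fun w : ℂ => 1 - Complex.exp (-(w - x))) (-(Complex.exp (-(x - x)) * (-1))) x := by
        exact (((hasDerivAt_id (x : ℂ)).sub_const (x : ℂ)).neg.cexp).const_sub 1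
      rw [this.deriv]; simp
    · rw [dslope_of_ne _ h, slope_def_field]
      have := one_sub_exp_neg_ne_zero (w := z - x) (by simpa using hz.2) (sub_ne_zero.2 h)
      simp only [sub_self, neg_zero, Complex.exp_zero, sub_zero]
      exact div_ne_zero this (sub_ne_zero.2 h)

/-- Convergence along `comap Complex.re l` is uniform in the imaginary part, so a constant dominates
the integrand on the short sides of the rectangle. -/
lemma tendsto_integral_vertical {f : ℂ → ℂ} {l : Filter ℝ} [l.IsCountablyGenerated] {c : ℂ}
    (hf : Tendsto f (comap Complex.re l) (𝓝 c))
    {a b : ℝ} (hcont : ∀ᶠ r : ℝ in l, ContinuousOn (fun s : ℝ => f (r + s * Complex.I)) (Icc a b))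
    (hab : a ≤ b) :
    Tendsto (fun r : ℝ => ∫ s in a..b, f (r + s * Complex.I)) l (𝓝 ((b - a) * c)) := by
  have h1 : ((b - a) * c : ℂ) = ∫ s in a..b, c := by simp
  rw [h1]
  refine intervalIntegral.tendsto_integral_filter_of_dominated_convergence (fun _ => ‖c‖ + 1)
    ?_ ?_ (by simp) ?_
  · filter_upwards [hcont] with r hr
    rw [uIoc_of_le hab]
    exact (hr.mono Ioc_subset_Icc_self).aestronglyMeasurable measurableSet_Ioc
  · have h2 : ∀ᶠ z in comap Complex.re l, ‖f z‖ < ‖c‖ + 1 :=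
      hf.norm.eventually (gt_mem_nhds (by linarith))
    rw [eventually_comap] at h2
    filter_upwards [h2] with r hr
    exact Eventually.of_forall fun s _ => (hr (r + s * Complex.I) (by simp)).le
  · refine Eventually.of_forall fun s _ => hf.comp ?_
    rw [tendsto_comap_iff]
    simp only [Function.comp_def, Complex.add_re, Complex.ofReal_re, Complex.re_ofReal_mul,
      Complex.I_re, mul_zero, add_zero]
    exact tendsto_id

lemma tendsto_mul_comap_re {l : Filter ℝ} (h : Tendsto (fun r => ρ * r) l l) :
    Tendsto (fun z : ℂ => ρ * z) (comap Complex.re l) (comap Complex.re l) := by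
  rw [tendsto_comap_iff]
  have : Complex.re ∘ (fun z : ℂ => ρ * z) = (fun r => ρ * r) ∘ Complex.re := by ext z; simp
  rw [this]
  exact h.comp tendsto_comap

lemma tendsto_neg_comap_re {l l' : Filter ℝ} (h : Tendsto (fun r => -r) l l') :
    Tendsto (fun z : ℂ => -z) (comap Complex.re l) (comap Complex.re l') := by
  rw [tendsto_comap_iff]
  have : Complex.re ∘ (fun z : ℂ => -z) = (fun r => -r) ∘ Complex.re := by ext z; simp
  rw [this]
  exact h.comp tendsto_comap

lemma tendsto_sub_comap_re {l l' : Filter ℝ} (x : ℝ) (h : Tendsto (fun r => r - x) l l') :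
    Tendsto (fun z : ℂ => z - x) (comap Complex.re l) (comap Complex.re l') := by
  rw [tendsto_comap_iff]
  have : Complex.re ∘ (fun z : ℂ => z - x) = (fun r => r - x) ∘ Complex.re := by ext z; simp
  rw [this]
  exact h.comp tendsto_comap

lemma tendsto_inv_add_exp_neg_atTop (a : ℂ) (ha : a ≠ 0) (b : ℂ) :
    Tendsto (fun z => (a + b * Complex.exp (-z))⁻¹) (comap Complex.re atTop) (𝓝 a⁻¹) := by
  have h := (Complex.tendsto_exp_comap_re_atBot.comp
    (tendsto_neg_comap_re tendsto_neg_atTop_atBot)).const_mul b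
  have h2 := h.const_add a
  rw [mul_zero, add_zero] at h2
  exact h2.inv₀ ha

lemma tendsto_inv_add_exp_neg_atBot (a b : ℂ) (hb : b ≠ 0) :
    Tendsto (fun z => (a + b * Complex.exp (-z))⁻¹) (comap Complex.re atBot) (𝓝 0) := by
  have h := Complex.tendsto_exp_comap_re_atBot
  have h2 := h.mul (((h.const_mul a).add_const b).inv₀ (by simpa))
  rw [zero_mul] at h2
  refine h2.congr fun z => ?_
  have hz := Complex.exp_ne_zero z
  have : a * Complex.exp z + b = Complex.exp z * (a + b * Complex.exp (-z)) := by
    rw [Complex.exp_neg]; field_simp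
  rw [this, mul_inv, mul_inv_cancel_left₀ hz]

lemma contourFun_eventuallyEq {x : ℝ} {l : Filter ℝ} (hl : ∀ᶠ r in l, r ≠ x) :
    (fun z => (logistic ρ z - logistic ρ x) * (1 + -1 * Complex.exp (-(z - x)))⁻¹)
      =ᶠ[comap Complex.re l] contourFun ρ x := by
  have : ∀ᶠ z in comap Complex.re l, z ≠ (x : ℂ) := by
    filter_upwards [preimage_mem_comap hl] with z hz h
    exact hz (by simp [h])
  filter_upwards [this] with z hz
  rw [contourFun_of_ne hz, neg_one_mul, sub_eq_add_neg (1 : ℂ)]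

lemma tendsto_contourFun_atTop (hρ : 0 < ρ) (x : ℝ) :
    Tendsto (contourFun ρ x) (comap Complex.re atTop) (𝓝 (1 - logistic ρ x)) := by
  refine Tendsto.congr' (contourFun_eventuallyEq (eventually_ne_atTop x)) ?_
  have h1 : Tendsto (logistic ρ) (comap Complex.re atTop) (𝓝 1) := by
    have : logistic ρ = fun z => (1 + Complex.exp (-(ρ * z)))⁻¹ := rfl
    rw [this]
    simpa [Function.comp_def] using (tendsto_inv_add_exp_neg_atTop 1 one_ne_zero 1).comp
      (tendsto_mul_comap_re (tendsto_id.const_mul_atTop hρ))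
  have h2 := (tendsto_inv_add_exp_neg_atTop 1 one_ne_zero (-1)).comp
    (tendsto_sub_comap_re x (tendsto_atTop_add_const_right _ (-x) tendsto_id))
  simpa using (h1.sub_const _).mul h2

lemma tendsto_contourFun_atBot (hρ : 0 < ρ) (x : ℝ) :
    Tendsto (contourFun ρ x) (comap Complex.re atBot) (𝓝 0) := by
  refine Tendsto.congr' (contourFun_eventuallyEq (eventually_ne_atBot x)) ?_
  have h1 : Tendsto (logistic ρ) (comap Complex.re atBot) (𝓝 0) := by
    have : logistic ρ = fun z => (1 + Complex.exp (-(ρ * z)))⁻¹ := rfl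
    rw [this]
    simpa [Function.comp_def] using (tendsto_inv_add_exp_neg_atBot 1 1 one_ne_zero).comp
      (tendsto_mul_comap_re (tendsto_id.const_mul_atBot hρ))
  have h2 := (tendsto_inv_add_exp_neg_atBot 1 (-1) (by simp)).comp
    (tendsto_sub_comap_re x (tendsto_atBot_add_const_right _ (-x) tendsto_id))
  simpa using (h1.sub_const _).mul h2

/-- On both lines Im z = ±π the exponential e^{x-z} equals -e^{x-y}. The two boundary values
therefore share the factor (1 + e^{x-y})⁻¹, the constant L(ρx) cancels, and the jump of the logistic
function remains. -/
lemma contourFun_sub_contourFun (hρ : ρ ∈ Ioo (0 : ℝ) 1) (x y : ℝ) :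
    contourFun ρ x (y + (-Real.pi : ℝ) * Complex.I) - contourFun ρ x (y + (Real.pi : ℝ) * Complex.I) =
      -(2 * Real.pi * Complex.I) * ((relaxDensity ρ y * (1 + Real.exp (x - y))⁻¹ : ℝ) : ℂ) := by
  have hne : ∀ s : ℝ, s ≠ 0 → (y + s * Complex.I : ℂ) ≠ x := by
    intro s hs h
    apply hs
    simpa using congrArg Complex.im h
  have e1 : Complex.exp (-(y + (-Real.pi : ℝ) * Complex.I - x)) = -Real.exp (x - y) := by
    have : -(y + (-Real.pi : ℝ) * Complex.I - x : ℂ) = ((x - y : ℝ) : ℂ) + Real.pi * Complex.I := by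
      push_cast; ring
    rw [this, Complex.exp_add, Complex.exp_pi_mul_I, Complex.ofReal_exp]; ring
  have e2 : Complex.exp (-(y + (Real.pi : ℝ) * Complex.I - x)) = -Real.exp (x - y) := by
    have : -(y + (Real.pi : ℝ) * Complex.I - x : ℂ) = ((x - y : ℝ) : ℂ) - Real.pi * Complex.I := by
      push_cast; ring
    rw [this, Complex.exp_sub, Complex.exp_pi_mul_I, Complex.ofReal_exp]; ring
  rw [contourFun_of_ne (hne _ (neg_ne_zero.2 Real.pi_ne_zero)),
    contourFun_of_ne (hne _ Real.pi_ne_zero), e1, e2, ← sub_mul, sub_sub_sub_cancel_right,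
    logistic_sub_logistic hρ]
  push_cast
  ring

/-- Cauchy's theorem on the rectangle |Re z| ≤ R, |Im z| ≤ π. The horizontal sides give -2πi times
the integral; as R → ∞ the right side tends to 2πi(1 - L(ρx)) and the left side to 0. In the
variable s = e^x this is the Stieltjes transform of the measure, up to the factor s. -/
theorem integral_relaxDensity_mul_logistic (hρ : ρ ∈ Ioo (0 : ℝ) 1) (x : ℝ) :
    ∫ y, relaxDensity ρ y * (1 + Real.exp (x - y))⁻¹ = 1 - (1 + Real.exp (-(ρ * x)))⁻¹ := by
  have hmem : ∀ z : ℂ, |z.im| ≤ Real.pi → |ρ * z.im| < Real.pi ∧ |z.im| < 2 * Real.pi := by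
    intro z hz
    have := Real.pi_pos
    refine ⟨?_, by linarith⟩
    rw [abs_mul, abs_of_pos hρ.1]
    nlinarith [hρ.1, hρ.2, abs_nonneg z.im]
  have hdiff : ∀ z : ℂ, |z.im| ≤ Real.pi → DifferentiableAt ℂ (contourFun ρ x) z := by
    intro z hz
    have hopen : IsOpen {z : ℂ | |ρ * z.im| < Real.pi ∧ |z.im| < 2 * Real.pi} := by
      apply IsOpen.and <;> exact isOpen_lt (by fun_prop) (by fun_prop)
    exact (differentiableOn_contourFun ρ x).differentiableAt (hopen.mem_nhds (hmem z hz))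
  have hhor : ∀ s : ℝ, |s| ≤ Real.pi → Continuous fun y : ℝ => contourFun ρ x (y + s * Complex.I) := by
    intro s hs
    rw [continuous_iff_continuousAt]
    intro y
    exact ContinuousAt.comp (f := fun y : ℝ => (y + s * Complex.I : ℂ)) (hdiff _ (by simpa)).continuousAt
      (by fun_prop)
  have hver : ∀ r : ℝ, ContinuousOn (fun s : ℝ => contourFun ρ x (r + s * Complex.I)) (Icc (-Real.pi) Real.pi) := by
    intro r s hs
    refine ContinuousAt.continuousWithinAt ?_
    exact ContinuousAt.comp (f := fun s : ℝ => (r + s * Complex.I : ℂ))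
      (hdiff _ (by simpa using abs_le.2 hs)).continuousAt (by fun_prop)
  have hint : Integrable fun y => relaxDensity ρ y * (1 + Real.exp (x - y))⁻¹ := by
    refine (integrable_relaxDensity hρ).mul_bdd (c := 1) ?_ (Eventually.of_forall fun y => ?_)
    · refine (Continuous.inv₀ (by fun_prop) fun y => ?_).aestronglyMeasurable
      positivity
    · rw [Real.norm_of_nonneg (by positivity)]
      exact inv_le_one_of_one_le₀ (by linarith [Real.exp_pos (x - y)])
  have hrect : ∀ R : ℝ, -(2 * Real.pi * Complex.I) *
      ((∫ y in -R..R, relaxDensity ρ y * (1 + Real.exp (x - y))⁻¹ : ℝ) : ℂ) +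
      Complex.I * (∫ s in -Real.pi..Real.pi, contourFun ρ x (R + s * Complex.I)) -
      Complex.I * (∫ s in -Real.pi..Real.pi, contourFun ρ x ((-R : ℝ) + s * Complex.I)) = 0 := by
    intro R
    have h := Complex.integral_boundary_rect_eq_zero_of_differentiableOn (contourFun ρ x)
      ⟨-R, -Real.pi⟩ ⟨R, Real.pi⟩ (by
        intro z hz
        refine (hdiff z ?_).differentiableWithinAt
        have := hz.2
        simp only [mem_preimage] at this
        rw [uIcc_of_le (by linarith [Real.pi_pos])] at this
        exact abs_le.2 this)
    rw [← intervalIntegral.integral_sub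
      ((hhor _ (by rw [abs_neg, abs_of_pos Real.pi_pos])).intervalIntegrable _ _)
      ((hhor _ (by rw [abs_of_pos Real.pi_pos])).intervalIntegrable _ _)] at h
    simp only [contourFun_sub_contourFun hρ] at h
    rw [intervalIntegral.integral_const_mul, intervalIntegral.integral_ofReal] at h
    simpa using h
  have hlim1 := intervalIntegral_tendsto_integral hint tendsto_neg_atTop_atBot tendsto_id
  have hlim2 : ∀ l : Filter ℝ, l.IsCountablyGenerated → ∀ c, Tendsto (contourFun ρ x) (comap Complex.re l) (𝓝 c) →
      Tendsto (fun r : ℝ => ∫ s in -Real.pi..Real.pi, contourFun ρ x (r + s * Complex.I)) l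
        (𝓝 ((Real.pi - (-Real.pi : ℝ)) * c)) := by
    intro l hl c hc
    exact tendsto_integral_vertical hc (Eventually.of_forall hver) (by linarith [Real.pi_pos])
  have hA := hlim2 atTop inferInstance _ (tendsto_contourFun_atTop hρ.1 x)
  have hB := (hlim2 atBot inferInstance _ (tendsto_contourFun_atBot hρ.1 x)).comp tendsto_neg_atTop_atBot
  have htot := (((Complex.continuous_ofReal.tendsto _).comp hlim1).const_mul
    (-(2 * Real.pi * Complex.I))).add (hA.const_mul Complex.I) |>.sub (hB.const_mul Complex.I)
  have h0 := tendsto_nhds_unique htot (tendsto_const_nhds.congr fun R => (hrect R).symm)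
  have hpi : (Real.pi : ℂ) ≠ 0 := by exact_mod_cast Real.pi_ne_zero
  have h1 : ((∫ y, relaxDensity ρ y * (1 + Real.exp (x - y))⁻¹ : ℝ) : ℂ) = 1 - logistic ρ x := by
    have hI := Complex.I_ne_zero
    have h2 : (2 * Real.pi * Complex.I) * (((∫ y, relaxDensity ρ y * (1 + Real.exp (x - y))⁻¹ : ℝ) : ℂ) -
      (1 - logistic ρ x)) = 0 := by
      push_cast at h0 ⊢
      linear_combination -h0
    have h3 := (mul_eq_zero.1 h2).resolve_left (by simp [hpi])
    linear_combination h3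
  have h2 : logistic ρ x = (((1 + Real.exp (-(ρ * x)))⁻¹ : ℝ) : ℂ) := by
    unfold logistic; push_cast; rfl
  rw [h2] at h1
  exact_mod_cast h1

/-- At x = 0 the Stieltjes transform gives 1/2. By evenness the reflected weight (1 + e^y)⁻¹ gives
1/2 as well, and the two weights add up to 1. -/
theorem integral_relaxDensity (hρ : ρ ∈ Ioo (0 : ℝ) 1) : ∫ y, relaxDensity ρ y = 1 := by
  have h := integral_relaxDensity_mul_logistic hρ 0
  have h2 := h
  rw [← integral_neg_eq_self] at h2
  have hb : ∀ s : ℝ, Integrable fun y => relaxDensity ρ y * (1 + Real.exp (s * y))⁻¹ := by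
    intro s
    refine (integrable_relaxDensity hρ).mul_bdd (c := 1) ?_ (Eventually.of_forall fun y => ?_)
    · refine (Continuous.inv₀ (by fun_prop) fun y => ?_).aestronglyMeasurable
      positivity
    · rw [Real.norm_of_nonneg (by positivity)]
      exact inv_le_one_of_one_le₀ (by linarith [Real.exp_pos (s * y)])
  have h3 : ∀ y, relaxDensity ρ y = relaxDensity ρ y * (1 + Real.exp (-1 * y))⁻¹ +
      relaxDensity ρ y * (1 + Real.exp (1 * y))⁻¹ := by
    intro y
    have : Real.exp (-1 * y) = (Real.exp y)⁻¹ := by rw [neg_one_mul, Real.exp_neg]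
    rw [this, one_mul]
    have := Real.exp_pos y
    field_simp
    ring
  rw [integral_congr_ae (Eventually.of_forall h3), integral_add (hb _) (hb _)]
  simp only [relaxDensity_neg] at h2
  simp at h h2 ⊢
  rw [h, h2]; norm_num

end Stieltjes

end

/-! ### The Laplace transform of the density, and uniqueness for Laplace transforms. -/

section

variable {ρ : ℝ}

/-- The relaxation function `E_ρ(-τ ^ ρ)`, as the Laplace transform of a positive measure. -/
noncomputable def relaxation (ρ τ : ℝ) : ℝ :=
  ∫ y, Real.exp (-(τ * Real.exp y)) * relaxDensity ρ y

lemma integrable_relaxation (hρ : ρ ∈ Ioo (0 : ℝ) 1) {τ : ℝ} (hτ : 0 ≤ τ) :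
    Integrable fun y => Real.exp (-(τ * Real.exp y)) * relaxDensity ρ y := by
  refine (integrable_relaxDensity hρ).bdd_mul (c := 1) (by fun_prop) (Eventually.of_forall fun y => ?_)
  rw [Real.norm_of_nonneg (Real.exp_pos _).le, Real.exp_le_one_iff]
  have := Real.exp_pos y
  nlinarith

lemma relaxation_zero (hρ : ρ ∈ Ioo (0 : ℝ) 1) : relaxation ρ 0 = 1 := by
  simp [relaxation, integral_relaxDensity hρ]

lemma relaxation_pos (hρ : ρ ∈ Ioo (0 : ℝ) 1) {τ : ℝ} (hτ : 0 ≤ τ) : 0 < relaxation ρ τ := by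
  have hpos : ∀ y, 0 < Real.exp (-(τ * Real.exp y)) * relaxDensity ρ y := fun y =>
    mul_pos (Real.exp_pos _) (relaxDensity_pos hρ y)
  rw [relaxation, integral_pos_iff_support_of_nonneg (fun y => (hpos y).le)
    (integrable_relaxation hρ hτ), eq_univ_of_forall (s := Function.support _) fun y => (hpos y).ne']
  simp

lemma strictAntiOn_relaxation (hρ : ρ ∈ Ioo (0 : ℝ) 1) : StrictAntiOn (relaxation ρ) (Ici 0) := by
  intro a ha b hb hab
  have hpos : ∀ y, 0 < Real.exp (-(a * Real.exp y)) * relaxDensity ρ y -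
      Real.exp (-(b * Real.exp y)) * relaxDensity ρ y := fun y => by
    rw [← sub_mul]
    refine mul_pos (sub_pos.2 (Real.exp_lt_exp.2 ?_)) (relaxDensity_pos hρ y)
    have := Real.exp_pos y
    nlinarith
  rw [← sub_pos, relaxation, relaxation, ← integral_sub (integrable_relaxation hρ ha)
    (integrable_relaxation hρ hb), integral_pos_iff_support_of_nonneg (fun y => (hpos y).le)
    ((integrable_relaxation hρ ha).sub (integrable_relaxation hρ hb)),
    eq_univ_of_forall (s := Function.support _) fun y => (hpos y).ne']
  simp

lemma relaxation_le_one (hρ : ρ ∈ Ioo (0 : ℝ) 1) {τ : ℝ} (hτ : 0 ≤ τ) : relaxation ρ τ ≤ 1 := by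
  rw [← relaxation_zero hρ]
  exact (strictAntiOn_relaxation hρ).antitoneOn self_mem_Ici hτ hτ

lemma continuousOn_relaxation (hρ : ρ ∈ Ioo (0 : ℝ) 1) : ContinuousOn (relaxation ρ) (Ici 0) := by
  unfold relaxation
  refine continuousOn_of_dominated (bound := relaxDensity ρ) ?_ ?_ (integrable_relaxDensity hρ) ?_
  · intro τ hτ
    exact (integrable_relaxation hρ hτ).aestronglyMeasurable
  · intro τ hτ
    refine Eventually.of_forall fun y => ?_
    rw [Real.norm_of_nonneg (mul_pos (Real.exp_pos _) (relaxDensity_pos hρ y)).le]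
    refine mul_le_of_le_one_left (relaxDensity_pos hρ y).le ?_
    rw [Real.exp_le_one_iff]
    have := mul_nonneg (mem_Ici.1 hτ) (Real.exp_pos y).le
    linarith
  · exact Eventually.of_forall fun y => by fun_prop

lemma mul_exp_neg_mul_le_one (x : ℝ) : x * Real.exp (-x) ≤ 1 := by
  rw [Real.exp_neg]
  have := Real.add_one_le_exp x
  rw [← div_eq_mul_inv, div_le_one (Real.exp_pos x)]
  linarith

/-- Near τ one has x > τ/2, and u e^{-u} ≤ 1 gives e^y exp(-x e^y) ≤ 1/x ≤ 2/τ, a bound independent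
of y. -/
lemma exists_hasDerivAt_relaxation (hρ : ρ ∈ Ioo (0 : ℝ) 1) {τ : ℝ} (hτ : 0 < τ) :
    HasDerivAt (relaxation ρ)
      (∫ y, -(Real.exp y * Real.exp (-(τ * Real.exp y))) * relaxDensity ρ y) τ ∧
    Integrable fun y => -(Real.exp y * Real.exp (-(τ * Real.exp y))) * relaxDensity ρ y := by
  have hc := continuous_relaxDensity hρ
  have h := hasDerivAt_integral_of_dominated_loc_of_deriv_le (μ := volume)
    (F := fun τ y => Real.exp (-(τ * Real.exp y)) * relaxDensity ρ y)
    (F' := fun τ y => -(Real.exp y * Real.exp (-(τ * Real.exp y))) * relaxDensity ρ y)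
    (bound := fun y => (2 / τ) * relaxDensity ρ y) (Ioi_mem_nhds (half_lt_self hτ))
    (Eventually.of_forall fun x => (by fun_prop : Continuous _).aestronglyMeasurable)
    (integrable_relaxation hρ hτ.le) ((by fun_prop : Continuous _).aestronglyMeasurable)
    (Eventually.of_forall fun y x hx => ?_) ((integrable_relaxDensity hρ).const_mul _)
    (Eventually.of_forall fun y x hx => ?_)
  · exact ⟨h.2, h.1⟩
  · have hx0 : 0 < x := lt_trans (half_pos hτ) hx
    rw [norm_mul, norm_neg, Real.norm_of_nonneg (relaxDensity_pos hρ y).le,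
      Real.norm_of_nonneg (by positivity)]
    refine mul_le_mul_of_nonneg_right ?_ (relaxDensity_pos hρ y).le
    have h1 := mul_exp_neg_mul_le_one (x * Real.exp y)
    rw [le_div_iff₀ hτ]
    have hx' : τ / 2 < x := hx
    have h3 : 0 < Real.exp y * Real.exp (-(x * Real.exp y)) := by positivity
    nlinarith
  · have := (((hasDerivAt_id x).mul_const (Real.exp y)).neg.exp).mul_const (relaxDensity ρ y)
    refine HasDerivAt.congr_deriv this ?_
    simp only [Pi.neg_apply, id]
    ring

lemma hasDerivAt_relaxation (hρ : ρ ∈ Ioo (0 : ℝ) 1) {τ : ℝ} (hτ : 0 < τ) :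
    HasDerivAt (relaxation ρ) (deriv (relaxation ρ) τ) τ :=
  (exists_hasDerivAt_relaxation hρ hτ).1.differentiableAt.hasDerivAt

lemma deriv_relaxation_nonpos (hρ : ρ ∈ Ioo (0 : ℝ) 1) {τ : ℝ} (hτ : 0 < τ) :
    deriv (relaxation ρ) τ ≤ 0 := by
  rw [(exists_hasDerivAt_relaxation hρ hτ).1.deriv]
  refine integral_nonpos fun y => ?_
  have := relaxDensity_pos hρ y
  have : 0 ≤ Real.exp y * Real.exp (-(τ * Real.exp y)) * relaxDensity ρ y := by positivity
  simp only [Pi.zero_apply]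
  linarith

lemma mul_abs_deriv_relaxation_le (hρ : ρ ∈ Ioo (0 : ℝ) 1) {τ : ℝ} (hτ : 0 < τ) :
    τ * |deriv (relaxation ρ) τ| ≤ 1 := by
  obtain ⟨h1, h2⟩ := exists_hasDerivAt_relaxation hρ hτ
  rw [abs_of_nonpos (deriv_relaxation_nonpos hρ hτ), h1.deriv, ← integral_neg, ← integral_const_mul,
    ← integral_relaxDensity hρ]
  refine integral_mono (h2.neg.const_mul τ) (integrable_relaxDensity hρ) fun y => ?_
  have h3 := mul_exp_neg_mul_le_one (τ * Real.exp y)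
  have h4 := relaxDensity_pos hρ y
  simp only
  nlinarith

lemma integrable_exp_neg_exp_mul_exp (hρ : ρ ∈ Ioo (0 : ℝ) 1) :
    Integrable fun y => Real.exp (-Real.exp y) * Real.exp (ρ * y) := by
  rw [← integrableOn_univ, ← Iic_union_Ioi (a := (0 : ℝ))]
  refine IntegrableOn.union ?_ ?_
  · refine Integrable.mono' (integrableOn_exp_mul_Iic hρ.1 0)
      (by fun_prop : Continuous _).aestronglyMeasurable (Eventually.of_forall fun y => ?_)
    rw [Real.norm_of_nonneg (by positivity)]
    exact mul_le_of_le_one_left (by positivity) (by simp [Real.exp_nonneg])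
  · refine Integrable.mono' (integrableOn_exp_mul_Ioi (a := ρ - 1) (by linarith [hρ.2]) 0)
      (by fun_prop : Continuous _).aestronglyMeasurable (Eventually.of_forall fun y => ?_)
    rw [Real.norm_of_nonneg (by positivity), ← Real.exp_add, Real.exp_le_exp]
    linarith [Real.add_one_le_exp y]

/-- With the density replaced by its bound C e^{ρy}, the shift y ↦ y + log τ takes out exactly the
factor τ^{-ρ}. -/
lemma exists_rpow_mul_relaxation_le (hρ : ρ ∈ Ioo (0 : ℝ) 1) :
    ∃ C, 0 < C ∧ ∀ τ, 0 ≤ τ → τ ^ ρ * relaxation ρ τ ≤ C := by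
  obtain ⟨C, hC, hle⟩ := exists_relaxDensity_le hρ
  have hint := integrable_exp_neg_exp_mul_exp hρ
  set K := ∫ y, Real.exp (-Real.exp y) * Real.exp (ρ * y) with hK
  have hK0 : 0 ≤ K := integral_nonneg fun y => by positivity
  refine ⟨C * K + 1, by positivity, fun τ hτ => ?_⟩
  rcases hτ.eq_or_lt with rfl | hτ
  · rw [Real.zero_rpow hρ.1.ne', zero_mul]; positivity
  have hshift : ∀ y, Real.exp (-(τ * Real.exp y)) * Real.exp (ρ * y) =
      τ ^ (-ρ) * (Real.exp (-Real.exp (y + Real.log τ)) * Real.exp (ρ * (y + Real.log τ))) := by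
    intro y
    rw [Real.exp_add, Real.exp_log hτ, Real.rpow_def_of_pos hτ, ← Real.exp_add, ← Real.exp_add,
      ← Real.exp_add]
    congr 1
    ring
  have h1 : relaxation ρ τ ≤ C * (τ ^ (-ρ) * K) := by
    have hKs : τ ^ (-ρ) * K = ∫ y, Real.exp (-(τ * Real.exp y)) * Real.exp (ρ * y) := by
      rw [integral_congr_ae (Eventually.of_forall hshift), integral_const_mul,
        integral_add_right_eq_self (fun y => Real.exp (-Real.exp y) * Real.exp (ρ * y))]
    rw [hKs, ← integral_const_mul]
    refine integral_mono (integrable_relaxation hρ hτ.le) ?_ fun y => ?_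
    · refine Integrable.const_mul ?_ _
      rw [integrable_congr (Eventually.of_forall hshift)]
      exact (hint.comp_add_right (Real.log τ)).const_mul _
    · have := mul_le_mul_of_nonneg_left (hle y) (Real.exp_pos (-(τ * Real.exp y))).le
      simp only
      linarith
  calc τ ^ ρ * relaxation ρ τ ≤ τ ^ ρ * (C * (τ ^ (-ρ) * K)) := by gcongr
    _ = C * K := by
        rw [Real.rpow_neg hτ.le]
        have := Real.rpow_pos_of_pos hτ ρ
        field_simp
    _ ≤ _ := by linarith

/-- The Laplace transform of the relaxation function. -/
theorem integral_exp_mul_relaxation (hρ : ρ ∈ Ioo (0 : ℝ) 1) {s : ℝ} (hs : 0 < s) :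
    ∫ τ in Ioi 0, Real.exp (-(s * τ)) * relaxation ρ τ = s⁻¹ * (1 + s ^ (-ρ))⁻¹ := by
  have hc := continuous_relaxDensity hρ
  have hexp : IntegrableOn (fun τ => Real.exp (-(s * τ))) (Ioi 0) := by
    simpa using integrableOn_exp_mul_Ioi (a := -s) (by linarith) 0
  have hprod : Integrable (Function.uncurry fun τ y : ℝ =>
      Real.exp (-(s * τ)) * (Real.exp (-(τ * Real.exp y)) * relaxDensity ρ y))
      ((volume.restrict (Ioi 0)).prod volume) := by
    refine Integrable.mono' (hexp.mul_prod (integrable_relaxDensity hρ))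
      (by fun_prop : Continuous _).aestronglyMeasurable ?_
    have hmem : ∀ᵐ p : ℝ × ℝ ∂((volume.restrict (Ioi (0 : ℝ))).prod volume), p.1 ∈ Ioi (0 : ℝ) :=
      Measure.quasiMeasurePreserving_fst.ae (ae_restrict_mem measurableSet_Ioi)
    filter_upwards [hmem] with p hp
    have hq := relaxDensity_pos hρ p.2
    simp only [Function.uncurry]
    rw [Real.norm_of_nonneg (by positivity)]
    refine mul_le_mul_of_nonneg_left (mul_le_of_le_one_left hq.le ?_) (by positivity)
    rw [Real.exp_le_one_iff]
    have := mul_pos (mem_Ioi.1 hp) (Real.exp_pos p.2)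
    linarith
  -- The inner integral is 1/(s + e^y), written through (1 + e^{log s - y})⁻¹ so that the Stieltjes
  -- transform applies at x = log s.
  have hinner : ∀ y, ∫ τ in Ioi (0 : ℝ), Real.exp (-(s * τ)) *
      (Real.exp (-(τ * Real.exp y)) * relaxDensity ρ y) =
      s⁻¹ * (relaxDensity ρ y - relaxDensity ρ y * (1 + Real.exp (Real.log s - y))⁻¹) := by
    intro y
    have hy := Real.exp_pos y
    have h1 : ∀ τ : ℝ, Real.exp (-(s * τ)) * (Real.exp (-(τ * Real.exp y)) * relaxDensity ρ y) =
        relaxDensity ρ y * Real.exp (-(s + Real.exp y) * τ) := by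
      intro τ
      rw [← mul_assoc, ← Real.exp_add, mul_comm]
      congr 2; ring
    simp_rw [h1]
    rw [integral_const_mul, integral_exp_mul_Ioi (by linarith), Real.exp_sub, Real.exp_log hs]
    simp only [mul_zero, Real.exp_zero]
    field_simp
    ring
  simp_rw [relaxation, ← integral_const_mul]
  rw [integral_integral_swap hprod]
  simp_rw [hinner]
  rw [integral_const_mul, integral_sub (integrable_relaxDensity hρ), integral_relaxDensity hρ,
    integral_relaxDensity_mul_logistic hρ, Real.rpow_def_of_pos hs]
  · congr 1
    rw [sub_sub_cancel]
    congr 3; ring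
  · refine (integrable_relaxDensity hρ).mul_bdd (c := 1) ?_ (Eventually.of_forall fun y => ?_)
    · refine (Continuous.inv₀ (by fun_prop) fun y => ?_).aestronglyMeasurable
      positivity
    · rw [Real.norm_of_nonneg (by positivity)]
      exact inv_le_one_of_one_le₀ (by linarith [Real.exp_pos (Real.log s - y)])

/-- An integrable function on the half-line is determined by its Laplace transform at the natural
numbers. -/
theorem ae_eq_zero_of_laplace_eq_zero {f : ℝ → ℝ} (hf : IntegrableOn f (Ioi 0))
    (h : ∀ n : ℕ, ∫ τ in Ioi 0, Real.exp (-τ) ^ n * f τ = 0) : ∀ᵐ τ, τ ∈ Ioi (0 : ℝ) → f τ = 0 := by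
  have hbd : ∀ g : ℝ → ℝ, ContinuousOn g (Icc 0 1) → IntegrableOn (fun τ => g (Real.exp (-τ)) * f τ) (Ioi 0) := by
    intro g hg
    obtain ⟨C, hC⟩ := isCompact_Icc.exists_bound_of_continuousOn hg
    have hmem : ∀ τ ∈ Ioi (0 : ℝ), Real.exp (-τ) ∈ Icc (0 : ℝ) 1 := fun τ hτ =>
      ⟨(Real.exp_pos _).le, Real.exp_le_one_iff.2 (by linarith [mem_Ioi.1 hτ])⟩
    refine Integrable.bdd_mul (c := C) hf ?_ ?_
    · exact ContinuousOn.aestronglyMeasurable (hg.comp (by fun_prop) hmem) measurableSet_Ioi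
    · filter_upwards [ae_restrict_mem measurableSet_Ioi] with τ hτ using hC _ (hmem τ hτ)
  have hpoly : ∀ p : Polynomial ℝ, ∫ τ in Ioi 0, p.eval (Real.exp (-τ)) * f τ = 0 := by
    intro p
    simp_rw [Polynomial.eval_eq_sum_range, Finset.sum_mul]
    rw [integral_finsetSum]
    · refine Finset.sum_eq_zero fun n _ => ?_
      simp_rw [mul_assoc]
      rw [integral_const_mul, h, mul_zero]
    · intro n _
      exact hbd (fun x => p.coeff n * x ^ n) (by fun_prop)
  -- Under x = e^{-τ} the hypotheses are the moments of f, so Weierstrass approximation passes from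
  -- polynomials to continuous functions on [0, 1].
  have hcont : ∀ g : ℝ → ℝ, ContinuousOn g (Icc 0 1) → ∫ τ in Ioi 0, g (Real.exp (-τ)) * f τ = 0 := by
    intro g hg
    set M := ∫ τ in Ioi 0, ‖f τ‖ with hM
    have hM0 : 0 ≤ M := integral_nonneg fun _ => norm_nonneg _
    rw [← norm_le_zero_iff]
    refine le_of_forall_pos_le_add fun ε hε => ?_
    obtain ⟨p, hp⟩ := exists_polynomial_near_of_continuousOn 0 1 g hg (ε / (M + 1)) (by positivity)
    have h1 : ∫ τ in Ioi 0, g (Real.exp (-τ)) * f τ =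
        ∫ τ in Ioi 0, (g (Real.exp (-τ)) * f τ - p.eval (Real.exp (-τ)) * f τ) := by
      rw [integral_sub (hbd g hg) (hbd _ p.continuous.continuousOn), hpoly, sub_zero]
    rw [h1, zero_add]
    calc _ ≤ ∫ τ in Ioi 0, ε / (M + 1) * ‖f τ‖ := by
          refine norm_integral_le_of_norm_le (hf.norm.const_mul _) ?_
          filter_upwards [ae_restrict_mem measurableSet_Ioi] with τ hτ
          rw [← sub_mul, norm_mul]
          refine mul_le_mul_of_nonneg_right ?_ (norm_nonneg _)
          rw [norm_sub_rev]
          exact (hp _ ⟨(Real.exp_pos _).le, Real.exp_le_one_iff.2 (by linarith [mem_Ioi.1 hτ])⟩).le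
      _ = ε / (M + 1) * M := integral_const_mul _ _
      _ ≤ ε := by
          rw [div_mul_eq_mul_div, div_le_iff₀ (by positivity)]
          nlinarith
  refine isOpen_Ioi.ae_eq_zero_of_integral_contDiff_smul_eq_zero hf.locallyIntegrableOn ?_
  intro g hg hgc hgs
  obtain ⟨B, hB⟩ := hgc.isCompact.bddAbove
  have hzero : ∀ u, u ∉ tsupport g → g u = 0 := fun u hu => image_eq_zero_of_notMem_tsupport hu
  -- Near x = 0 the function vanishes: -log x leaves the bounded support of g. At x = 0 itself
  -- `Real.log 0 = 0`, and 0 is outside the support, which lies in (0, ∞).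
  have hcg : ContinuousOn (fun x => g (-Real.log x)) (Icc 0 1) := by
    intro x hx
    rcases hx.1.eq_or_lt with rfl | hx0
    · refine ContinuousAt.continuousWithinAt ?_
      have : (fun x => g (-Real.log x)) =ᶠ[𝓝 0] fun _ => 0 := by
        filter_upwards [Metric.ball_mem_nhds (0 : ℝ) (lt_min one_pos (Real.exp_pos (-B)))] with x hx
        rw [Metric.mem_ball, dist_zero_right, Real.norm_eq_abs] at hx
        apply hzero
        intro hmem
        have h1 := hB hmem
        rcases eq_or_ne x 0 with rfl | hx0
        · have := hgs hmem
          simp at this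
        · have h2 : Real.log |x| < -B := by
            rw [Real.log_lt_iff_lt_exp (abs_pos.2 hx0)]
            exact hx.trans_le (min_le_right _ _)
          rw [Real.log_abs] at h2
          linarith
      exact ContinuousAt.congr continuousAt_const this.symm
    · exact ((hg.continuous.continuousAt).comp (Real.continuousAt_log hx0.ne').neg).continuousWithinAt
  have h2 := hcont _ hcg
  simp only [Real.log_exp, neg_neg] at h2
  rw [← h2]
  symm
  apply setIntegral_eq_integral_of_forall_compl_eq_zero
  intro x hx
  rw [hzero x (fun h => hx (hgs h)), zero_mul]

end

/-! ### Identification with the Mittag-Leffler series, and the scalar equation. -/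

section

variable {ρ : ℝ}

/-- The Gamma integral restricted to u > R. The free parameter R yields geometric majorants of the
Mittag-Leffler series with any prescribed ratio, and majorants uniform in ρ. -/
lemma exp_neg_mul_rpow_le_Gamma {R x : ℝ} (hR : 0 < R) (hx : 0 ≤ x) :
    Real.exp (-R) * R ^ x ≤ Real.Gamma (x + 1) := by
  have hconv := Real.GammaIntegral_convergent (s := x + 1) (by linarith)
  rw [Real.Gamma_eq_integral (by linarith)]
  calc Real.exp (-R) * R ^ x = ∫ u in Ioi R, Real.exp (-u) * R ^ x := by
        rw [integral_mul_const, integral_exp_neg_Ioi]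
    _ ≤ ∫ u in Ioi R, Real.exp (-u) * u ^ (x + 1 - 1) := by
        refine setIntegral_mono_on ?_ (hconv.mono_set (Ioi_subset_Ioi hR.le)) measurableSet_Ioi ?_
        · have : IntegrableOn (fun u => Real.exp (-u)) (Ioi R) := by
            simpa using integrableOn_exp_mul_Ioi (a := -1) (by norm_num) R
          exact this.mul_const _
        · intro u hu
          rw [add_sub_cancel_right]
          have hu' : R < u := hu
          gcongr
    _ ≤ ∫ u in Ioi 0, Real.exp (-u) * u ^ (x + 1 - 1) := by
        refine setIntegral_mono_set hconv ?_ (Ioi_subset_Ioi hR.le).eventuallyLE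
        filter_upwards [ae_restrict_mem measurableSet_Ioi] with u hu
        have hu' : 0 < u := hu
        simp only [Pi.zero_apply]
        positivity

lemma Gamma_mul_nat_add_one_pos (hρ : 0 ≤ ρ) (k : ℕ) : 0 < Real.Gamma (ρ * k + 1) :=
  Real.Gamma_pos_of_pos (by positivity)

lemma pow_div_Gamma_le (hρ : 0 ≤ ρ) {R B : ℝ} (hR : 0 < R) (hB : 0 ≤ B) (k : ℕ) :
    B ^ k / Real.Gamma (ρ * k + 1) ≤ Real.exp R * (B / R ^ ρ) ^ k := by
  have h := exp_neg_mul_rpow_le_Gamma hR (by positivity : 0 ≤ ρ * k)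
  have hRk : R ^ (ρ * k) = (R ^ ρ) ^ k := by rw [Real.rpow_mul hR.le, Real.rpow_natCast]
  rw [hRk] at h
  have hp : 0 < R ^ ρ := Real.rpow_pos_of_pos hR ρ
  calc B ^ k / Real.Gamma (ρ * k + 1) ≤ B ^ k / (Real.exp (-R) * (R ^ ρ) ^ k) := by gcongr
    _ = _ := by rw [Real.exp_neg, div_pow]; field_simp

lemma summable_pow_div_Gamma (hρ : 0 < ρ) {B : ℝ} (hB : 0 ≤ B) :
    Summable fun k : ℕ => B ^ k / Real.Gamma (ρ * k + 1) := by
  -- Chosen so that R^ρ = 2B + 1 and the ratio B / R^ρ is below 1.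
  set R := (2 * B + 1) ^ (1 / ρ) with hR
  have hR0 : 0 < R := Real.rpow_pos_of_pos (by linarith) _
  have hRρ : R ^ ρ = 2 * B + 1 := by
    rw [hR, ← Real.rpow_mul (by linarith), one_div_mul_cancel hρ.ne', Real.rpow_one]
  refine Summable.of_nonneg_of_le (fun k => ?_) (fun k => pow_div_Gamma_le hρ.le hR0 hB k) ?_
  · have := Gamma_mul_nat_add_one_pos hρ.le k
    positivity
  · refine (summable_geometric_of_lt_one ?_ ?_).mul_left _ <;> rw [hRρ]
    · positivity
    · rw [div_lt_one (by linarith)]; linarith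

lemma norm_pow_div_Gamma_le (hρ : 0 ≤ ρ) {z B : ℝ} (hz : |z| ≤ B) (k : ℕ) :
    ‖z ^ k / Real.Gamma (ρ * k + 1)‖ ≤ B ^ k / Real.Gamma (ρ * k + 1) := by
  have h := Gamma_mul_nat_add_one_pos hρ k
  rw [norm_div, norm_pow, Real.norm_of_nonneg h.le, Real.norm_eq_abs]
  gcongr

lemma summable_mittagLeffler (hρ : 0 < ρ) (z : ℝ) :
    Summable fun k : ℕ => z ^ k / Real.Gamma (ρ * k + 1) :=
  Summable.of_norm_bounded (summable_pow_div_Gamma hρ (abs_nonneg z)) fun k =>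
    norm_pow_div_Gamma_le hρ.le le_rfl k

lemma continuous_mittagLeffler (hρ : 0 < ρ) : Continuous (mittagLeffler ρ) := by
  rw [continuous_iff_continuousAt]
  intro z
  have h : ContinuousOn (mittagLeffler ρ) (Metric.ball 0 (|z| + 1)) := by
    refine continuousOn_tsum (fun k => by fun_prop)
      (summable_pow_div_Gamma hρ (by positivity : 0 ≤ |z| + 1)) fun k x hx => ?_
    refine norm_pow_div_Gamma_le hρ.le ?_ k
    simpa using (Metric.mem_ball.1 hx).le
  exact h.continuousAt (Metric.isOpen_ball.mem_nhds (by simp))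

lemma integrableOn_exp_mul_rpow {s a : ℝ} (hs : 0 < s) (ha : 0 < a) :
    IntegrableOn (fun τ : ℝ => Real.exp (-(s * τ)) * τ ^ (a - 1)) (Ioi 0) := by
  -- The Bochner integral of a non-integrable function is 0, so a nonzero value proves
  -- integrability. The same device recurs below.
  refine Integrable.of_integral_ne_zero ?_
  simp_rw [mul_comm (Real.exp _)]
  rw [Real.integral_rpow_mul_exp_neg_mul_Ioi ha hs]
  have := Real.Gamma_pos_of_pos ha
  positivity

lemma rpow_pow_eq {τ : ℝ} (hτ : 0 ≤ τ) (ρ : ℝ) (k : ℕ) : (τ ^ ρ) ^ k = τ ^ (ρ * k) := by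
  rw [Real.rpow_mul hτ, Real.rpow_natCast]

/-- The Laplace transform of the terms of the Mittag-Leffler series. -/
lemma integral_exp_mul_term (hρ : 0 < ρ) {s : ℝ} (hs : 0 < s) (c : ℝ) (k : ℕ) :
    IntegrableOn (fun τ : ℝ => Real.exp (-(s * τ)) *
      ((c * τ ^ ρ) ^ k / Real.Gamma (ρ * k + 1))) (Ioi 0) ∧
    ∫ τ in Ioi (0 : ℝ), Real.exp (-(s * τ)) * ((c * τ ^ ρ) ^ k / Real.Gamma (ρ * k + 1)) =
      s⁻¹ * (c * s ^ (-ρ)) ^ k := by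
  have hG := Gamma_mul_nat_add_one_pos hρ.le k
  have hpos : 0 < ρ * k + 1 := by positivity
  have heq : EqOn (fun τ : ℝ => Real.exp (-(s * τ)) * ((c * τ ^ ρ) ^ k / Real.Gamma (ρ * k + 1)))
      (fun τ => c ^ k / Real.Gamma (ρ * k + 1) * (Real.exp (-(s * τ)) * τ ^ (ρ * k + 1 - 1)))
      (Ioi 0) := by
    intro τ hτ
    simp only
    rw [mul_pow, rpow_pow_eq (le_of_lt hτ), add_sub_cancel_right]
    ring
  constructor
  · exact IntegrableOn.congr_fun ((integrableOn_exp_mul_rpow hs hpos).const_mul _) heq.symm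
      measurableSet_Ioi
  · rw [setIntegral_congr_fun measurableSet_Ioi heq, integral_const_mul]
    simp_rw [mul_comm (Real.exp _)]
    rw [Real.integral_rpow_mul_exp_neg_mul_Ioi hpos hs, mul_pow, rpow_pow_eq hs.le,
      Real.rpow_add (by positivity), Real.rpow_one, one_div, Real.inv_rpow hs.le,
      ← Real.rpow_neg hs.le, ← neg_mul]
    field_simp

lemma rpow_neg_lt_one (hρ : 0 < ρ) {s : ℝ} (hs : 1 < s) : s ^ (-ρ) < 1 :=
  Real.rpow_lt_one_of_one_lt_of_neg hs (by linarith)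

/-- Termwise the transform is a geometric series in ±s^{-ρ}, convergent for s > 1. The plus sign
also gives the integrals of the absolute values, which justify the exchange of sum and integral. -/
lemma hasSum_laplace_mittagLeffler (hρ : 0 < ρ) {s : ℝ} (hs : 1 < s) :
    IntegrableOn (fun τ => Real.exp (-(s * τ)) * mittagLeffler ρ (τ ^ ρ)) (Ioi 0) ∧
    ∫ τ in Ioi (0 : ℝ), Real.exp (-(s * τ)) * mittagLeffler ρ (-τ ^ ρ) =
      s⁻¹ * (1 + s ^ (-ρ))⁻¹ := by
  have hs0 : 0 < s := by linarith
  have hr0 : 0 < s ^ (-ρ) := Real.rpow_pos_of_pos hs0 _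
  have hr1 := rpow_neg_lt_one hρ hs
  have hgen : ∀ c : ℝ, |c| = 1 →
      HasSum (fun k : ℕ => s⁻¹ * (c * s ^ (-ρ)) ^ k)
        (∫ τ in Ioi (0 : ℝ), Real.exp (-(s * τ)) * mittagLeffler ρ (c * τ ^ ρ)) := by
    intro c hc
    have h := hasSum_integral_of_summable_integral_norm (μ := volume.restrict (Ioi (0 : ℝ)))
      (F := fun (k : ℕ) τ => Real.exp (-(s * τ)) * ((c * τ ^ ρ) ^ k / Real.Gamma (ρ * k + 1)))
      (fun k => (integral_exp_mul_term hρ hs0 c k).1) ?_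
    · simp only [(integral_exp_mul_term hρ hs0 c _).2, tsum_mul_left] at h
      exact h
    · have hn : ∀ k : ℕ, ∫ τ in Ioi (0 : ℝ), ‖Real.exp (-(s * τ)) *
          ((c * τ ^ ρ) ^ k / Real.Gamma (ρ * k + 1))‖ = s⁻¹ * (s ^ (-ρ)) ^ k := by
        intro k
        rw [← one_mul (s ^ (-ρ)), ← (integral_exp_mul_term hρ hs0 1 k).2]
        refine setIntegral_congr_fun measurableSet_Ioi fun τ hτ => ?_
        have := Gamma_mul_nat_add_one_pos hρ.le k
        have hτ' := Real.rpow_pos_of_pos (mem_Ioi.1 hτ) ρ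
        simp only [norm_mul, norm_div, norm_pow, Real.norm_eq_abs, hc, Real.abs_exp, one_mul,
          abs_of_pos this, abs_of_pos hτ']
      simp_rw [hn]
      exact (summable_geometric_of_lt_one hr0.le hr1).mul_left _
  constructor
  · refine Integrable.of_integral_ne_zero ?_
    have h1 := hgen 1 (by simp)
    simp only [one_mul] at h1
    rw [← h1.tsum_eq, tsum_mul_left, tsum_geometric_of_lt_one hr0.le hr1]
    have : 0 < 1 - s ^ (-ρ) := by linarith
    positivity
  · have h1 := hgen (-1) (by simp)
    simp only [neg_one_mul] at h1
    rw [← h1.tsum_eq, tsum_mul_left, tsum_geometric_of_abs_lt_one (by rwa [abs_neg, abs_of_pos hr0]),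
      sub_neg_eq_add]

/-- The Mittag-Leffler function on the negative half-line as a Laplace transform. -/
theorem mittagLeffler_neg_rpow (hρ : ρ ∈ Ioo (0 : ℝ) 1) {τ : ℝ} (hτ : 0 ≤ τ) :
    mittagLeffler ρ (-τ ^ ρ) = relaxation ρ τ := by
  have hml0 : mittagLeffler ρ 0 = 1 := by
    rw [mittagLeffler, tsum_eq_single 0]
    · simp
    · intro k hk; simp [hk]
  rcases hτ.eq_or_lt with rfl | hτ
  · rw [Real.zero_rpow hρ.1.ne', neg_zero, hml0, relaxation_zero hρ]
  have hcm : Continuous (mittagLeffler ρ) := continuous_mittagLeffler hρ.1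
  have hcr : Continuous fun τ : ℝ => τ ^ ρ := Real.continuous_rpow_const hρ.1.le
  have hrel : ∀ s : ℝ, 0 < s → IntegrableOn (fun τ => Real.exp (-(s * τ)) * relaxation ρ τ) (Ioi 0) := by
    intro s hs
    refine Integrable.of_integral_ne_zero ?_
    rw [integral_exp_mul_relaxation hρ hs]
    positivity
  have hml : ∀ s : ℝ, 1 < s → IntegrableOn (fun τ => Real.exp (-(s * τ)) * mittagLeffler ρ (-τ ^ ρ)) (Ioi 0) := by
    intro s hs
    refine Integrable.of_integral_ne_zero ?_
    rw [(hasSum_laplace_mittagLeffler hρ.1 hs).2]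
    positivity
  -- The factor e^{-2τ} moves the natural numbers n to s = n + 2, where the transform of the series
  -- is known.
  set f : ℝ → ℝ := fun τ => Real.exp (-(2 * τ)) * (mittagLeffler ρ (-τ ^ ρ) - relaxation ρ τ) with hf
  have hint : IntegrableOn f (Ioi 0) := by
    have := (hml 2 (by norm_num)).sub (hrel 2 (by norm_num))
    refine this.congr (Eventually.of_forall fun τ => ?_)
    simp only [hf, Pi.sub_apply]; ring
  have hzero : ∀ᵐ τ, τ ∈ Ioi (0 : ℝ) → f τ = 0 := by
    refine ae_eq_zero_of_laplace_eq_zero hint fun n => ?_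
    have hs : (1 : ℝ) < 2 + n := by
      have : (0 : ℝ) ≤ n := n.cast_nonneg
      linarith
    have h1 : ∀ τ : ℝ, Real.exp (-τ) ^ n * f τ = Real.exp (-((2 + n) * τ)) * mittagLeffler ρ (-τ ^ ρ) -
        Real.exp (-((2 + n) * τ)) * relaxation ρ τ := by
      intro τ
      have : Real.exp (-((2 + n) * τ)) = Real.exp (-τ) ^ n * Real.exp (-(2 * τ)) := by
        rw [← Real.exp_nat_mul, ← Real.exp_add]; congr 1; ring
      rw [this, hf]; ring
    simp_rw [h1]
    rw [integral_sub (hml _ hs) (hrel _ (by linarith)), (hasSum_laplace_mittagLeffler hρ.1 hs).2,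
      integral_exp_mul_relaxation hρ (by linarith), sub_self]
  have hae : (fun τ : ℝ => mittagLeffler ρ (-τ ^ ρ)) =ᵐ[volume.restrict (Ioi 0)] relaxation ρ := by
    rw [EventuallyEq, ae_restrict_iff' measurableSet_Ioi]
    filter_upwards [hzero] with τ h hτ
    have := (mul_eq_zero.1 (h hτ)).resolve_left (Real.exp_pos _).ne'
    linarith
  exact Measure.eqOn_open_of_ae_eq hae isOpen_Ioi (hcm.comp hcr.neg).continuousOn
    ((continuousOn_relaxation hρ).mono Ioi_subset_Ici_self) hτ

lemma mittagLeffler_neg_mul_rpow (hρ : ρ ∈ Ioo (0 : ℝ) 1) {c t : ℝ} (hc : 0 ≤ c) (ht : 0 ≤ t) :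
    mittagLeffler ρ (-(c * t ^ ρ)) = relaxation ρ (c ^ (1 / ρ) * t) := by
  rw [← mittagLeffler_neg_rpow hρ (by positivity), Real.mul_rpow (by positivity) ht,
    ← Real.rpow_mul hc, one_div_mul_cancel hρ.1.ne', Real.rpow_one]

lemma integral_rpow_mul_rpow_sub {a b t : ℝ} (ha : 0 < a) (hb : 0 < b) (ht : 0 < t) :
    ∫ s in Ioo 0 t, (t - s) ^ (b - 1) * s ^ (a - 1) =
      t ^ (a + b - 1) * (Real.Gamma a * Real.Gamma b / Real.Gamma (a + b)) := by
  have h := Complex.betaIntegral_scaled a b ht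
  rw [Complex.betaIntegral_eq_Gamma_mul_div _ _ (by simpa) (by simpa)] at h
  have h2 : ∫ s in (0 : ℝ)..t, (s : ℂ) ^ ((a : ℂ) - 1) * ((t : ℂ) - s) ^ ((b : ℂ) - 1) =
      ((∫ s in Ioo 0 t, (t - s) ^ (b - 1) * s ^ (a - 1) : ℝ) : ℂ) := by
    rw [intervalIntegral.integral_of_le ht.le, integral_Ioc_eq_integral_Ioo, ← integral_complex_ofReal]
    refine setIntegral_congr_fun measurableSet_Ioo fun s hs => ?_
    have h1 : 0 ≤ t - s := by linarith [hs.2]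
    push_cast
    rw [Complex.ofReal_cpow hs.1.le, Complex.ofReal_cpow h1]
    push_cast
    ring
  rw [h2, ← Complex.ofReal_add, Complex.Gamma_ofReal, Complex.Gamma_ofReal, Complex.Gamma_ofReal] at h
  have h3 : ((t : ℂ) ^ (((a + b : ℝ) : ℂ) - 1)) = ((t ^ (a + b - 1) : ℝ) : ℂ) := by
    rw [Complex.ofReal_cpow ht.le]; push_cast; rfl
  rw [h3] at h
  exact_mod_cast h

lemma integrableOn_rpow_mul_rpow_sub {a b t : ℝ} (ha : 0 < a) (hb : 0 < b) (ht : 0 < t) :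
    IntegrableOn (fun s => (t - s) ^ (b - 1) * s ^ (a - 1)) (Ioo 0 t) := by
  refine Integrable.of_integral_ne_zero ?_
  rw [integral_rpow_mul_rpow_sub ha hb ht]
  have := Real.Gamma_pos_of_pos ha
  have := Real.Gamma_pos_of_pos hb
  have := Real.Gamma_pos_of_pos (add_pos ha hb)
  positivity

lemma hasSum_deriv_relaxation (hρ : ρ ∈ Ioo (0 : ℝ) 1) {t : ℝ} (ht : 0 < t) :
    deriv (relaxation ρ) t =
      ∑' k : ℕ, (-1) ^ k * (ρ * k) * t ^ (ρ * k - 1) / Real.Gamma (ρ * k + 1) := by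
  have hρ0 := hρ.1
  -- (2t)^ρ bounds the powers on (t/2, 2t), and the factor 2 absorbs the k from differentiation
  -- through k ≤ 2^k.
  set B := 2 * (2 * t) ^ ρ with hB
  have hB0 : 0 ≤ B := by positivity
  have hmem : t ∈ Ioo (t / 2) (2 * t) := ⟨by linarith, by linarith⟩
  have hder : HasDerivAt (fun τ => ∑' k : ℕ, (-1) ^ k * τ ^ (ρ * k) / Real.Gamma (ρ * k + 1))
      (∑' k : ℕ, (-1) ^ k * (ρ * k) * t ^ (ρ * k - 1) / Real.Gamma (ρ * k + 1)) t := by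
    refine hasDerivAt_tsum_of_isPreconnected
      (g := fun (k : ℕ) (τ : ℝ) => (-1) ^ k * τ ^ (ρ * k) / Real.Gamma (ρ * k + 1))
      (g' := fun (k : ℕ) (τ : ℝ) => (-1) ^ k * (ρ * k) * τ ^ (ρ * k - 1) / Real.Gamma (ρ * k + 1))
      (u := fun k : ℕ => 2 / t * ρ * (B ^ k / Real.Gamma (ρ * k + 1)))
      ((summable_pow_div_Gamma hρ0 hB0).mul_left _) isOpen_Ioo isPreconnected_Ioo
      (t := Ioo (t / 2) (2 * t)) ?_ ?_ hmem ?_ hmem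
    · intro k y hy
      have hy0 : 0 < y := by linarith [hy.1]
      have := ((Real.hasDerivAt_rpow_const (x := y) (p := ρ * k) (Or.inl hy0.ne')).const_mul
        ((-1 : ℝ) ^ k)).div_const (Real.Gamma (ρ * k + 1))
      refine this.congr_deriv ?_
      ring
    · intro k y hy
      have hy0 : 0 < y := by linarith [hy.1]
      have hG := Gamma_mul_nat_add_one_pos hρ0.le k
      rw [norm_div, Real.norm_of_nonneg hG.le, mul_div_assoc', norm_mul, norm_mul, norm_pow, norm_neg,
        norm_one, one_pow, one_mul, Real.norm_of_nonneg (by positivity : 0 ≤ ρ * k),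
        Real.norm_of_nonneg (by positivity)]
      refine div_le_div_of_nonneg_right ?_ hG.le
      have h1 : y ^ (ρ * k - 1) ≤ (2 / t) * ((2 * t) ^ ρ) ^ k := by
        rw [Real.rpow_sub_one hy0.ne', rpow_pow_eq (by positivity), div_eq_inv_mul]
        refine mul_le_mul ?_ (Real.rpow_le_rpow hy0.le hy.2.le (by positivity)) (by positivity)
          (by positivity)
        rw [inv_le_comm₀ hy0 (by positivity), inv_div]
        exact hy.1.le
      have h2 : (k : ℝ) ≤ 2 ^ k := by exact_mod_cast Nat.lt_two_pow_self.le
      calc ρ * k * y ^ (ρ * k - 1) ≤ ρ * 2 ^ k * ((2 / t) * ((2 * t) ^ ρ) ^ k) := by gcongr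
        _ = _ := by rw [hB, mul_pow]; ring
    · refine (summable_mittagLeffler hρ0 (-t ^ ρ)).congr fun k => ?_
      rw [neg_pow, rpow_pow_eq ht.le]
  refine HasDerivAt.deriv (hder.congr_of_eventuallyEq ?_)
  filter_upwards [Ioi_mem_nhds ht] with τ hτ
  rw [← mittagLeffler_neg_rpow hρ (le_of_lt hτ), mittagLeffler]
  refine tsum_congr fun k => ?_
  rw [neg_pow, rpow_pow_eq (le_of_lt hτ)]

/-- The relaxation function solves `D_t^ρ e = -e`. -/
theorem integral_rpow_mul_deriv_relaxation (hρ : ρ ∈ Ioo (0 : ℝ) 1) {t : ℝ} (ht : 0 < t) :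
    ∫ s in Ioo 0 t, (t - s) ^ (-ρ) * deriv (relaxation ρ) s =
      -(Real.Gamma (1 - ρ) * relaxation ρ t) := by
  have hρ0 := hρ.1
  have hΓ : 0 < Real.Gamma (1 - ρ) := Real.Gamma_pos_of_pos (by linarith [hρ.2])
  set c : ℝ → ℕ → ℝ := fun ε k => ε ^ k * (ρ * k) / Real.Gamma (ρ * k + 1) with hc
  -- The terms of the kernel times the differentiated series at ε = -1; at ε = 1 the same formula
  -- gives their absolute values.
  set F : ℝ → ℕ → ℝ → ℝ := fun ε k s => c ε k * ((t - s) ^ ((1 - ρ) - 1) * s ^ (ρ * k - 1)) with hF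
  have hFint : ∀ ε k, IntegrableOn (F ε k) (Ioo 0 t) := by
    intro ε k
    rcases Nat.eq_zero_or_pos k with rfl | hk
    · simp [hF, hc]
    · have hk' : 0 < ρ * k := mul_pos hρ0 (by exact_mod_cast hk)
      exact (integrableOn_rpow_mul_rpow_sub hk' (by linarith [hρ.2]) ht).const_mul _
  have hval0 : ∀ ε, ∫ s in Ioo 0 t, F ε 0 s = 0 := by intro ε; simp [hF, hc]
  -- The Beta integral lowers the Gamma argument by ρ, so the term k + 1 becomes the term k of the
  -- original series: the series reproduces itself up to the factor ε Γ(1 - ρ).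
  have hval : ∀ ε k, ∫ s in Ioo 0 t, F ε (k + 1) s =
      ε * Real.Gamma (1 - ρ) * ((ε * t ^ ρ) ^ k / Real.Gamma (ρ * k + 1)) := by
    intro ε k
    have hk' : 0 < ρ * ((k + 1 : ℕ) : ℝ) := by positivity
    have hG := Real.Gamma_pos_of_pos hk'
    rw [hF, integral_const_mul, integral_rpow_mul_rpow_sub hk' (by linarith [hρ.2]) ht, hc]
    simp only
    rw [Real.Gamma_add_one hk'.ne', mul_pow, rpow_pow_eq ht.le]
    have e1 : ρ * ((k + 1 : ℕ) : ℝ) + (1 - ρ) = ρ * k + 1 := by push_cast; ring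
    rw [e1, add_sub_cancel_right]
    have := Gamma_mul_nat_add_one_pos hρ0.le k
    field_simp
    ring
  have hsummable : Summable fun k => ∫ s in Ioo 0 t, ‖F (-1) k s‖ := by
    have hn : ∀ k, ∫ s in Ioo 0 t, ‖F (-1) k s‖ = ∫ s in Ioo 0 t, F 1 k s := by
      intro k
      refine setIntegral_congr_fun measurableSet_Ioo fun s hs => ?_
      have h1 : 0 ≤ t - s := by linarith [hs.2]
      have h2 := hs.1
      have hG := Gamma_mul_nat_add_one_pos hρ0.le k
      simp only [hF, hc]
      rw [norm_mul, norm_div, norm_mul, norm_pow, norm_neg, norm_one, one_pow,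
        Real.norm_of_nonneg hG.le, Real.norm_of_nonneg (by positivity : 0 ≤ ρ * k),
        Real.norm_of_nonneg (by positivity)]
    simp_rw [hn]
    rw [← summable_nat_add_iff 1]
    simp_rw [hval]
    exact (summable_mittagLeffler hρ0 _).mul_left _
  have h := hasSum_integral_of_summable_integral_norm (hFint (-1)) hsummable
  have hlhs : ∫ s in Ioo 0 t, ∑' k, F (-1) k s = ∫ s in Ioo 0 t, (t - s) ^ (-ρ) * deriv (relaxation ρ) s := by
    refine setIntegral_congr_fun measurableSet_Ioo fun s hs => ?_
    simp only [hF, hc]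
    rw [hasSum_deriv_relaxation hρ hs.1, ← tsum_mul_left]
    refine tsum_congr fun k => ?_
    have : 1 - ρ - 1 = -ρ := by ring
    rw [this]; ring
  rw [← hlhs, ← h.tsum_eq, h.summable.tsum_eq_zero_add, hval0, zero_add]
  simp_rw [hval]
  rw [tsum_mul_left, ← mittagLeffler_neg_rpow hρ ht.le, mittagLeffler]
  simp only [neg_mul, one_mul]

end

/-! ### Monotonicity and continuity in the order ρ. -/

/-- sin(πx)/x decreases, by strict concavity of the sine and sin 0 = 0. -/
lemma mul_sin_pi_lt {α β : ℝ} (hα : 0 < α) (hαβ : α < β) (hβ : β < 1) :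
    Real.sin (Real.pi * β) * α < Real.sin (Real.pi * α) * β := by
  have hpi := Real.pi_pos
  have hβ0 : 0 < β := hα.trans hαβ
  have hm1 : Real.pi * β ∈ Icc 0 Real.pi := ⟨by positivity, by nlinarith⟩
  have hm2 : (0 : ℝ) ∈ Icc 0 Real.pi := ⟨le_rfl, hpi.le⟩
  have h := strictConcaveOn_sin_Icc.2 hm1 hm2 (by positivity) (div_pos hα hβ0)
    (by rw [sub_pos, div_lt_one hβ0]; exact hαβ : 0 < 1 - α / β) (by ring)
  simp only [smul_eq_mul, Real.sin_zero, mul_zero, add_zero] at h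
  have e : α / β * (Real.pi * β) = Real.pi * α := by field_simp
  rw [e, div_mul_eq_mul_div, div_lt_iff₀ hβ0] at h
  linarith

/-- sin/(1 + cos) is the tangent of the half angle, which increases. This is the positivity of the
density gap at y = 0. -/
lemma sin_pi_mul_one_add_cos_lt {α β : ℝ} (hα : 0 < α) (hαβ : α < β) (hβ : β < 1) :
    Real.sin (Real.pi * α) * (1 + Real.cos (Real.pi * β)) <
      Real.sin (Real.pi * β) * (1 + Real.cos (Real.pi * α)) := by
  have hpi := Real.pi_pos
  have hs : ∀ x : ℝ, Real.sin (Real.pi * x) =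
      2 * Real.sin (Real.pi * x / 2) * Real.cos (Real.pi * x / 2) := fun x => by
    rw [← Real.sin_two_mul]; congr 1; ring
  have hc : ∀ x : ℝ, 1 + Real.cos (Real.pi * x) = 2 * Real.cos (Real.pi * x / 2) ^ 2 := fun x => by
    have : Real.pi * x = 2 * (Real.pi * x / 2) := by ring
    rw [this, Real.cos_two_mul, ← this]; ring
  have hcα : 0 < Real.cos (Real.pi * α / 2) := Real.cos_pos_of_mem_Ioo ⟨by nlinarith, by nlinarith⟩
  have hcβ : 0 < Real.cos (Real.pi * β / 2) := Real.cos_pos_of_mem_Ioo ⟨by nlinarith, by nlinarith⟩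
  have hd : 0 < Real.sin (Real.pi * β / 2 - Real.pi * α / 2) :=
    Real.sin_pos_of_pos_of_lt_pi (by nlinarith) (by nlinarith)
  rw [Real.sin_sub] at hd
  rw [hs, hs, hc, hc]
  have := mul_pos (mul_pos hcα hcβ) hd
  nlinarith

/-- The numerator of the difference of the densities of orders `β` and `α`. -/
noncomputable def densityGap (α β y : ℝ) : ℝ :=
  Real.sin (Real.pi * β) * (Real.cosh (α * y) + Real.cos (Real.pi * α)) -
    Real.sin (Real.pi * α) * (Real.cosh (β * y) + Real.cos (Real.pi * β))

lemma densityGap_abs (α β y : ℝ) : densityGap α β |y| = densityGap α β y := by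
  rcases abs_choice y with h | h <;> simp [h, densityGap]

lemma relaxDensity_sub {α β : ℝ} (hα : α ∈ Ioo (0 : ℝ) 1) (hβ : β ∈ Ioo (0 : ℝ) 1) (y : ℝ) :
    ∃ K, 0 < K ∧ relaxDensity β y - relaxDensity α y = K * densityGap α β y := by
  have h1 := cosh_add_cos_pos hα y
  have h2 := cosh_add_cos_pos hβ y
  have hpi := Real.pi_pos
  refine ⟨(2 * Real.pi * ((Real.cosh (α * y) + Real.cos (Real.pi * α)) *
    (Real.cosh (β * y) + Real.cos (Real.pi * β))))⁻¹, by positivity, ?_⟩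
  unfold relaxDensity densityGap
  rw [div_sub_div _ _ (by positivity) (by positivity), inv_mul_eq_div, div_eq_div_iff
    (by positivity) (by positivity)]
  ring

/-- In the derivative the term of order β wins twice: α sin(πβ) < β sin(πα), and sinh(αy) <
sinh(βy). -/
lemma strictAntiOn_densityGap {α β : ℝ} (hα : 0 < α) (hαβ : α < β) (hβ : β < 1) :
    StrictAntiOn (densityGap α β) (Ici 0) := by
  refine strictAntiOn_of_deriv_neg (convex_Ici 0)
    (by unfold densityGap; fun_prop : Continuous (densityGap α β)).continuousOn fun y hy => ?_
  rw [interior_Ici] at hy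
  have hy0 : 0 < y := hy
  have hd : HasDerivAt (densityGap α β) (Real.sin (Real.pi * β) * (Real.sinh (α * y) * α) -
      Real.sin (Real.pi * α) * (Real.sinh (β * y) * β)) y := by
    have h : ∀ c : ℝ, HasDerivAt (fun y => Real.cosh (c * y)) (Real.sinh (c * y) * c) y := fun c => by
      simpa using ((hasDerivAt_id y).const_mul c).cosh
    exact (((h α).add_const _).const_mul _).sub (((h β).add_const _).const_mul _)
  rw [hd.deriv]
  have h1 := mul_sin_pi_lt hα hαβ hβ
  have h2 : 0 < Real.sinh (α * y) := Real.sinh_pos_iff.2 (by positivity)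
  have h3 : Real.sinh (α * y) < Real.sinh (β * y) := Real.sinh_lt_sinh.2 (by nlinarith)
  have h4 := sin_pi_mul_pos (ρ := α) ⟨hα, hαβ.trans hβ⟩
  have h5 : 0 < Real.sin (Real.pi * α) * β := mul_pos h4 (hα.trans hαβ)
  nlinarith

/-- The densities of two orders cross exactly once on the half-line. -/
lemma exists_densityGap_eq_zero {α β : ℝ} (hα : 0 < α) (hαβ : α < β) (hβ : β < 1) :
    ∃ y₀, 0 < y₀ ∧ densityGap α β y₀ = 0 := by
  have hα' : α ∈ Ioo (0 : ℝ) 1 := ⟨hα, hαβ.trans hβ⟩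
  have hβ' : β ∈ Ioo (0 : ℝ) 1 := ⟨hα.trans hαβ, hβ⟩
  have h0 : 0 < densityGap α β 0 := by
    have := sin_pi_mul_one_add_cos_lt hα hαβ hβ
    simp only [densityGap, mul_zero, Real.cosh_zero]
    linarith
  -- Otherwise K_β > K_α everywhere, although both densities have integral 1.
  have hneg : ∃ y, 0 < y ∧ densityGap α β y ≤ 0 := by
    by_contra! hcon
    have hpos : ∀ y, 0 < relaxDensity β y - relaxDensity α y := by
      intro y
      obtain ⟨K, hK, h⟩ := relaxDensity_sub hα' hβ' y
      rw [h, ← densityGap_abs]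
      rcases (abs_nonneg y).eq_or_lt with hy | hy
      · rw [← hy]; positivity
      · exact mul_pos hK (hcon _ hy)
    have hint := (integrable_relaxDensity hβ').sub (integrable_relaxDensity hα')
    have h1 := (integral_pos_iff_support_of_nonneg (fun y => (hpos y).le) hint).2 (by
      rw [eq_univ_of_forall (s := Function.support _) fun y => (hpos y).ne']; simp)
    rw [integral_sub (integrable_relaxDensity hβ') (integrable_relaxDensity hα'),
      integral_relaxDensity hβ', integral_relaxDensity hα', sub_self] at h1
    exact lt_irrefl _ h1
  obtain ⟨y₁, hy₁, hle⟩ := hneg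
  obtain ⟨y, hy, hy0⟩ := intermediate_value_Icc' hy₁.le
    (by unfold densityGap; fun_prop : Continuous (densityGap α β)).continuousOn ⟨hle, h0.le⟩
  refine ⟨y, hy.1.lt_of_ne ?_, hy0⟩
  rintro rfl
  exact h0.ne' hy0

/-- The symmetrization of `y ↦ exp (-t e ^ y)`. -/
noncomputable def symExp (t y : ℝ) : ℝ :=
  Real.exp (-(t * Real.exp y)) + Real.exp (-(t * Real.exp (-y)))

lemma symExp_abs (t y : ℝ) : symExp t |y| = symExp t y := by
  rcases abs_choice y with h | h <;> simp [h, symExp, add_comm]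

/-- The derivative is positive if and only if y < t sinh y, which follows from y < sinh y when t ≥
1. This is where the first observation time has to be at least 1. -/
lemma strictMonoOn_symExp {t : ℝ} (ht : 1 ≤ t) : StrictMonoOn (symExp t) (Ici 0) := by
  refine strictMonoOn_of_deriv_pos (convex_Ici 0)
    (by unfold symExp; fun_prop : Continuous (symExp t)).continuousOn fun y hy => ?_
  rw [interior_Ici] at hy
  have hy0 : 0 < y := hy
  have hd : HasDerivAt (symExp t) (Real.exp (-(t * Real.exp y)) * -(t * Real.exp y) +
      Real.exp (-(t * Real.exp (-y))) * -(t * -Real.exp (-y))) y := by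
    have h1 : HasDerivAt (fun y => Real.exp (-y)) (-Real.exp (-y)) y := by
      simpa using (hasDerivAt_id y).neg.exp
    exact (((Real.hasDerivAt_exp y).const_mul t).neg.exp).add ((h1.const_mul t).neg.exp)
  have h2 : Real.exp (-(t * Real.exp y)) * Real.exp y < Real.exp (-(t * Real.exp (-y))) * Real.exp (-y) := by
    rw [← Real.exp_add, ← Real.exp_add, Real.exp_lt_exp]
    have h3 := Real.self_lt_sinh_iff.2 hy0
    rw [Real.sinh_eq] at h3
    nlinarith
  rw [hd.deriv]
  nlinarith

lemma integrable_symExp_mul {ρ : ℝ} (hρ : ρ ∈ Ioo (0 : ℝ) 1) {t : ℝ} (ht : 0 ≤ t) :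
    Integrable fun y => symExp t y * relaxDensity ρ y := by
  have h := integrable_relaxation hρ ht
  refine (h.add h.comp_neg).congr (Eventually.of_forall fun y => ?_)
  simp [symExp, relaxDensity_neg]; ring

lemma relaxation_eq_integral_symExp {ρ : ℝ} (hρ : ρ ∈ Ioo (0 : ℝ) 1) {t : ℝ} (ht : 0 ≤ t) :
    2 * relaxation ρ t = ∫ y, symExp t y * relaxDensity ρ y := by
  have h := integrable_relaxation hρ ht
  have h2 : ∫ y, Real.exp (-(t * Real.exp (-y))) * relaxDensity ρ (-y) = relaxation ρ t :=
    integral_neg_eq_self (fun y => Real.exp (-(t * Real.exp y)) * relaxDensity ρ y) volume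
  rw [two_mul]
  nth_rewrite 2 [← h2]
  rw [relaxation, ← integral_add h h.comp_neg]
  refine integral_congr_ae (Eventually.of_forall fun y => ?_)
  simp [symExp, relaxDensity_neg]; ring

/-- For a fixed time `t ≥ 1`, the relaxation function decreases with the order. -/
theorem strictAntiOn_relaxation_order {t : ℝ} (ht : 1 ≤ t) :
    StrictAntiOn (fun ρ => relaxation ρ t) (Ioo 0 1) := by
  intro α hα β hβ hαβ
  have ht0 : 0 ≤ t := by linarith
  obtain ⟨y₀, hy₀, hgap⟩ := exists_densityGap_eq_zero hα.1 hαβ hβ.2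
  -- Both factors change sign at |y| = y₀ and in the same direction, so g ≥ 0. Subtracting the
  -- constant `symExp t y₀` leaves the integral unchanged because the two densities have equal mass.
  set g : ℝ → ℝ := fun y => (symExp t y - symExp t y₀) * (relaxDensity α y - relaxDensity β y) with hg
  have hsign : ∀ y, 0 ≤ g y ∧ (|y| ≠ y₀ → 0 < g y) := by
    intro y
    obtain ⟨K, hK, h⟩ := relaxDensity_sub hα hβ y
    have hgy : g y = K * ((symExp t |y| - symExp t y₀) * (densityGap α β y₀ - densityGap α β |y|)) := by
      rw [hgap, densityGap_abs, symExp_abs, hg]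
      have : relaxDensity α y - relaxDensity β y = -(K * densityGap α β y) := by rw [← h]; ring
      simp only [this]; ring
    have hpos : |y| ≠ y₀ → 0 < g y := by
      intro hne
      rw [hgy]
      refine mul_pos hK ?_
      rcases lt_or_gt_of_ne hne with hlt | hlt
      · have h1 := strictMonoOn_symExp ht (abs_nonneg y) hy₀.le hlt
        have h2 := strictAntiOn_densityGap hα.1 hαβ hβ.2 (abs_nonneg y) hy₀.le hlt
        exact mul_pos_of_neg_of_neg (by linarith) (by linarith)
      · have h1 := strictMonoOn_symExp ht hy₀.le (abs_nonneg y) hlt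
        have h2 := strictAntiOn_densityGap hα.1 hαβ hβ.2 hy₀.le (abs_nonneg y) hlt
        exact mul_pos (by linarith) (by linarith)
    refine ⟨?_, hpos⟩
    by_cases hne : |y| = y₀
    · rw [hgy, hne]; simp
    · exact (hpos hne).le
  have hsplit : ∀ y, g y = (symExp t y * relaxDensity α y - symExp t y * relaxDensity β y) -
      symExp t y₀ * (relaxDensity α y - relaxDensity β y) := by
    intro y; simp only [hg]; ring
  have i1 := (integrable_symExp_mul hα ht0).sub (integrable_symExp_mul hβ ht0)
  have i2 := ((integrable_relaxDensity hα).sub (integrable_relaxDensity hβ)).const_mul (symExp t y₀)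
  have hint : Integrable g := (i1.sub i2).congr (Eventually.of_forall fun y => (hsplit y).symm)
  have hval : ∫ y, g y = 2 * relaxation α t - 2 * relaxation β t := by
    rw [integral_congr_ae (Eventually.of_forall hsplit)]
    refine (integral_sub i1 i2).trans ?_
    rw [integral_const_mul, integral_sub' (integrable_symExp_mul hα ht0) (integrable_symExp_mul hβ ht0),
      integral_sub' (integrable_relaxDensity hα) (integrable_relaxDensity hβ)]
    rw [integral_relaxDensity hα, integral_relaxDensity hβ, relaxation_eq_integral_symExp hα ht0,
      relaxation_eq_integral_symExp hβ ht0]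
    ring
  have hpos : 0 < ∫ y, g y := by
    rw [integral_pos_iff_support_of_nonneg (fun y => (hsign y).1) hint]
    refine lt_of_lt_of_le ?_ (measure_mono (s := Ioi y₀) fun y hy => ?_)
    · simp
    · refine ((hsign y).2 ?_).ne'
      have hy' : y₀ < y := hy
      rw [abs_of_pos (by linarith)]
      exact hy'.ne'
  rw [hval] at hpos
  simp only
  linarith

/-- The choice R = 2t in the bound on Gamma gives the ratio (1/2)^ρ ≤ (1/2)^ρ₀, uniform in ρ. The
series is used rather than the density because it remains valid at ρ = 1, where `relaxDensity`
vanishes. -/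
lemma continuousOn_mittagLeffler_order {t : ℝ} (ht : 0 < t) {ρ₀ : ℝ} (hρ₀ : 0 < ρ₀) :
    ContinuousOn (fun ρ => mittagLeffler ρ (-t ^ ρ)) (Ici ρ₀) := by
  have h0 : (0 : ℝ) < (1 / 2 : ℝ) ^ ρ₀ := by positivity
  have h1 : (1 / 2 : ℝ) ^ ρ₀ < 1 := Real.rpow_lt_one (by norm_num) (by norm_num) hρ₀
  refine continuousOn_tsum (u := fun k : ℕ => Real.exp (2 * t) * ((1 / 2 : ℝ) ^ ρ₀) ^ k) (fun k => ?_)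
    ((summable_geometric_of_lt_one h0.le h1).mul_left _) fun k ρ hρ => ?_
  · refine ContinuousOn.div ?_ ?_ ?_
    · have : Continuous fun ρ : ℝ => t ^ ρ := Real.continuous_const_rpow ht.ne'
      fun_prop
    · intro ρ hρ
      have h2 : 0 < ρ := hρ₀.trans_le hρ
      refine ContinuousAt.continuousWithinAt (ContinuousAt.comp (f := fun ρ : ℝ => ρ * k + 1)
        (Real.differentiableAt_Gamma fun m => ?_).continuousAt (by fun_prop))
      have : 0 < ρ * k + 1 := by positivity
      have : (0 : ℝ) ≤ m := m.cast_nonneg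
      linarith
    · intro ρ hρ
      exact (Gamma_mul_nat_add_one_pos (hρ₀.le.trans hρ) k).ne'
  · have hρ0 : 0 ≤ ρ := hρ₀.le.trans hρ
    have hp : 0 < t ^ ρ := Real.rpow_pos_of_pos ht ρ
    refine (norm_pow_div_Gamma_le hρ0 (B := t ^ ρ) (by rw [abs_neg, abs_of_pos hp]) k).trans ?_
    refine (pow_div_Gamma_le hρ0 (R := 2 * t) (by positivity) hp.le k).trans ?_
    rw [← Real.div_rpow ht.le (by positivity)]
    have e : t / (2 * t) = 1 / 2 := by field_simp
    rw [e]
    have : (1 / 2 : ℝ) ^ ρ ≤ (1 / 2 : ℝ) ^ ρ₀ :=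
      Real.rpow_le_rpow_of_exponent_ge (by norm_num) (by norm_num) hρ
    gcongr

lemma mittagLeffler_one (z : ℝ) : mittagLeffler 1 z = Real.exp z := by
  rw [mittagLeffler, Real.exp_eq_exp_ℝ, NormedSpace.exp_eq_tsum_div]
  refine tsum_congr fun k => ?_
  rw [one_mul, Real.Gamma_nat_eq_factorial]

/-- The values of the relaxation function at a time `t ≥ 1` for the orders in `[ρ₀, 1)`. -/
theorem exists_order_iff {t : ℝ} (ht : 1 ≤ t) {ρ₀ : ℝ} (hρ₀ : ρ₀ ∈ Ioo (0 : ℝ) 1) (r : ℝ) :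
    (∃ ρ ∈ Ico ρ₀ 1, relaxation ρ t = r) ↔ Real.exp (-t) < r ∧ r ≤ relaxation ρ₀ t := by
  have ht0 : 0 < t := by linarith
  have hcont := (continuousOn_mittagLeffler_order ht0 hρ₀.1).mono (fun x hx => hx.1 : Icc ρ₀ 1 ⊆ Ici ρ₀)
  have heq : ∀ ρ ∈ Ioo (0 : ℝ) 1, mittagLeffler ρ (-t ^ ρ) = relaxation ρ t := fun ρ hρ =>
    mittagLeffler_neg_rpow hρ ht0.le
  have hone : mittagLeffler 1 (-t ^ (1 : ℝ)) = Real.exp (-t) := by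
    rw [mittagLeffler_one, Real.rpow_one]
  have hanti := strictAntiOn_relaxation_order ht
  have hmem : ∀ ρ ∈ Ico ρ₀ 1, ρ ∈ Ioo (0 : ℝ) 1 := fun ρ hρ => ⟨hρ₀.1.trans_le hρ.1, hρ.2⟩
  have hlim : ∀ ρ ∈ Ioo (0 : ℝ) 1, Real.exp (-t) ≤ relaxation ρ t := by
    intro ρ hρ
    have hc := ((continuousOn_mittagLeffler_order ht0 hρ.1).continuousWithinAt (x := 1) hρ.2.le).mono
      (fun x hx => hx.1 : Icc ρ 1 ⊆ Ici ρ) |>.mono Ico_subset_Icc_self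
    rw [ContinuousWithinAt, hone] at hc
    have : (𝓝[Ico ρ 1] (1 : ℝ)).NeBot := by
      rw [← mem_closure_iff_nhdsWithin_neBot, closure_Ico hρ.2.ne]
      exact ⟨hρ.2.le, le_rfl⟩
    refine le_of_tendsto hc ?_
    filter_upwards [self_mem_nhdsWithin] with x hx
    have hx' : x ∈ Ioo (0 : ℝ) 1 := ⟨hρ.1.trans_le hx.1, hx.2⟩
    rw [heq x hx']
    exact hanti.antitoneOn hρ hx' hx.1
  constructor
  · rintro ⟨ρ, hρ, rfl⟩
    refine ⟨?_, hanti.antitoneOn hρ₀ (hmem ρ hρ) hρ.1⟩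
    -- The limit at order 1 gives only a weak inequality; comparison with an order strictly between
    -- ρ and 1 makes it strict.
    have hmid : (ρ + 1) / 2 ∈ Ioo (0 : ℝ) 1 := by
      have := hmem ρ hρ
      constructor <;> linarith [this.1, this.2]
    exact (hlim _ hmid).trans_lt (hanti (hmem ρ hρ) hmid (by linarith [hρ.2]))
  · rintro ⟨h1, h2⟩
    rw [← heq _ hρ₀] at h2
    obtain ⟨ρ, hρ, hr⟩ := intermediate_value_Icc' hρ₀.2.le hcont
      ⟨(hone.le.trans h1.le : mittagLeffler 1 (-t ^ (1 : ℝ)) ≤ r), h2⟩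
    have hlt : ρ < 1 := by
      refine hρ.2.lt_of_ne ?_
      rintro rfl
      simp only [hone] at hr
      exact h1.ne hr
    exact ⟨ρ, ⟨hρ.1, hlt⟩, by rw [← heq ρ (hmem ρ ⟨hρ.1, hlt⟩)]; exact hr⟩

/-! ### The L² Fourier transform and Fourier inversion in the class L₂^τ. -/

section

section Fourier

variable {V : Type*} [NormedAddCommGroup V] [InnerProductSpace ℝ V] [FiniteDimensional ℝ V]
  [MeasurableSpace V] [BorelSpace V]

lemma continuous_fourierInv {g : V → ℂ} (hg : Integrable g) : Continuous (𝓕⁻ g : V → ℂ) :=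
  VectorFourier.fourierIntegral_continuous Real.continuous_fourierChar
    (by simp only [LinearMap.neg_apply, innerₗ_apply_apply]; fun_prop) hg

lemma integral_fourierInv_smul_eq {f g : V → ℂ} (hf : Integrable f) (hg : Integrable g) :
    ∫ x, (𝓕⁻ f : V → ℂ) x • g x = ∫ x, f x • (𝓕⁻ g : V → ℂ) x := by
  have h := VectorFourier.integral_fourierIntegral_smul_eq_flip (e := Real.fourierChar)
    (μ := (volume : Measure V)) (ν := (volume : Measure V)) (L := -innerₗ V) (f := f) (g := g)
    Real.continuous_fourierChar (by simp only [LinearMap.neg_apply, innerₗ_apply_apply]; fun_prop) hf hg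
  have hflip : (-innerₗ V).flip = -innerₗ V := by
    ext x y; simp [real_inner_comm]
  rw [hflip] at h
  exact h

/-- On `L¹ ∩ L²` the inverse Fourier transform in the `L²` sense is given by the integral. -/
theorem fourierInv_toLp_ae_eq {g : V → ℂ} (hg : Integrable g) (hg2 : MemLp g 2) :
    ((𝓕⁻ (hg2.toLp g) : Lp ℂ 2 (volume : Measure V)) : V → ℂ) =ᵐ[volume] (𝓕⁻ g : V → ℂ) := by
  refine ae_eq_of_integral_contDiff_smul_eq ?_ ?_ ?_
  · exact (Lp.memLp _).locallyIntegrable (by norm_num)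
  · exact (continuous_fourierInv hg).locallyIntegrable
  · intro h hh hc
    -- The test function is a Schwartz function, so the L² transform may be moved onto it through
    -- tempered distributions; Fubini moves it back as the integral transform of g.
    have hc' : HasCompactSupport (Complex.ofRealCLM ∘ h) := hc.comp_left rfl
    have hh' : ContDiff ℝ ((⊤ : ℕ∞) : WithTop ℕ∞) (Complex.ofRealCLM ∘ h) := by fun_prop
    set φ := hc'.toSchwartzMap hh' with hφ
    have hφx : ∀ x, φ x = h x := fun x => rfl
    have h1 := congrArg (fun T => T φ) (Lp.fourierInv_toTemperedDistribution_eq (hg2.toLp g))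
    simp only [TemperedDistribution.fourierInv_apply, Lp.toTemperedDistribution_apply] at h1
    calc ∫ x, h x • (𝓕⁻ (hg2.toLp g) : Lp ℂ 2 (volume : Measure V)) x
        = ∫ x, φ x • (𝓕⁻ (hg2.toLp g) : Lp ℂ 2 (volume : Measure V)) x := by
          simp [hφx]
      _ = ∫ x, (𝓕⁻ φ) x • hg2.toLp g x := h1.symm
      _ = ∫ x, (𝓕⁻ (φ : V → ℂ) : V → ℂ) x • g x := by
          refine integral_congr_ae ?_
          filter_upwards [hg2.coeFn_toLp] with x hx
          rw [hx, SchwartzMap.fourierInv_coe]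
      _ = ∫ x, φ x • (𝓕⁻ g : V → ℂ) x := integral_fourierInv_smul_eq φ.integrable hg
      _ = _ := by simp [hφx]

lemma memLp_fourierInv {g : V → ℂ} (hg : Integrable g) (hg2 : MemLp g 2) :
    MemLp (𝓕⁻ g : V → ℂ) 2 := by
  exact (memLp_congr_ae (fourierInv_toLp_ae_eq hg hg2)).1 (Lp.memLp _)

lemma fourier_toLp_fourierInv {g : V → ℂ} (hg : Integrable g) (hg2 : MemLp g 2) :
    (𝓕 ((memLp_fourierInv hg hg2).toLp _) : Lp ℂ 2 (volume : Measure V)) = hg2.toLp g := by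
  have h : (memLp_fourierInv hg hg2).toLp _ = 𝓕⁻ (hg2.toLp g) := by
    refine Lp.ext ?_
    exact (MemLp.coeFn_toLp _).trans (fourierInv_toLp_ae_eq hg hg2).symm
  rw [h]
  exact FourierTransform.fourier_fourierInv_eq _

lemma eLpNorm_fourierInv {g : V → ℂ} (hg : Integrable g) (hg2 : MemLp g 2) :
    eLpNorm (𝓕⁻ g : V → ℂ) 2 volume = eLpNorm g 2 volume := by
  have h := congrArg (fun f : Lp ℂ 2 (volume : Measure V) => ENNReal.ofReal ‖f‖)
    (fourier_toLp_fourierInv hg hg2)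
  simpa [Lp.norm_toLp, ENNReal.ofReal_toReal, (memLp_fourierInv hg hg2).eLpNorm_ne_top,
    hg2.eLpNorm_ne_top] using h

/-- The Riemann–Lebesgue lemma, reflected by x ↦ -x. -/
lemma tendsto_fourierInv_cocompact (g : V → ℂ) :
    Tendsto (𝓕⁻ g : V → ℂ) (cocompact V) (𝓝 0) := by
  have h := (tendsto_integral_exp_inner_smul_cocompact g).comp
    (Homeomorph.neg V).isClosedEmbedding.tendsto_cocompact
  refine h.congr fun x => ?_
  simp [Real.fourierInv_eq]

end Fourier

variable {N : ℕ}

lemma hat_of_memLp {f : EuclideanSpace ℝ (Fin N) → ℂ} (h : MemLp f 2 volume)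
    (ξ : EuclideanSpace ℝ (Fin N)) :
    hat f ξ = (((2 * Real.pi) ^ N)⁻¹ : ℝ) •
      (𝓕 (h.toLp f) : Lp ℂ 2 volume) ((2 * Real.pi)⁻¹ • ξ) := by
  rw [hat, dif_pos h]

lemma two_pi_inv_ne_zero : (2 * Real.pi)⁻¹ ≠ 0 := by positivity

lemma hat_fourierInv {g : EuclideanSpace ℝ (Fin N) → ℂ} (hg : Integrable g) (hg2 : MemLp g 2) :
    hat (𝓕⁻ g : EuclideanSpace ℝ (Fin N) → ℂ) =ᵐ[volume]
      fun ξ => (((2 * Real.pi) ^ N)⁻¹ : ℝ) • g ((2 * Real.pi)⁻¹ • ξ) := by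
  have h := (Measure.quasiMeasurePreserving_smul
    (volume : Measure (EuclideanSpace ℝ (Fin N))) two_pi_inv_ne_zero).ae_eq_comp
    hg2.coeFn_toLp
  filter_upwards [h] with ξ hξ
  rw [hat_of_memLp (memLp_fourierInv hg hg2), fourier_toLp_fourierInv hg hg2]
  simp only [Function.comp_def] at hξ
  rw [hξ]

lemma fourier_eq_hat {f : EuclideanSpace ℝ (Fin N) → ℂ} (h : MemLp f 2 volume)
    (η : EuclideanSpace ℝ (Fin N)) :
    (𝓕 (h.toLp f) : Lp ℂ 2 volume) η = ((2 * Real.pi) ^ N : ℝ) • hat f ((2 * Real.pi) • η) := by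
  have : (2 * Real.pi) ≠ 0 := by positivity
  rw [hat_of_memLp h, smul_smul, smul_smul, inv_mul_cancel₀ this, mul_inv_cancel₀ (pow_ne_zero _ this),
    one_smul, one_smul]

/-- For `τ > N / 2` the Fourier transform of a function of class `L₂^τ` is integrable. -/
lemma integrable_hat_of_memSobolevClass {τ : ℝ} (hτ : (N : ℝ) / 2 < τ)
    {φ : EuclideanSpace ℝ (Fin N) → ℂ} (hφ : MemSobolevClass τ φ) : Integrable (hat φ) := by
  -- Cauchy–Schwarz: the reciprocal weight is in L² because 2τ > N.
  have hw : MemLp (fun ξ : EuclideanSpace ℝ (Fin N) => (((1 + ‖ξ‖ ^ 2) ^ (-(τ / 2)) : ℝ) : ℂ)) 2 volume := by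
    have hc : Continuous fun ξ : EuclideanSpace ℝ (Fin N) => (((1 + ‖ξ‖ ^ 2) ^ (-(τ / 2)) : ℝ) : ℂ) := by
      refine Complex.continuous_ofReal.comp (Continuous.rpow_const (by fun_prop) fun ξ => Or.inl ?_)
      positivity
    rw [memLp_two_iff_integrable_sq_norm hc.aestronglyMeasurable]
    have h := integrable_rpow_neg_one_add_norm_sq (E := EuclideanSpace ℝ (Fin N)) (μ := volume)
      (r := 2 * τ) (by simp only [finrank_euclideanSpace, Fintype.card_fin]; linarith)
    refine h.congr (Eventually.of_forall fun ξ => ?_)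
    have hpos : 0 < 1 + ‖ξ‖ ^ 2 := by positivity
    simp only [Complex.norm_real, Real.norm_eq_abs, sq_abs]
    rw [← Real.rpow_mul_natCast hpos.le]
    congr 1; push_cast; ring
  refine (hw.integrable_mul hφ.2).congr (Eventually.of_forall fun ξ => ?_)
  have hpos : 0 < 1 + ‖ξ‖ ^ 2 := by positivity
  simp only [Pi.mul_apply]
  rw [← mul_assoc, ← Complex.ofReal_mul, ← Real.rpow_add hpos]
  simp

/-- Fourier inversion for a continuous function of class `L₂^τ`, `τ > N / 2`. -/
lemma exists_eq_fourierInv {τ : ℝ} (hτ : (N : ℝ) / 2 < τ)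
    {φ : EuclideanSpace ℝ (Fin N) → ℂ} (hφc : Continuous φ) (hφ : MemSobolevClass τ φ) :
    ∃ a : EuclideanSpace ℝ (Fin N) → ℂ, Integrable a ∧ MemLp a 2 ∧ φ = (𝓕⁻ a) ∧
      ∀ ξ, hat φ ξ = (((2 * Real.pi) ^ N)⁻¹ : ℝ) • a ((2 * Real.pi)⁻¹ • ξ) := by
  have h2pi : (2 * Real.pi) ≠ 0 := by positivity
  set a := (𝓕 (hφ.1.toLp φ) : Lp ℂ 2 volume) with ha
  have hint : Integrable a := by
    have h := (((integrable_hat_of_memSobolevClass hτ hφ).comp_smul h2pi).smul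
      ((2 * Real.pi) ^ N : ℝ))
    exact h.congr (Eventually.of_forall fun η => (fourier_eq_hat hφ.1 η).symm)
  refine ⟨a, hint, Lp.memLp _, ?_, hat_of_memLp hφ.1⟩
  -- L² inversion gives equality almost everywhere; continuity of both sides makes it hold
  -- everywhere.
  refine (Continuous.ae_eq_iff_eq volume hφc (continuous_fourierInv hint)).1 ?_
  refine hφ.1.coeFn_toLp.symm.trans (EventuallyEq.trans ?_ (fourierInv_toLp_ae_eq hint (Lp.memLp a)))
  have : (𝓕⁻ ((Lp.memLp a).toLp a) : Lp ℂ 2 volume) = hφ.1.toLp φ := by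
    rw [Lp.toLp_coeFn, ha]
    exact FourierTransform.fourierInv_fourier_eq _
  rw [this]

end

/-! ### The scalar modes and the evolution they generate. -/

section

section Mode

variable {ρ lam t : ℝ}

/-- The solution `E_ρ(-lam t ^ ρ)` of `D_t^ρ e = -lam e`, `e(0) = 1`. -/
noncomputable def mode (ρ lam t : ℝ) : ℝ := relaxation ρ (lam ^ (1 / ρ) * t)

/-- The derivative of `mode ρ lam` in time. -/
noncomputable def modeDeriv (ρ lam t : ℝ) : ℝ :=
  lam ^ (1 / ρ) * deriv (relaxation ρ) (lam ^ (1 / ρ) * t)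

lemma mode_zero (hρ : ρ ∈ Ioo (0 : ℝ) 1) (lam : ℝ) : mode ρ lam 0 = 1 := by
  rw [mode, mul_zero, relaxation_zero hρ]

lemma mode_pos (hρ : ρ ∈ Ioo (0 : ℝ) 1) (hlam : 0 ≤ lam) (ht : 0 ≤ t) : 0 < mode ρ lam t :=
  relaxation_pos hρ (by positivity)

lemma mode_le_one (hρ : ρ ∈ Ioo (0 : ℝ) 1) (hlam : 0 ≤ lam) (ht : 0 ≤ t) : mode ρ lam t ≤ 1 :=
  relaxation_le_one hρ (by positivity)

/-- Uniformity in lam is the smoothing effect: for t > 0 the operator is bounded on the evolution,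
without regularity of the datum, and the bound is integrable at t = 0 because ρ < 1. -/
lemma mul_rpow_mul_mode_le (hρ : ρ ∈ Ioo (0 : ℝ) 1) :
    ∃ C, 0 < C ∧ ∀ lam t, 0 ≤ lam → 0 < t → lam * mode ρ lam t ≤ C * t ^ (-ρ) := by
  obtain ⟨C, hC, h⟩ := exists_rpow_mul_relaxation_le hρ
  refine ⟨C, hC, fun lam t hlam ht => ?_⟩
  have h1 := h (lam ^ (1 / ρ) * t) (by positivity)
  rw [Real.mul_rpow (by positivity) ht.le, ← Real.rpow_mul hlam, one_div_mul_cancel hρ.1.ne',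
    Real.rpow_one] at h1
  have hp := Real.rpow_pos_of_pos ht ρ
  rw [Real.rpow_neg ht.le, ← div_eq_mul_inv, le_div_iff₀ hp]
  calc lam * mode ρ lam t * t ^ ρ = lam * t ^ ρ * relaxation ρ (lam ^ (1 / ρ) * t) := by
        rw [mode]; ring
    _ ≤ C := h1

lemma continuousOn_mode (hρ : ρ ∈ Ioo (0 : ℝ) 1) (hlam : 0 ≤ lam) :
    ContinuousOn (mode ρ lam) (Ici 0) := by
  refine (continuousOn_relaxation hρ).comp (by fun_prop) fun s hs => ?_
  have : 0 ≤ s := hs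
  simp only [mem_Ici]
  positivity

lemma continuous_mode {X : Type*} [TopologicalSpace X] {f : X → ℝ} (hρ : ρ ∈ Ioo (0 : ℝ) 1)
    (hf : Continuous f) (h0 : ∀ x, 0 ≤ f x) (ht : 0 ≤ t) : Continuous fun x => mode ρ (f x) t := by
  refine (continuousOn_relaxation hρ).comp_continuous ?_ fun x => ?_
  · have : Continuous fun x => f x ^ (1 / ρ) := hf.rpow_const fun x => Or.inr (by
      have := hρ.1; positivity)
    fun_prop
  · have := h0 x
    simp only [mem_Ici]
    positivity

lemma measurable_modeDeriv (ρ : ℝ) : Measurable fun p : ℝ × ℝ => modeDeriv ρ p.1 p.2 := by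
  unfold modeDeriv
  have h := measurable_deriv (relaxation ρ)
  have h1 : Measurable fun p : ℝ × ℝ => p.1 ^ (1 / ρ) := measurable_fst.pow_const _
  exact h1.mul (h.comp (h1.mul measurable_snd))

lemma hasDerivAt_mode (hρ : ρ ∈ Ioo (0 : ℝ) 1) (hlam : 0 ≤ lam) (ht : 0 < t) :
    HasDerivAt (mode ρ lam) (modeDeriv ρ lam t) t := by
  have hκ : 0 ≤ lam ^ (1 / ρ) := by positivity
  rcases hκ.eq_or_lt with h | h
  · unfold mode modeDeriv
    rw [← h]
    simp only [zero_mul]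
    exact hasDerivAt_const _ _
  · have h1 := (hasDerivAt_relaxation hρ (mul_pos h ht)).comp t ((hasDerivAt_id t).const_mul _)
    refine h1.congr_deriv ?_
    rw [modeDeriv]; ring

lemma modeDeriv_nonpos (hρ : ρ ∈ Ioo (0 : ℝ) 1) (hlam : 0 ≤ lam) (ht : 0 < t) :
    modeDeriv ρ lam t ≤ 0 := by
  have hκ : 0 ≤ lam ^ (1 / ρ) := by positivity
  rcases hκ.eq_or_lt with h | h
  · rw [modeDeriv, ← h, zero_mul]
  · exact mul_nonpos_of_nonneg_of_nonpos hκ (deriv_relaxation_nonpos hρ (mul_pos h ht))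

lemma abs_modeDeriv_le (hρ : ρ ∈ Ioo (0 : ℝ) 1) (hlam : 0 ≤ lam) (ht : 0 < t) :
    |modeDeriv ρ lam t| ≤ 1 / t := by
  have hκ : 0 ≤ lam ^ (1 / ρ) := by positivity
  rcases hκ.eq_or_lt with h | h
  · rw [modeDeriv, ← h, zero_mul, abs_zero]; positivity
  · have := mul_abs_deriv_relaxation_le hρ (mul_pos h ht)
    rw [le_div_iff₀ ht, modeDeriv, abs_mul, abs_of_pos h]
    linarith

/-- Scaling time by κ = lam^{1/ρ} reduces to lam = 1. The case lam = 0 is separate: there the mode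
is constant. -/
lemma integral_rpow_mul_modeDeriv (hρ : ρ ∈ Ioo (0 : ℝ) 1) (hlam : 0 ≤ lam) (ht : 0 < t) :
    IntegrableOn (fun s => (t - s) ^ (-ρ) * modeDeriv ρ lam s) (Ioo 0 t) ∧
    ∫ s in Ioo 0 t, (t - s) ^ (-ρ) * modeDeriv ρ lam s =
      -(Real.Gamma (1 - ρ) * (lam * mode ρ lam t)) := by
  have hΓ : 0 < Real.Gamma (1 - ρ) := Real.Gamma_pos_of_pos (by linarith [hρ.2])
  rcases hlam.eq_or_lt with h | h
  · have hz : lam ^ (1 / ρ) = 0 := by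
      rw [← h]; exact Real.zero_rpow (one_div_pos.2 hρ.1).ne'
    have hz' : ∀ s, modeDeriv ρ lam s = 0 := fun s => by rw [modeDeriv, hz, zero_mul]
    have h0 : lam * mode ρ lam t = 0 := by rw [← h, zero_mul]
    refine ⟨by simp [hz'], ?_⟩
    rw [h0]
    simp [hz']
  · have hmp := mode_pos hρ hlam ht.le
    have hval : ∫ s in Ioo 0 t, (t - s) ^ (-ρ) * modeDeriv ρ lam s =
        -(Real.Gamma (1 - ρ) * (lam * mode ρ lam t)) := by
      set κ := lam ^ (1 / ρ) with hκdef
      have hκ : 0 < κ := Real.rpow_pos_of_pos h _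
      have hκρ : κ ^ ρ = lam := by
        rw [hκdef, ← Real.rpow_mul hlam, one_div_mul_cancel hρ.1.ne', Real.rpow_one]
      have h1 := integral_rpow_mul_deriv_relaxation hρ (mul_pos hκ ht)
      rw [← integral_Ioc_eq_integral_Ioo, ← intervalIntegral.integral_of_le (by positivity)] at h1 ⊢
      have h2 := intervalIntegral.integral_comp_mul_left (a := 0) (b := t)
        (fun u => (κ * t - u) ^ (-ρ) * deriv (relaxation ρ) u) hκ.ne'
      rw [mul_zero, h1] at h2
      have h3 : ∫ s in (0 : ℝ)..t, (t - s) ^ (-ρ) * modeDeriv ρ lam s =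
          κ ^ ρ * κ * ∫ s in (0 : ℝ)..t, (κ * t - κ * s) ^ (-ρ) * deriv (relaxation ρ) (κ * s) := by
        rw [← intervalIntegral.integral_const_mul]
        refine intervalIntegral.integral_congr fun s hs => ?_
        rw [uIcc_of_le ht.le] at hs
        have h4 : 0 ≤ t - s := by linarith [hs.2]
        simp only [modeDeriv]
        rw [← mul_sub, Real.mul_rpow hκ.le h4, Real.rpow_neg hκ.le]
        have := Real.rpow_pos_of_pos hκ ρ
        field_simp
        rw [hκdef]
      rw [h3, h2, hκρ, smul_eq_mul, mode]
      rw [← hκdef]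
      field_simp
    refine ⟨Integrable.of_integral_ne_zero ?_, hval⟩
    rw [hval]
    exact (neg_neg_of_pos (by positivity)).ne

lemma mode_eq_mittagLeffler (hρ : ρ ∈ Ioo (0 : ℝ) 1) (hlam : 0 ≤ lam) (ht : 0 ≤ t) :
    mode ρ lam t = mittagLeffler ρ (-(lam * t ^ ρ)) :=
  (mittagLeffler_neg_mul_rpow hρ hlam ht).symm

end Mode

section Wave

variable {V : Type*} [NormedAddCommGroup V] [InnerProductSpace ℝ V]

/-- The wave `e^{2 π i ⟨η, x⟩}`. -/
noncomputable def planeWave (x η : V) : ℂ := Complex.exp (((2 * Real.pi * inner ℝ η x : ℝ) : ℂ) * Complex.I)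

lemma norm_planeWave (x η : V) : ‖planeWave x η‖ = 1 := Complex.norm_exp_ofReal_mul_I _

lemma continuous_planeWave_prod (η : V) : Continuous fun x : V => planeWave x η := by
  unfold planeWave; fun_prop

lemma continuous_planeWave (x : V) :
    Continuous fun η : V => planeWave x η := by
  unfold planeWave; fun_prop

end Wave

section Evolution

variable {V : Type*} [NormedAddCommGroup V] [InnerProductSpace ℝ V] [FiniteDimensional ℝ V]
  [MeasurableSpace V] [BorelSpace V] {ρ t : ℝ} {lam : V → ℝ} {a : V → ℂ}

lemma fourierInv_eq_integral_mul (f : V → ℂ) (x : V) :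
    (𝓕⁻ f : V → ℂ) x = ∫ η, planeWave x η * f η := by
  rw [Real.fourierInv_eq']; rfl

/-- The evolution with the symbol `lam` of the function with Fourier transform `a`. -/
noncomputable def evolution (ρ : ℝ) (lam : V → ℝ) (a : V → ℂ) (x : V) (t : ℝ) : ℂ :=
  (𝓕⁻ (fun η => (mode ρ (lam η) t : ℂ) * a η) : V → ℂ) x

/-- The operator with the symbol `lam` applied to the evolution. -/
noncomputable def evolutionSymbol (ρ : ℝ) (lam : V → ℝ) (a : V → ℂ) (x : V) (t : ℝ) : ℂ :=
  (𝓕⁻ (fun η => ((lam η * mode ρ (lam η) t : ℝ) : ℂ) * a η) : V → ℂ) x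

lemma memLp_mul_of_bound {p : ℝ≥0∞} {f : V → ℝ} {C : ℝ} (hf : Continuous f) (hC : ∀ x, ‖f x‖ ≤ C)
    (ha : MemLp a p) : MemLp (fun η => (f η : ℂ) * a η) p := by
  have hm : AEStronglyMeasurable (fun η => (f η : ℂ)) (volume : Measure V) :=
    (Complex.continuous_ofReal.comp hf).aestronglyMeasurable
  refine MemLp.of_le_mul (c := C) ha (hm.mul ha.1) (Eventually.of_forall fun η => ?_)
  rw [norm_mul, Complex.norm_real]
  exact mul_le_mul_of_nonneg_right (hC η) (norm_nonneg _)

lemma memLp_mode_mul {p : ℝ≥0∞} (hρ : ρ ∈ Ioo (0 : ℝ) 1) (hlam : Continuous lam)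
    (h0 : ∀ η, 0 ≤ lam η) (ha : MemLp a p) (ht : 0 ≤ t) :
    MemLp (fun η => (mode ρ (lam η) t : ℂ) * a η) p := by
  refine memLp_mul_of_bound (C := 1) (continuous_mode hρ hlam h0 ht) (fun η => ?_) ha
  rw [Real.norm_of_nonneg (mode_pos hρ (h0 η) ht).le]
  exact mode_le_one hρ (h0 η) ht

lemma memLp_symbol_mode_mul {p : ℝ≥0∞} (hρ : ρ ∈ Ioo (0 : ℝ) 1) (hlam : Continuous lam)
    (h0 : ∀ η, 0 ≤ lam η) (ha : MemLp a p) (ht : 0 < t) :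
    MemLp (fun η => ((lam η * mode ρ (lam η) t : ℝ) : ℂ) * a η) p := by
  obtain ⟨C, hC, h⟩ := mul_rpow_mul_mode_le hρ
  refine memLp_mul_of_bound (C := C * t ^ (-ρ)) (hlam.mul (continuous_mode hρ hlam h0 ht.le))
    (fun η => ?_) ha
  have := h0 η
  have := mode_pos hρ (h0 η) ht.le
  rw [Real.norm_of_nonneg (by positivity)]
  exact h _ _ (h0 η) ht

lemma evolution_zero (hρ : ρ ∈ Ioo (0 : ℝ) 1) (x : V) : evolution ρ lam a x 0 = (𝓕⁻ a : V → ℂ) x := by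
  simp [evolution, mode_zero hρ]

lemma continuousOn_evolution (hρ : ρ ∈ Ioo (0 : ℝ) 1) (hlam : Continuous lam)
    (h0 : ∀ η, 0 ≤ lam η) (ha : Integrable a) (x : V) :
    ContinuousOn (evolution ρ lam a x) (Ici 0) := by
  have : evolution ρ lam a x = fun t => ∫ η, planeWave x η *
      ((mode ρ (lam η) t : ℂ) * a η) := by
    ext t; exact fourierInv_eq_integral_mul _ _
  rw [this]
  refine continuousOn_of_dominated (bound := fun η => ‖a η‖) (fun t ht => ?_) (fun t ht => ?_) ha.norm ?_
  · exact (continuous_planeWave x).aestronglyMeasurable.mul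
      (memLp_mode_mul hρ hlam h0 (memLp_one_iff_integrable.2 ha) ht).1
  · refine Eventually.of_forall fun η => ?_
    rw [norm_mul, norm_mul, norm_planeWave, one_mul, Complex.norm_real,
      Real.norm_of_nonneg (mode_pos hρ (h0 η) ht).le]
    exact mul_le_of_le_one_left (norm_nonneg _) (mode_le_one hρ (h0 η) ht)
  · refine Eventually.of_forall fun η => ?_
    exact continuousOn_const.mul ((Complex.continuous_ofReal.comp_continuousOn
      (continuousOn_mode hρ (h0 η))).mul continuousOn_const)

lemma aestronglyMeasurable_modeDeriv_mul (hlam : Continuous lam) (ha : Integrable a) (x : V)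
    (w : ℝ → ℝ) (hw : Measurable w) (μ : Measure ℝ) [SFinite μ] :
    AEStronglyMeasurable (fun p : ℝ × V => (w p.1 : ℂ) * (planeWave x p.2 *
      ((modeDeriv ρ (lam p.2) p.1 : ℂ) * a p.2))) (μ.prod volume) := by
  have h1 : Measurable fun p : ℝ × V => modeDeriv ρ (lam p.2) p.1 :=
    (measurable_modeDeriv ρ).comp ((hlam.measurable.comp measurable_snd).prodMk measurable_fst)
  have h2 : Measurable fun p : ℝ × V => planeWave x p.2 :=
    (continuous_planeWave x).measurable.comp measurable_snd
  have h3 : AEStronglyMeasurable (fun p : ℝ × V => a p.2) (μ.prod volume) := ha.1.comp_snd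
  exact (Complex.measurable_ofReal.comp (hw.comp measurable_fst)).aestronglyMeasurable.mul
    (h2.aestronglyMeasurable.mul ((Complex.measurable_ofReal.comp h1).aestronglyMeasurable.mul h3))

lemma hasDerivAt_evolution (hρ : ρ ∈ Ioo (0 : ℝ) 1) (hlam : Continuous lam)
    (h0 : ∀ η, 0 ≤ lam η) (ha : Integrable a) (x : V) (ht : 0 < t) :
    HasDerivAt (evolution ρ lam a x) (∫ η, planeWave x η *
      ((modeDeriv ρ (lam η) t : ℂ) * a η)) t := by
  have : evolution ρ lam a x = fun t => ∫ η, planeWave x η *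
      ((mode ρ (lam η) t : ℂ) * a η) := by
    ext t; exact fourierInv_eq_integral_mul _ _
  rw [this]
  have hm : ∀ s : ℝ, 0 ≤ s → AEStronglyMeasurable (fun η => planeWave x η *
      ((mode ρ (lam η) s : ℂ) * a η)) volume := fun s hs =>
    (continuous_planeWave x).aestronglyMeasurable.mul
      (memLp_mode_mul hρ hlam h0 (memLp_one_iff_integrable.2 ha) hs).1
  refine (hasDerivAt_integral_of_dominated_loc_of_deriv_le
    (F := fun t η => planeWave x η * ((mode ρ (lam η) t : ℂ) * a η))
    (F' := fun t η => planeWave x η * ((modeDeriv ρ (lam η) t : ℂ) * a η)) (bound := fun η => 2 / t * ‖a η‖)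
    (Ioi_mem_nhds (half_lt_self ht)) ?_ ?_ ?_ ?_ (ha.norm.const_mul _) ?_).2
  · filter_upwards [Ioi_mem_nhds ht] with s hs using hm s (le_of_lt hs)
  · refine Integrable.mono' ha.norm (hm t ht.le) (Eventually.of_forall fun η => ?_)
    rw [norm_mul, norm_mul, norm_planeWave, one_mul, Complex.norm_real,
      Real.norm_of_nonneg (mode_pos hρ (h0 η) ht.le).le]
    exact mul_le_of_le_one_left (norm_nonneg _) (mode_le_one hρ (h0 η) ht.le)
  · have h1 : Measurable fun η : V => modeDeriv ρ (lam η) t :=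
      (measurable_modeDeriv ρ).comp (hlam.measurable.prodMk measurable_const)
    exact (continuous_planeWave x).aestronglyMeasurable.mul
      ((Complex.measurable_ofReal.comp h1).aestronglyMeasurable.mul ha.1)
  · refine Eventually.of_forall fun η s hs => ?_
    have hs' : t / 2 < s := hs
    have hs0 : 0 < s := by linarith
    rw [norm_mul, norm_mul, norm_planeWave, one_mul, Complex.norm_real]
    refine mul_le_mul_of_nonneg_right ?_ (norm_nonneg _)
    refine (abs_modeDeriv_le hρ (h0 η) hs0).trans ?_
    rw [div_le_div_iff₀ hs0 ht]
    linarith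
  · refine Eventually.of_forall fun η s hs => ?_
    have hs' : t / 2 < s := hs
    exact (((hasDerivAt_mode hρ (h0 η) (by linarith)).ofReal_comp).mul_const _).const_mul _

/-- Modes decrease in time, so the integral of the absolute value over s is the exact value Γ(1 - ρ)
lam · mode up to |a|, and this is a bounded multiple of |a|. The result licenses Fubini in
`caputo_evolution`. -/
lemma integrable_kernel_mul_modeDeriv (hρ : ρ ∈ Ioo (0 : ℝ) 1) (hlam : Continuous lam)
    (h0 : ∀ η, 0 ≤ lam η) (ha : Integrable a) (x : V) (ht : 0 < t) :
    Integrable (fun p : ℝ × V => (((t - p.1) ^ (-ρ) : ℝ) : ℂ) *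
      (planeWave x p.2 * ((modeDeriv ρ (lam p.2) p.1 : ℂ) * a p.2)))
      ((volume.restrict (Ioo 0 t)).prod volume) := by
  have hm := aestronglyMeasurable_modeDeriv_mul (ρ := ρ) hlam ha x (fun s => (t - s) ^ (-ρ))
    ((measurable_const.sub measurable_id).pow_const _) (volume.restrict (Ioo 0 t))
  rw [integrable_prod_iff' hm]
  constructor
  · refine Eventually.of_forall fun η => ?_
    have h := (integral_rpow_mul_modeDeriv hρ (h0 η) ht).1
    refine (h.ofReal.mul_const (planeWave x η * a η)).congr
      (Eventually.of_forall fun s => ?_)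
    simp only [RCLike.ofReal_mul, Complex.coe_algebraMap]
    ring
  · obtain ⟨C, hC, hle⟩ := mul_rpow_mul_mode_le hρ
    have hval : ∀ η, ∫ s in Ioo 0 t, ‖(((t - s) ^ (-ρ) : ℝ) : ℂ) *
        (planeWave x η * ((modeDeriv ρ (lam η) s : ℂ) * a η))‖ =
        Real.Gamma (1 - ρ) * ‖((lam η * mode ρ (lam η) t : ℝ) : ℂ) * a η‖ := by
      intro η
      have h := (integral_rpow_mul_modeDeriv hρ (h0 η) ht).2
      have h1 : EqOn (fun s => ‖(((t - s) ^ (-ρ) : ℝ) : ℂ) *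
          (planeWave x η * ((modeDeriv ρ (lam η) s : ℂ) * a η))‖)
          (fun s => -‖a η‖ * ((t - s) ^ (-ρ) * modeDeriv ρ (lam η) s)) (Ioo 0 t) := by
        intro s hs
        have h2 := modeDeriv_nonpos hρ (h0 η) hs.1
        have h3 : 0 ≤ (t - s) ^ (-ρ) := Real.rpow_nonneg (by linarith [hs.2]) _
        simp only [norm_mul, norm_planeWave, one_mul, Complex.norm_real]
        rw [Real.norm_of_nonneg h3, Real.norm_of_nonpos h2]
        ring
      have h4 := h0 η
      have h5 := mode_pos hρ (h0 η) ht.le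
      rw [setIntegral_congr_fun measurableSet_Ioo h1, integral_const_mul, h, norm_mul,
        Complex.norm_real, Real.norm_of_nonneg (by positivity)]
      ring
    simp_rw [hval]
    exact (memLp_one_iff_integrable.1 (memLp_symbol_mode_mul hρ hlam h0
      (memLp_one_iff_integrable.2 ha) ht)).norm.const_mul _

lemma integrableOn_kernel_smul_deriv_evolution (hρ : ρ ∈ Ioo (0 : ℝ) 1) (hlam : Continuous lam)
    (h0 : ∀ η, 0 ≤ lam η) (ha : Integrable a) (x : V) (ht : 0 < t) :
    IntegrableOn (fun s => ((t - s) ^ (-ρ) : ℝ) • deriv (evolution ρ lam a x) s) (Ioo 0 t) := by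
  have h : IntegrableOn (fun s => ∫ η, (((t - s) ^ (-ρ) : ℝ) : ℂ) *
      (planeWave x η * ((modeDeriv ρ (lam η) s : ℂ) * a η))) (Ioo 0 t) :=
    (integrable_kernel_mul_modeDeriv hρ hlam h0 ha x ht).integral_prod_left
  refine IntegrableOn.congr_fun h (fun s hs => ?_) measurableSet_Ioo
  rw [(hasDerivAt_evolution hρ hlam h0 ha x hs.1).deriv, integral_const_mul, Complex.real_smul]

/-- Fubini brings the Caputo derivative inside the frequency integral, where each mode solves its
own scalar equation. -/
theorem caputo_evolution (hρ : ρ ∈ Ioo (0 : ℝ) 1) (hlam : Continuous lam)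
    (h0 : ∀ η, 0 ≤ lam η) (ha : Integrable a) (x : V) (ht : 0 < t) :
    caputo ρ (evolution ρ lam a x) t = -evolutionSymbol ρ lam a x t := by
  have hΓ : 0 < Real.Gamma (1 - ρ) := Real.Gamma_pos_of_pos (by linarith [hρ.2])
  have hswap := integral_integral_swap
    (f := fun s η => (((t - s) ^ (-ρ) : ℝ) : ℂ) *
      (planeWave x η * ((modeDeriv ρ (lam η) s : ℂ) * a η)))
    (integrable_kernel_mul_modeDeriv hρ hlam h0 ha x ht)
  have h1 : ∫ s in (0 : ℝ)..t, ((t - s) ^ (-ρ) : ℝ) • deriv (evolution ρ lam a x) s =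
      ∫ s in Ioo 0 t, ∫ η, (((t - s) ^ (-ρ) : ℝ) : ℂ) *
      (planeWave x η * ((modeDeriv ρ (lam η) s : ℂ) * a η)) := by
    rw [intervalIntegral.integral_of_le ht.le, integral_Ioc_eq_integral_Ioo]
    refine setIntegral_congr_fun measurableSet_Ioo fun s hs => ?_
    rw [(hasDerivAt_evolution hρ hlam h0 ha x hs.1).deriv, integral_const_mul, Complex.real_smul]
  have h2 : ∀ η, ∫ s in Ioo 0 t, (((t - s) ^ (-ρ) : ℝ) : ℂ) *
      (planeWave x η * ((modeDeriv ρ (lam η) s : ℂ) * a η)) =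
      -(Real.Gamma (1 - ρ) : ℂ) * (planeWave x η *
        (((lam η * mode ρ (lam η) t : ℝ) : ℂ) * a η)) := by
    intro η
    have h := congrArg (fun r : ℝ => (r : ℂ)) (integral_rpow_mul_modeDeriv hρ (h0 η) ht).2
    rw [← integral_complex_ofReal] at h
    have h3 : ∀ s : ℝ, (((t - s) ^ (-ρ) : ℝ) : ℂ) *
      (planeWave x η * ((modeDeriv ρ (lam η) s : ℂ) * a η)) =
      (((t - s) ^ (-ρ) * modeDeriv ρ (lam η) s : ℝ) : ℂ) *
        (planeWave x η * a η) := by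
      intro s; push_cast; ring
    simp_rw [h3]
    rw [integral_mul_const, h]
    push_cast; ring
  rw [caputo, h1, hswap]
  simp_rw [h2]
  rw [integral_const_mul, evolutionSymbol, fourierInv_eq_integral_mul, Complex.real_smul, neg_mul,
    mul_neg, ← mul_assoc, ← Complex.ofReal_mul, inv_mul_cancel₀ hΓ.ne', Complex.ofReal_one, one_mul]

lemma hasCaputo_evolution (hρ : ρ ∈ Ioo (0 : ℝ) 1) (hlam : Continuous lam)
    (h0 : ∀ η, 0 ≤ lam η) (ha : Integrable a) (x : V) {T : ℝ} (hT : 0 < T) :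
    HasCaputo ρ T (evolution ρ lam a x) where
  continuousOn := (continuousOn_evolution hρ hlam h0 ha x).mono Icc_subset_Ici_self
  differentiableAt t ht := (hasDerivAt_evolution hρ hlam h0 ha x ht.1).differentiableAt
  integrable_deriv := by
    -- Integrability against the kernel at time T suffices: multiplying by the bounded function (T -
    -- s)^ρ removes the kernel.
    have h := integrableOn_kernel_smul_deriv_evolution hρ hlam h0 ha x hT
    have h2 : IntegrableOn (fun s => (((T - s) ^ ρ : ℝ) : ℂ) *
        (((T - s) ^ (-ρ) : ℝ) • deriv (evolution ρ lam a x) s)) (Ioo 0 T) := by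
      refine Integrable.bdd_mul (c := T ^ ρ) h ?_ ?_
      · exact (Complex.measurable_ofReal.comp
          ((measurable_const.sub measurable_id).pow_const _)).aestronglyMeasurable
      · filter_upwards [ae_restrict_mem measurableSet_Ioo] with s hs
        have h1 : 0 ≤ T - s := by linarith [hs.2]
        rw [Complex.norm_real, Real.norm_of_nonneg (by positivity)]
        exact Real.rpow_le_rpow h1 (by linarith [hs.1]) hρ.1.le
    refine IntegrableOn.congr_fun h2 (fun s hs => ?_) measurableSet_Ioo
    have h1 : 0 < T - s := by linarith [hs.2]
    rw [Complex.real_smul, ← mul_assoc, ← Complex.ofReal_mul, ← Real.rpow_add h1]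
    simp
  integrable_kernel t ht := integrableOn_kernel_smul_deriv_evolution hρ hlam h0 ha x ht.1

lemma continuousOn_evolutionSymbol (hρ : ρ ∈ Ioo (0 : ℝ) 1) (hlam : Continuous lam)
    (h0 : ∀ η, 0 ≤ lam η) (ha : Integrable a) (T : ℝ) :
    ContinuousOn (fun p : V × ℝ => evolutionSymbol ρ lam a p.1 p.2) (univ ×ˢ Ioc 0 T) := by
  have : (fun p : V × ℝ => evolutionSymbol ρ lam a p.1 p.2) = fun p =>
      ∫ η, planeWave p.1 η *
        (((lam η * mode ρ (lam η) p.2 : ℝ) : ℂ) * a η) := by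
    ext p; exact fourierInv_eq_integral_mul _ _
  rw [this]
  rintro ⟨x, t⟩ ⟨-, ht, -⟩
  simp only at ht
  refine ContinuousAt.continuousWithinAt ?_
  obtain ⟨C, hC, hle⟩ := mul_rpow_mul_mode_le hρ
  have hev : ∀ᶠ p : V × ℝ in 𝓝 (x, t), t / 2 < p.2 :=
    (continuous_snd.tendsto (x, t)).eventually (lt_mem_nhds (half_lt_self ht))
  refine continuousAt_of_dominated (bound := fun η => C * (t / 2) ^ (-ρ) * ‖a η‖) ?_ ?_
    (ha.norm.const_mul _) ?_
  · filter_upwards [hev] with p hp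
    exact (continuous_planeWave p.1).aestronglyMeasurable.mul
      (memLp_symbol_mode_mul hρ hlam h0 (memLp_one_iff_integrable.2 ha) (by linarith)).1
  · filter_upwards [hev] with p hp
    refine Eventually.of_forall fun η => ?_
    have hp0 : 0 < p.2 := by linarith
    have := h0 η
    have := mode_pos hρ (h0 η) hp0.le
    rw [norm_mul, norm_mul, norm_planeWave, one_mul, Complex.norm_real,
      Real.norm_of_nonneg (by positivity)]
    refine mul_le_mul_of_nonneg_right ((hle _ _ (h0 η) hp0).trans ?_) (norm_nonneg _)
    refine mul_le_mul_of_nonneg_left ?_ hC.le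
    exact Real.rpow_le_rpow_of_nonpos (by linarith) hp.le (by linarith [hρ.1])
  · refine Eventually.of_forall fun η => ?_
    have hmode : ContinuousAt (mode ρ (lam η)) t :=
      (continuousOn_mode hρ (h0 η)).continuousAt (Ici_mem_nhds ht)
    have h1 : ContinuousAt (fun p : V × ℝ => mode ρ (lam η) p.2) (x, t) :=
      ContinuousAt.comp (f := Prod.snd) (g := mode ρ (lam η)) hmode continuous_snd.continuousAt
    have h2 : Continuous fun p : V × ℝ => planeWave p.1 η :=
      (continuous_planeWave_prod η).comp continuous_fst
    exact h2.continuousAt.mul ((Complex.continuous_ofReal.continuousAt.comp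
      (continuousAt_const.mul h1)).mul continuousAt_const)

lemma lintegral_eLpNorm_evolutionSymbol_lt_top (hρ : ρ ∈ Ioo (0 : ℝ) 1) (hlam : Continuous lam)
    (h0 : ∀ η, 0 ≤ lam η) (ha : Integrable a) (ha2 : MemLp a 2) (T : ℝ) :
    (∫⁻ t in Ioc 0 T, eLpNorm (fun x => evolutionSymbol ρ lam a x t) 2 volume) < ∞ := by
  obtain ⟨C, hC, hle⟩ := mul_rpow_mul_mode_le hρ
  rcases le_or_gt T 0 with hT | hT
  · simp [Ioc_eq_empty_of_le hT]
  have hb : ∀ t ∈ Ioc 0 T, eLpNorm (fun x => evolutionSymbol ρ lam a x t) 2 volume ≤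
      ENNReal.ofReal (C * t ^ (-ρ)) * eLpNorm a 2 volume := by
    intro t ht
    have h1 := eLpNorm_fourierInv (memLp_one_iff_integrable.1 (memLp_symbol_mode_mul hρ hlam h0
      (memLp_one_iff_integrable.2 ha) ht.1)) (memLp_symbol_mode_mul hρ hlam h0 ha2 ht.1)
    refine h1.le.trans ?_
    refine eLpNorm_le_mul_eLpNorm_of_ae_le_mul (Eventually.of_forall fun η => ?_) 2
    have := h0 η
    have := mode_pos hρ (h0 η) ht.1.le
    rw [norm_mul, Complex.norm_real, Real.norm_of_nonneg (by positivity)]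
    exact mul_le_mul_of_nonneg_right (hle _ _ (h0 η) ht.1) (norm_nonneg _)
  refine (setLIntegral_mono' measurableSet_Ioc hb).trans_lt ?_
  rw [lintegral_mul_const' _ _ ha2.eLpNorm_ne_top]
  refine ENNReal.mul_lt_top ?_ ha2.eLpNorm_lt_top
  have hint : IntegrableOn (fun t : ℝ => C * t ^ (-ρ)) (Ioc 0 T) := by
    have := (intervalIntegral.intervalIntegrable_rpow' (a := 0) (b := T) (r := -ρ)
      (by linarith [hρ.2])).1
    exact this.const_mul C
  exact hint.lintegral_lt_top

end Evolution

end

/-! ### Existence for (1), and calculus of Lebesgue points. -/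

section

variable {N l : ℕ} {A : MvPolynomial (Fin N) ℝ}

lemma symbol_nonneg (hl : 0 < l) (hA : A.IsHomogeneous (2 * l))
    (hApos : ∀ ξ : EuclideanSpace ℝ (Fin N), ξ ≠ 0 → 0 < symbol A ξ)
    (ξ : EuclideanSpace ℝ (Fin N)) : 0 ≤ symbol A ξ := by
  by_cases h : ξ = 0
  · have h0 : MvPolynomial.coeff 0 A = 0 := hA.coeff_eq_zero (by simp; omega)
    have : symbol A ξ = MvPolynomial.coeff 0 A := by
      rw [h, symbol, ← MvPolynomial.constantCoeff_eq, ← MvPolynomial.eval_zero]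
      rfl
    rw [this, h0]
  · exact (hApos ξ h).le

lemma continuous_symbol (A : MvPolynomial (Fin N) ℝ) : Continuous (symbol A) :=
  (MvPolynomial.continuous_eval A).comp (by fun_prop)

/-- The symbol of `Â^σ` in the variable of Mathlib's Fourier transform. -/
noncomputable def powerSymbol (A : MvPolynomial (Fin N) ℝ) (σ : ℝ) (η : EuclideanSpace ℝ (Fin N)) : ℝ :=
  symbol A ((2 * Real.pi) • η) ^ σ

lemma powerSymbol_smul (σ : ℝ) (ξ : EuclideanSpace ℝ (Fin N)) :
    powerSymbol A σ ((2 * Real.pi)⁻¹ • ξ) = symbol A ξ ^ σ := by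
  rw [powerSymbol, smul_smul, mul_inv_cancel₀ (by positivity), one_smul]

lemma continuous_powerSymbol {σ : ℝ} (hσ : 0 ≤ σ) : Continuous (powerSymbol A σ) :=
  ((continuous_symbol A).comp (continuous_const_smul _)).rpow_const fun _ => Or.inr hσ

lemma powerSymbol_nonneg (hA0 : ∀ ξ, 0 ≤ symbol A ξ) (σ : ℝ) (η : EuclideanSpace ℝ (Fin N)) :
    0 ≤ powerSymbol A σ η := Real.rpow_nonneg (hA0 _) _

section Existence

variable {ρ σ T : ℝ} {a : EuclideanSpace ℝ (Fin N) → ℂ}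

lemma hat_evolution (hρ : ρ ∈ Ioo (0 : ℝ) 1) (hσ : 0 ≤ σ) (hA0 : ∀ ξ, 0 ≤ symbol A ξ)
    (ha : Integrable a) (ha2 : MemLp a 2) {t : ℝ} (ht : 0 ≤ t) :
    hat (fun x => evolution ρ (powerSymbol A σ) a x t) =ᵐ[volume] fun ξ =>
      (mode ρ (symbol A ξ ^ σ) t : ℂ) *
        ((((2 * Real.pi) ^ N)⁻¹ : ℝ) • a ((2 * Real.pi)⁻¹ • ξ)) := by
  have hc := continuous_powerSymbol (A := A) hσ
  have h0 := powerSymbol_nonneg hA0 σ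
  have h1 := hat_fourierInv (memLp_one_iff_integrable.1 (memLp_mode_mul hρ hc h0
    (memLp_one_iff_integrable.2 ha) ht)) (memLp_mode_mul hρ hc h0 ha2 ht)
  filter_upwards [h1] with ξ hξ
  refine hξ.trans ?_
  rw [powerSymbol_smul, mul_smul_comm]

lemma hat_evolutionSymbol (hρ : ρ ∈ Ioo (0 : ℝ) 1) (hσ : 0 ≤ σ) (hA0 : ∀ ξ, 0 ≤ symbol A ξ)
    (ha : Integrable a) (ha2 : MemLp a 2) {t : ℝ} (ht : 0 < t) :
    hat (fun x => evolutionSymbol ρ (powerSymbol A σ) a x t) =ᵐ[volume] fun ξ =>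
      ((symbol A ξ ^ σ * mode ρ (symbol A ξ ^ σ) t : ℝ) : ℂ) *
        ((((2 * Real.pi) ^ N)⁻¹ : ℝ) • a ((2 * Real.pi)⁻¹ • ξ)) := by
  have hc := continuous_powerSymbol (A := A) hσ
  have h0 := powerSymbol_nonneg hA0 σ
  have h1 := hat_fourierInv (memLp_one_iff_integrable.1 (memLp_symbol_mode_mul hρ hc h0
    (memLp_one_iff_integrable.2 ha) ht)) (memLp_symbol_mode_mul hρ hc h0 ha2 ht)
  filter_upwards [h1] with ξ hξ
  refine hξ.trans ?_
  rw [powerSymbol_smul, mul_smul_comm]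

theorem isSolution_evolution (hρ : ρ ∈ Ioo (0 : ℝ) 1) (hσ : 0 ≤ σ) (hA0 : ∀ ξ, 0 ≤ symbol A ξ)
    (ha : Integrable a) (ha2 : MemLp a 2) (hT : 0 < T) :
    IsSolution A ρ σ T (𝓕⁻ a) (evolution ρ (powerSymbol A σ) a) := by
  have hc := continuous_powerSymbol (A := A) hσ
  have h0 := powerSymbol_nonneg hA0 σ
  have ha1 : MemLp a 1 := memLp_one_iff_integrable.2 ha
  refine ⟨evolution_zero hρ, fun t ht => tendsto_fourierInv_cocompact _,
    fun x => hasCaputo_evolution hρ hc h0 ha x hT, ?_, fun t ht => ?_,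
    evolutionSymbol ρ (powerSymbol A σ) a, continuousOn_evolutionSymbol hρ hc h0 ha T,
    fun t ht => ⟨?_, ?_, ?_⟩, lintegral_eLpNorm_evolutionSymbol_lt_top hρ hc h0 ha ha2 T, ?_⟩
  · refine (continuousOn_evolutionSymbol hρ hc h0 ha T).neg.congr fun p hp => ?_
    exact caputo_evolution hρ hc h0 ha p.1 hp.2.1
  · rw [integrable_congr (hat_evolution hρ hσ hA0 ha ha2 ht.1.le)]
    have h1 := (((memLp_one_iff_integrable.1 (memLp_mode_mul hρ hc h0 ha1 ht.1.le)).comp_smul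
      two_pi_inv_ne_zero).smul (((2 * Real.pi) ^ N)⁻¹ : ℝ))
    refine h1.congr (Eventually.of_forall fun ξ => ?_)
    simp only [Pi.smul_apply]
    rw [powerSymbol_smul, mul_smul_comm]
  · exact memLp_fourierInv (memLp_one_iff_integrable.1 (memLp_mode_mul hρ hc h0 ha1 ht.1.le))
      (memLp_mode_mul hρ hc h0 ha2 ht.1.le)
  · exact memLp_fourierInv (memLp_one_iff_integrable.1 (memLp_symbol_mode_mul hρ hc h0 ha1 ht.1))
      (memLp_symbol_mode_mul hρ hc h0 ha2 ht.1)
  · filter_upwards [hat_evolution hρ hσ hA0 ha ha2 ht.1.le,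
      hat_evolutionSymbol hρ hσ hA0 ha ha2 ht.1] with ξ h1 h2
    rw [h1, h2, Complex.ofReal_mul, mul_assoc]
  · intro x t ht
    rw [caputo_evolution hρ hc h0 ha x ht.1, neg_add_cancel]

end Existence

section LebesgueValue

variable {f g : EuclideanSpace ℝ (Fin N) → ℂ} {ξ : EuclideanSpace ℝ (Fin N)} {c c' : ℂ}

lemma HasLebesgueValue.congr (h : HasLebesgueValue f ξ c) (hfg : f =ᵐ[volume] g) :
    HasLebesgueValue g ξ c := by
  refine Tendsto.congr (fun r => ?_) h
  refine setLAverage_congr_fun_ae measurableSet_ball ?_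
  filter_upwards [hfg] with η hη _
  rw [hη]

lemma setLAverage_ball_const (ξ : EuclideanSpace ℝ (Fin N)) {r : ℝ} (hr : 0 < r) (k : ℝ≥0∞) :
    ⨍⁻ _ in Metric.ball ξ r, k ∂volume = k :=
  setLAverage_const (Metric.measure_ball_pos volume ξ hr).ne' measure_ball_lt_top.ne k

lemma setLAverage_mono {s : Set (EuclideanSpace ℝ (Fin N))} (hs : MeasurableSet s)
    {f g : EuclideanSpace ℝ (Fin N) → ℝ≥0∞} (h : ∀ x ∈ s, f x ≤ g x) :
    ⨍⁻ x in s, f x ∂volume ≤ ⨍⁻ x in s, g x ∂volume := by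
  rw [setLAverage_eq, setLAverage_eq]
  exact ENNReal.div_le_div_right (setLIntegral_mono' hs h) _

lemma setLAverage_add_const (hf : AEStronglyMeasurable f volume) (k : ℝ≥0∞) {r : ℝ} (hr : 0 < r) :
    ⨍⁻ η in Metric.ball ξ r, (‖f η - c‖ₑ + k) ∂volume =
      (⨍⁻ η in Metric.ball ξ r, ‖f η - c‖ₑ ∂volume) + k := by
  have h := setLAverage_ball_const ξ hr k
  have hm : AEMeasurable (fun η => ‖f η - c‖ₑ) (volume.restrict (Metric.ball ξ r)) :=
    (hf.restrict.sub aestronglyMeasurable_const).enorm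
  rw [setLAverage_eq] at h ⊢
  rw [lintegral_add_left' hm, ENNReal.add_div, h,
    setLAverage_eq]

lemma HasLebesgueValue.unique (hf : AEStronglyMeasurable f volume) (h : HasLebesgueValue f ξ c)
    (h' : HasLebesgueValue f ξ c') : c = c' := by
  have hle : ∀ᶠ r : ℝ in 𝓝[>] 0, ‖c - c'‖ₑ ≤ (⨍⁻ η in Metric.ball ξ r, ‖f η - c‖ₑ ∂volume) +
      ⨍⁻ η in Metric.ball ξ r, ‖f η - c'‖ₑ ∂volume := by
    filter_upwards [self_mem_nhdsWithin] with r hr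
    rw [← setLAverage_ball_const ξ hr ‖c - c'‖ₑ]
    have h1 : ∀ η, ‖c - c'‖ₑ ≤ ‖f η - c‖ₑ + ‖f η - c'‖ₑ := fun η => by
      have e : c - c' = (f η - c') - (f η - c) := by ring
      rw [e, add_comm]
      exact enorm_sub_le
    refine (setLAverage_mono measurableSet_ball fun η _ => h1 η).trans ?_
    have hm : AEMeasurable (fun η => ‖f η - c‖ₑ) (volume.restrict (Metric.ball ξ r)) :=
      (hf.restrict.sub aestronglyMeasurable_const).enorm
    rw [setLAverage_eq, lintegral_add_left' hm,
      ENNReal.add_div, ← setLAverage_eq, ← setLAverage_eq]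
  have h0 := ge_of_tendsto (Tendsto.add h h') hle
  rw [add_zero, nonpos_iff_eq_zero, enorm_eq_zero, sub_eq_zero] at h0
  exact h0

/-- From gf - g(ξ)c = g(f - c) + (g - g(ξ))c: the first term is controlled by |g| ≤ 1, the second by
continuity at ξ. This carries Lebesgue points of φ̂ over to v̂(·, t). -/
lemma HasLebesgueValue.mul (hf : AEStronglyMeasurable f volume) (h : HasLebesgueValue f ξ c)
    (hg : ContinuousAt g ξ) (hg1 : ∀ η, ‖g η‖ ≤ 1) :
    HasLebesgueValue (fun η => g η * f η) ξ (g ξ * c) := by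
  rw [HasLebesgueValue, ENNReal.tendsto_nhds_zero] at h ⊢
  intro ε hε
  have hε2 : 0 < ε / 2 := ENNReal.half_pos hε.ne'
  have hcont : Tendsto (fun η => ‖(g η - g ξ) * c‖ₑ) (𝓝 ξ) (𝓝 0) := by
    have : Tendsto (fun η => (g η - g ξ) * c) (𝓝 ξ) (𝓝 0) := by
      simpa using (hg.sub_const (g ξ)).mul_const c
    simpa using this.enorm
  rw [ENNReal.tendsto_nhds_zero] at hcont
  obtain ⟨δ, hδ, hball⟩ := Metric.eventually_nhds_iff_ball.1 (hcont _ hε2)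
  filter_upwards [h _ hε2, Ioo_mem_nhdsGT hδ] with r hr hrδ
  calc ⨍⁻ η in Metric.ball ξ r, ‖g η * f η - g ξ * c‖ₑ ∂volume
      ≤ ⨍⁻ η in Metric.ball ξ r, (‖f η - c‖ₑ + ε / 2) ∂volume := by
        refine setLAverage_mono measurableSet_ball fun η hη => ?_
        have e : g η * f η - g ξ * c = g η * (f η - c) + (g η - g ξ) * c := by ring
        rw [e]
        refine (enorm_add_le _ _).trans (add_le_add ?_ (hball η (Metric.ball_subset_ball hrδ.2.le hη)))
        rw [enorm_mul]
        refine mul_le_of_le_one_left' ?_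
        rw [← ofReal_norm]
        exact ENNReal.ofReal_le_one.2 (hg1 η)
    _ = (⨍⁻ η in Metric.ball ξ r, ‖f η - c‖ₑ ∂volume) + ε / 2 := setLAverage_add_const hf _ hrδ.1
    _ ≤ ε / 2 + ε / 2 := by gcongr
    _ = ε := ENNReal.add_halves ε

lemma aestronglyMeasurable_hat {f : EuclideanSpace ℝ (Fin N) → ℂ} (hf : MemLp f 2 volume) :
    AEStronglyMeasurable (hat f) volume := by
  have : hat f = fun ξ => (((2 * Real.pi) ^ N)⁻¹ : ℝ) •
      (𝓕 (hf.toLp f) : Lp ℂ 2 volume) ((2 * Real.pi)⁻¹ • ξ) := funext (hat_of_memLp hf)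
  rw [this]
  have h := (Lp.stronglyMeasurable (𝓕 (hf.toLp f) : Lp ℂ 2 volume)).comp_measurable
    (measurable_const_smul (2 * Real.pi)⁻¹)
  exact (h.const_smul (((2 * Real.pi) ^ N)⁻¹ : ℝ)).aestronglyMeasurable

end LebesgueValue

end

/-! ### Abel inversion of the Caputo derivative and fractional integrals. -/

section Abel

variable {ρ t T : ℝ}

/-- The kernel of the composition of the fractional integrals of orders `ρ` and `1 - ρ`. -/
noncomputable def abelKernel (ρ t s r : ℝ) : ℝ :=
  if r < s then (t - s) ^ (ρ - 1) * (s - r) ^ (-ρ) else 0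

lemma measurable_abelKernel (ρ t : ℝ) : Measurable fun p : ℝ × ℝ => abelKernel ρ t p.1 p.2 := by
  unfold abelKernel
  refine Measurable.ite (measurableSet_lt measurable_snd measurable_fst) ?_ measurable_const
  exact ((measurable_const.sub measurable_fst).pow_const _).mul
    ((measurable_fst.sub measurable_snd).pow_const _)

lemma abelKernel_nonneg {s r : ℝ} (hs : s ≤ t) : 0 ≤ abelKernel ρ t s r := by
  unfold abelKernel
  split_ifs with h
  · exact mul_nonneg (Real.rpow_nonneg (by linarith) _) (Real.rpow_nonneg (by linarith) _)
  · exact le_rfl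

/-- A translated Beta integral B(1 - ρ, ρ); its value depends on neither r nor t, so the two
fractional integrals compose to plain integration. -/
lemma integral_abelKernel (hρ : ρ ∈ Ioo (0 : ℝ) 1) {r : ℝ} (hr : r ∈ Ioo 0 t) :
    IntegrableOn (fun s => abelKernel ρ t s r) (Ioo 0 t) ∧
    ∫ s in Ioo 0 t, abelKernel ρ t s r = Real.Gamma (1 - ρ) * Real.Gamma ρ := by
  have htr : 0 < t - r := by linarith [hr.2]
  have h1 : 0 < 1 - ρ := by linarith [hρ.2]
  set G : ℝ → ℝ := fun u => (t - r - u) ^ (ρ - 1) * u ^ (1 - ρ - 1) with hG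
  have hind : (Ioo 0 t).indicator (fun s => abelKernel ρ t s r) =
      fun s => (Ioo 0 (t - r)).indicator G (s - r) := by
    ext s
    by_cases hs : r < s ∧ s < t
    · rw [indicator_of_mem (show s ∈ Ioo 0 t from ⟨hr.1.trans hs.1, hs.2⟩),
        indicator_of_mem (show s - r ∈ Ioo 0 (t - r) from ⟨by linarith, by linarith⟩), abelKernel,
        if_pos hs.1, hG]
      congr 2 <;> ring
    · rw [indicator_of_notMem (s := Ioo 0 (t - r))]
      · by_cases hs' : s ∈ Ioo 0 t
        · rw [indicator_of_mem hs', abelKernel, if_neg]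
          exact fun h => hs ⟨h, hs'.2⟩
        · rw [indicator_of_notMem hs']
      · exact fun h => hs ⟨by linarith [h.1], by linarith [h.2]⟩
  constructor
  · rw [← integrable_indicator_iff measurableSet_Ioo, hind]
    refine Integrable.comp_sub_right ?_ r
    rw [integrable_indicator_iff measurableSet_Ioo]
    exact integrableOn_rpow_mul_rpow_sub h1 hρ.1 htr
  · rw [← integral_indicator measurableSet_Ioo, hind, integral_sub_right_eq_self,
      integral_indicator measurableSet_Ioo, hG, integral_rpow_mul_rpow_sub h1 hρ.1 htr]
    simp

/-- The fractional integral of order `ρ` inverts the Caputo derivative. -/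
theorem integral_caputo (hρ : ρ ∈ Ioo (0 : ℝ) 1) {h : ℝ → ℂ} (H : HasCaputo ρ T h)
    (ht : t ∈ Ioc 0 T) :
    IntegrableOn (fun s => ((t - s) ^ (ρ - 1) : ℝ) • caputo ρ h s) (Ioo 0 t) ∧
    ((Real.Gamma ρ)⁻¹ : ℝ) • ∫ s in Ioo 0 t, ((t - s) ^ (ρ - 1) : ℝ) • caputo ρ h s = h t - h 0 := by
  have hΓ1 : 0 < Real.Gamma (1 - ρ) := Real.Gamma_pos_of_pos (by linarith [hρ.2])
  have hΓ : 0 < Real.Gamma ρ := Real.Gamma_pos_of_pos hρ.1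
  have hf : IntegrableOn (deriv h) (Ioo 0 t) := H.integrable_deriv.mono_set (Ioo_subset_Ioo_right ht.2)
  have hm : AEStronglyMeasurable (fun p : ℝ × ℝ => abelKernel ρ t p.1 p.2 • deriv h p.2)
      ((volume.restrict (Ioo 0 t)).prod (volume.restrict (Ioo 0 t))) :=
    (measurable_abelKernel ρ t).aestronglyMeasurable.smul hf.1.comp_snd
  -- The kernel is nonnegative with constant integral in s, so joint integrability reduces to that
  -- of the derivative of h.
  have hint : Integrable (fun p : ℝ × ℝ => abelKernel ρ t p.1 p.2 • deriv h p.2)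
      ((volume.restrict (Ioo 0 t)).prod (volume.restrict (Ioo 0 t))) := by
    rw [integrable_prod_iff' hm]
    constructor
    · filter_upwards [ae_restrict_mem measurableSet_Ioo] with r hr
      exact (integral_abelKernel hρ hr).1.smul_const _
    · refine (hf.norm.const_mul (Real.Gamma (1 - ρ) * Real.Gamma ρ)).congr ?_
      filter_upwards [ae_restrict_mem measurableSet_Ioo] with r hr
      rw [← (integral_abelKernel hρ hr).2, ← integral_mul_const]
      refine setIntegral_congr_fun measurableSet_Ioo fun s hs => ?_
      rw [norm_smul, Real.norm_of_nonneg (abelKernel_nonneg hs.2.le)]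
  have hinner : ∀ s ∈ Ioo 0 t, ∫ r in Ioo 0 t, abelKernel ρ t s r • deriv h r =
      Real.Gamma (1 - ρ) • (((t - s) ^ (ρ - 1) : ℝ) • caputo ρ h s) := by
    intro s hs
    have h1 : ∀ r, (Ioo 0 t).indicator (fun r => abelKernel ρ t s r • deriv h r) r =
        (Ioo 0 s).indicator (fun r => ((t - s) ^ (ρ - 1)) • (((s - r) ^ (-ρ) : ℝ) • deriv h r)) r := by
      intro r
      by_cases hr : 0 < r ∧ r < s
      · rw [indicator_of_mem (show r ∈ Ioo 0 t from ⟨hr.1, hr.2.trans hs.2⟩),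
          indicator_of_mem (show r ∈ Ioo 0 s from ⟨hr.1, hr.2⟩), abelKernel, if_pos hr.2, mul_smul]
      · rw [indicator_of_notMem (s := Ioo 0 s) (by exact fun h => hr ⟨h.1, h.2⟩)]
        by_cases hr' : r ∈ Ioo 0 t
        · rw [indicator_of_mem hr', abelKernel, if_neg (fun h => hr ⟨hr'.1, h⟩), zero_smul]
        · rw [indicator_of_notMem hr']
    rw [← integral_indicator measurableSet_Ioo, integral_congr_ae (Eventually.of_forall h1),
      integral_indicator measurableSet_Ioo, integral_smul, caputo,
      intervalIntegral.integral_of_le hs.1.le, integral_Ioc_eq_integral_Ioo, smul_smul,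
      smul_smul]
    congr 1
    field_simp
  have hswap := integral_integral_swap (f := fun s r => abelKernel ρ t s r • deriv h r) hint
  have hleft : ∫ s in Ioo 0 t, ∫ r in Ioo 0 t, abelKernel ρ t s r • deriv h r =
      Real.Gamma (1 - ρ) • ∫ s in Ioo 0 t, ((t - s) ^ (ρ - 1) : ℝ) • caputo ρ h s := by
    rw [setIntegral_congr_fun measurableSet_Ioo hinner, integral_smul]
  have hright : ∫ r in Ioo 0 t, ∫ s in Ioo 0 t, abelKernel ρ t s r • deriv h r =
      (Real.Gamma (1 - ρ) * Real.Gamma ρ) • (h t - h 0) := by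
    have h1 : EqOn (fun r => ∫ s in Ioo 0 t, abelKernel ρ t s r • deriv h r)
        (fun r => (Real.Gamma (1 - ρ) * Real.Gamma ρ) • deriv h r) (Ioo 0 t) := by
      intro r hr
      simp only
      rw [integral_smul_const, (integral_abelKernel hρ hr).2]
    rw [setIntegral_congr_fun measurableSet_Ioo h1, integral_smul, ← integral_Ioc_eq_integral_Ioo,
      ← intervalIntegral.integral_of_le ht.1.le,
      intervalIntegral.integral_eq_sub_of_hasDerivAt_of_le ht.1.le
        (H.continuousOn.mono (Icc_subset_Icc_right ht.2))
        (fun x hx => (H.differentiableAt x ⟨hx.1, hx.2.trans_le ht.2⟩).hasDerivAt)]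
    rw [intervalIntegrable_iff_integrableOn_Ioo_of_le ht.1.le]
    exact hf
  constructor
  · have h1 : IntegrableOn (fun s => ∫ r in Ioo 0 t, abelKernel ρ t s r • deriv h r) (Ioo 0 t) :=
      hint.integral_prod_left
    have h2 := (h1.congr_fun hinner measurableSet_Ioo).smul (Real.Gamma (1 - ρ))⁻¹
    refine h2.congr (Eventually.of_forall fun s => ?_)
    simp only [Pi.smul_apply]
    rw [smul_smul, inv_mul_cancel₀ hΓ1.ne', one_smul]
  · have h1 : Real.Gamma (1 - ρ) • ∫ s in Ioo 0 t, ((t - s) ^ (ρ - 1) : ℝ) • caputo ρ h s =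
        (Real.Gamma (1 - ρ) * Real.Gamma ρ) • (h t - h 0) := hleft.symm.trans (hswap.trans hright)
    rw [mul_smul] at h1
    have h2 := smul_right_injective ℂ hΓ1.ne' h1
    rw [h2, smul_smul, inv_mul_cancel₀ hΓ.ne', one_smul]

end Abel

/-- Fractional integration is small in weighted `L¹` spaces with a large weight. -/
lemma lintegral_exp_mul_fractionalIntegral_le {ρ μ : ℝ} (hρ : 0 < ρ) (hμ : 0 < μ) (T : ℝ)
    {F : ℝ → ℝ≥0∞} (hF : Measurable F) :
    ∫⁻ t in Ioc 0 T, ENNReal.ofReal (Real.exp (-(μ * t))) *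
      ∫⁻ s in Ioo 0 t, ENNReal.ofReal ((t - s) ^ (ρ - 1)) * F s ≤
    ENNReal.ofReal (μ ^ (-ρ) * Real.Gamma ρ) *
      ∫⁻ s in Ioc 0 T, ENNReal.ofReal (Real.exp (-(μ * s))) * F s := by
  -- Splitting e^{-μt} = e^{-μ(t-s)} e^{-μs} gives a convolution with k, whose mass is μ^{-ρ} Γ(ρ).
  set k : ℝ → ℝ≥0∞ := (Ioi 0).indicator
    (fun u => ENNReal.ofReal (Real.exp (-(μ * u)) * u ^ (ρ - 1))) with hk
  set F' : ℝ → ℝ≥0∞ := (Ioc 0 T).indicator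
    (fun s => ENNReal.ofReal (Real.exp (-(μ * s))) * F s) with hF'
  have hkm : Measurable k := by
    refine Measurable.indicator ?_ measurableSet_Ioi
    exact ENNReal.measurable_ofReal.comp
      ((by fun_prop : Measurable fun u : ℝ => Real.exp (-(μ * u))).mul (measurable_id.pow_const _))
  have hFm : Measurable F' := by
    refine Measurable.indicator ?_ measurableSet_Ioc
    exact (ENNReal.measurable_ofReal.comp (by fun_prop)).mul hF
  have hpt : ∀ t ∈ Ioc 0 T, ENNReal.ofReal (Real.exp (-(μ * t))) *
      ∫⁻ s in Ioo 0 t, ENNReal.ofReal ((t - s) ^ (ρ - 1)) * F s ≤ ∫⁻ s, k (t - s) * F' s := by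
    intro t ht
    rw [← lintegral_const_mul' _ _ ENNReal.ofReal_ne_top, ← lintegral_indicator measurableSet_Ioo]
    refine lintegral_mono fun s => ?_
    by_cases hs : s ∈ Ioo 0 t
    · have h1 : t - s ∈ Ioi (0 : ℝ) := by simp only [mem_Ioi]; linarith [hs.2]
      rw [indicator_of_mem hs, hk, hF', indicator_of_mem h1,
        indicator_of_mem (show s ∈ Ioc 0 T from ⟨hs.1, hs.2.le.trans ht.2⟩), ← mul_assoc,
        ← mul_assoc, ← ENNReal.ofReal_mul (by positivity),
        ← ENNReal.ofReal_mul (mul_nonneg (Real.exp_pos _).le (Real.rpow_nonneg (le_of_lt h1) _)),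
        mul_right_comm (Real.exp _), ← Real.exp_add]
      refine le_of_eq ?_
      congr 4; ring
    · rw [indicator_of_notMem hs]; exact zero_le
  have hkint : ∫⁻ u, k u = ENNReal.ofReal (μ ^ (-ρ) * Real.Gamma ρ) := by
    have hi := integrableOn_exp_mul_rpow hμ hρ
    have hv := Real.integral_rpow_mul_exp_neg_mul_Ioi hρ hμ
    simp_rw [mul_comm (_ ^ (ρ - 1))] at hv
    rw [hk, lintegral_indicator measurableSet_Ioi, ← ofReal_integral_eq_lintegral_ofReal hi, hv,
      one_div, Real.inv_rpow hμ.le, ← Real.rpow_neg hμ.le]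
    filter_upwards [ae_restrict_mem measurableSet_Ioi] with u hu
    exact mul_nonneg (Real.exp_pos _).le (Real.rpow_nonneg (le_of_lt hu) _)
  calc _ ≤ ∫⁻ t in Ioc 0 T, ∫⁻ s, k (t - s) * F' s := setLIntegral_mono' measurableSet_Ioc hpt
    _ ≤ ∫⁻ t, ∫⁻ s, k (t - s) * F' s := setLIntegral_le_lintegral _ _
    _ = ∫⁻ s, ∫⁻ t, k (t - s) * F' s := by
        refine lintegral_lintegral_swap (Measurable.aemeasurable ?_)
        exact (hkm.comp (measurable_fst.sub measurable_snd)).mul (hFm.comp measurable_snd)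
    _ = ∫⁻ s, (∫⁻ u, k u) * F' s := by
        refine lintegral_congr fun s => ?_
        rw [lintegral_mul_const _ (by fun_prop : Measurable fun t => k (t - s)),
          lintegral_sub_right_eq_self k s]
    _ = _ := by
        rw [lintegral_const_mul _ hFm, hkint, hF', lintegral_indicator measurableSet_Ioc]

/-! ### Pairing functions of (x, t) with square-integrable frequency functions. -/

section Pairing

variable {V : Type*} [NormedAddCommGroup V] [InnerProductSpace ℝ V] [FiniteDimensional ℝ V]
  [MeasurableSpace V] [BorelSpace V] {ρ T : ℝ} {m : V → ℝ} {u W : V → ℝ → ℂ}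

/-- The pairing of a time-dependent function with the inverse Fourier transform of `b`. -/
noncomputable def pairing (W : V → ℝ → ℂ) (b : Lp ℂ 2 (volume : Measure V)) (t : ℝ) : ℂ :=
  ∫ x, inner ℂ ((𝓕⁻ b : Lp ℂ 2 (volume : Measure V)) x) (W x t)

/-- Plancherel. The integral over x makes measurability in t and Fubini accessible; the inner
product in frequency lets the multiplier act. -/
lemma pairing_eq_inner (b : Lp ℂ 2 (volume : Measure V)) {t : ℝ}
    (h : MemLp (fun x => W x t) 2 volume) : pairing W b t = inner ℂ b (𝓕 (h.toLp _)) := by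
  have h1 : inner ℂ b (𝓕 (h.toLp _)) =
      inner ℂ (𝓕⁻ b : Lp ℂ 2 (volume : Measure V)) (h.toLp _) := by
    rw [← Lp.inner_fourier_eq (𝓕⁻ b), FourierTransform.fourier_fourierInv_eq]
  rw [h1, L2.inner_def, pairing]
  refine integral_congr_ae ?_
  filter_upwards [h.coeFn_toLp] with x hx
  rw [hx]

lemma measurable_pairing (hW : Measurable fun p : V × ℝ => W p.1 p.2)
    (b : Lp ℂ 2 (volume : Measure V)) : Measurable (pairing W b) := by
  refine StronglyMeasurable.measurable ?_
  refine StronglyMeasurable.integral_prod_left' (f := fun p : V × ℝ =>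
    inner ℂ ((𝓕⁻ b : Lp ℂ 2 (volume : Measure V)) p.1) (W p.1 p.2)) ?_
  exact StronglyMeasurable.inner
    ((Lp.stronglyMeasurable _).comp_measurable measurable_fst) hW.stronglyMeasurable

lemma measurable_eLpNorm_two (hW : Measurable fun p : V × ℝ => W p.1 p.2) :
    Measurable fun t => eLpNorm (fun x => W x t) 2 (volume : Measure V) := by
  simp_rw [eLpNorm_eq_lintegral_rpow_enorm_toReal (two_ne_zero) (ENNReal.ofNat_ne_top)]
  refine Measurable.pow_const ?_ _
  exact Measurable.lintegral_prod_left' (f := fun p : V × ℝ => ‖W p.1 p.2‖ₑ ^ (2 : ℝ≥0∞).toReal)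
    (hW.enorm.pow_const _)

/-- Cauchy–Schwarz, in the form of Hölder's inequality with exponents 2, 2, 1. -/
lemma lintegral_enorm_inner_le {f g : V → ℂ} (hf : AEStronglyMeasurable f volume)
    (hg : AEStronglyMeasurable g volume) :
    ∫⁻ x, ‖inner ℂ (f x) (g x)‖ₑ ≤ eLpNorm f 2 volume * eLpNorm g 2 volume := by
  have h := eLpNorm_smul_le_mul_eLpNorm (p := 2) (q := 2) (r := 1) hg hf
  rw [eLpNorm_one_eq_lintegral_enorm] at h
  refine le_trans (lintegral_mono fun x => ?_) h
  simp only [RCLike.inner_apply, Pi.smul_apply', smul_eq_mul, enorm_mul]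
  rw [mul_comm]
  simp

lemma enorm_pairing_le (hW : Measurable fun p : V × ℝ => W p.1 p.2)
    (b : Lp ℂ 2 (volume : Measure V)) (t : ℝ) :
    ‖pairing W b t‖ₑ ≤ ‖b‖ₑ * eLpNorm (fun x => W x t) 2 (volume : Measure V) := by
  refine (enorm_integral_le_lintegral_enorm _).trans ?_
  refine (lintegral_enorm_inner_le (Lp.aestronglyMeasurable _)
    (hW.comp (measurable_id.prodMk measurable_const)).aestronglyMeasurable).trans ?_
  have hb : ‖(𝓕⁻ b : Lp ℂ 2 (volume : Measure V))‖ₑ = ‖b‖ₑ := by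
    rw [enorm_eq_iff_norm_eq, ← Lp.norm_fourier_eq, FourierTransform.fourier_fourierInv_eq]
  rw [← Lp.enorm_def, hb]
  rfl

/-- Fubini for the pairing with a fractional integral. -/
lemma enorm_integral_inner_fractionalIntegral_le (hW : Measurable fun p : V × ℝ => W p.1 p.2)
    (b : Lp ℂ 2 (volume : Measure V)) {t : ℝ}
    (ht : ∫⁻ s in Ioo 0 t, ENNReal.ofReal ((t - s) ^ (ρ - 1)) *
      eLpNorm (fun x => W x s) 2 (volume : Measure V) < ∞) :
    ‖∫ x, inner ℂ ((𝓕⁻ b : Lp ℂ 2 (volume : Measure V)) x)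
        (∫ s in Ioo 0 t, ((t - s) ^ (ρ - 1) : ℝ) • W x s)‖ₑ ≤
      ∫⁻ s in Ioo 0 t, ENNReal.ofReal ((t - s) ^ (ρ - 1)) * ‖pairing W b s‖ₑ := by
  set g : V → ℂ := ⇑(𝓕⁻ b : Lp ℂ 2 (volume : Measure V)) with hg
  have hgm : StronglyMeasurable g := Lp.stronglyMeasurable _
  set f : V → ℝ → ℂ := fun x s => ((t - s) ^ (ρ - 1) : ℝ) • inner ℂ (g x) (W x s) with hf
  have hfm : StronglyMeasurable (fun p : V × ℝ => f p.1 p.2) := by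
    have h1 : StronglyMeasurable fun p : V × ℝ => inner ℂ (g p.1) (W p.1 p.2) :=
      (hgm.comp_measurable measurable_fst).inner hW.stronglyMeasurable
    have h2 : StronglyMeasurable fun p : V × ℝ => (t - p.2) ^ (ρ - 1) :=
      ((measurable_const.sub measurable_snd).pow_const _).stronglyMeasurable
    exact h2.smul h1
  have hbound : ∀ s ∈ Ioo 0 t, ∫⁻ x, ‖f x s‖ₑ ≤
      eLpNorm g 2 volume * (ENNReal.ofReal ((t - s) ^ (ρ - 1)) *
        eLpNorm (fun x => W x s) 2 (volume : Measure V)) := by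
    intro s hs
    simp_rw [hf, enorm_smul, Real.enorm_of_nonneg (Real.rpow_nonneg (sub_nonneg.2 hs.2.le) (ρ - 1))]
    rw [lintegral_const_mul' _ _ ENNReal.ofReal_ne_top, mul_left_comm]
    gcongr
    exact lintegral_enorm_inner_le hgm.aestronglyMeasurable
      (hW.comp (measurable_id.prodMk measurable_const)).aestronglyMeasurable
  have hint : Integrable (fun p : V × ℝ => f p.1 p.2)
      ((volume : Measure V).prod (volume.restrict (Ioo 0 t))) := by
    refine ⟨hfm.aestronglyMeasurable, ?_⟩
    rw [HasFiniteIntegral, lintegral_prod_symm _ hfm.enorm.aemeasurable]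
    refine (setLIntegral_mono' measurableSet_Ioo hbound).trans_lt ?_
    rw [lintegral_const_mul' _ _ (Lp.memLp _).2.ne]
    exact ENNReal.mul_lt_top (Lp.memLp _).2 ht
  have hleft : ∫ x, inner ℂ (g x) (∫ s in Ioo 0 t, ((t - s) ^ (ρ - 1) : ℝ) • W x s) =
      ∫ x, ∫ s in Ioo 0 t, f x s := by
    refine integral_congr_ae (Eventually.of_forall fun x => ?_)
    simp only [hf, RCLike.inner_apply]
    rw [← integral_mul_const]
    simp only [smul_mul_assoc]
  rw [hleft, integral_integral_swap hint]
  refine (enorm_integral_le_lintegral_enorm _).trans (setLIntegral_mono' measurableSet_Ioo ?_)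
  intro s hs
  rw [hf, integral_smul, enorm_smul,
    Real.enorm_of_nonneg (Real.rpow_nonneg (sub_nonneg.2 hs.2.le) (ρ - 1)), pairing]

end Pairing

/-! ### Uniqueness for u = -I^ρ W, W = Â^σ u. -/

section Uniqueness

variable {V : Type*} [NormedAddCommGroup V] [InnerProductSpace ℝ V] [FiniteDimensional ℝ V]
  [MeasurableSpace V] [BorelSpace V] {ρ T : ℝ} {m : V → ℝ} {u W : V → ℝ → ℂ}

/-- `W = Â^σ u`, with the symbol `m`, and `-u` is the fractional integral of `W` in time, for a
square-integrable function `W` of finite `L¹(0, T; L²)` norm. -/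
structure IsHomogeneousPair (ρ T : ℝ) (m : V → ℝ) (u W : V → ℝ → ℂ) : Prop where
  measurable : Measurable fun p : V × ℝ => W p.1 p.2
  memLp_left : ∀ t ∈ Ioc 0 T, MemLp (fun x => u x t) 2 volume
  memLp_right : ∀ t ∈ Ioc 0 T, MemLp (fun x => W x t) 2 volume
  fourier_eq : ∀ t (ht : t ∈ Ioc 0 T),
    (𝓕 ((memLp_right t ht).toLp _) : Lp ℂ 2 (volume : Measure V)) =ᵐ[volume]
      fun η => (m η : ℂ) * (𝓕 ((memLp_left t ht).toLp _) : Lp ℂ 2 (volume : Measure V)) η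
  lintegral_lt_top : ∫⁻ t in Ioc 0 T, eLpNorm (fun x => W x t) 2 (volume : Measure V) < ∞
  eq_integral : ∀ x, ∀ t ∈ Ioc 0 T,
    u x t = -(((Real.Gamma ρ)⁻¹ : ℝ) • ∫ s in Ioo 0 t, ((t - s) ^ (ρ - 1) : ℝ) • W x s)

namespace IsHomogeneousPair

/-- The multiplier is real, hence can be moved from u onto b. -/
lemma pairing_eq (H : IsHomogeneousPair ρ T m u W) {b b' : Lp ℂ 2 (volume : Measure V)}
    (hb : b' =ᵐ[volume] fun η => (m η : ℂ) * b η) {t : ℝ} (ht : t ∈ Ioc 0 T) :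
    pairing W b t = pairing u b' t := by
  rw [pairing_eq_inner b (H.memLp_right t ht), pairing_eq_inner b' (H.memLp_left t ht), L2.inner_def,
    L2.inner_def]
  refine integral_congr_ae ?_
  filter_upwards [hb, H.fourier_eq t ht] with η h1 h2
  rw [h1, h2]
  simp only [RCLike.inner_apply, map_mul, Complex.conj_ofReal]
  ring

/-- One step of the iteration: the multiplier passes to b, then u is replaced by minus the
fractional integral of W. Each step costs one factor m and gains one fractional integration. -/
lemma enorm_pairing_le_of_lt_top (H : IsHomogeneousPair ρ T m u W) (hρ : 0 < ρ)
    {b b' : Lp ℂ 2 (volume : Measure V)}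
    (hb : b' =ᵐ[volume] fun η => (m η : ℂ) * b η) {t : ℝ} (ht : t ∈ Ioc 0 T)
    (hfin : ∫⁻ s in Ioo 0 t, ENNReal.ofReal ((t - s) ^ (ρ - 1)) *
      eLpNorm (fun x => W x s) 2 (volume : Measure V) < ∞) :
    ‖pairing W b t‖ₑ ≤ ENNReal.ofReal (Real.Gamma ρ)⁻¹ *
      ∫⁻ s in Ioo 0 t, ENNReal.ofReal ((t - s) ^ (ρ - 1)) * ‖pairing W b' s‖ₑ := by
  have h1 : pairing W b t = -(((Real.Gamma ρ)⁻¹ : ℝ) •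
      ∫ x, inner ℂ ((𝓕⁻ b' : Lp ℂ 2 (volume : Measure V)) x)
        (∫ s in Ioo 0 t, ((t - s) ^ (ρ - 1) : ℝ) • W x s)) := by
    rw [H.pairing_eq hb ht, pairing, ← integral_smul, ← integral_neg]
    refine integral_congr_ae (Eventually.of_forall fun x => ?_)
    simp only [H.eq_integral x t ht, RCLike.inner_apply]
    rw [neg_mul, smul_mul_assoc]
  rw [h1, enorm_neg, enorm_smul,
    Real.enorm_of_nonneg (inv_nonneg.2 (Real.Gamma_pos_of_pos hρ).le)]
  gcongr
  exact enorm_integral_inner_fractionalIntegral_le H.measurable b' hfin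

/-- The fractional integral of an integrable function is integrable, hence finite almost everywhere;
the weighted estimate with μ = 1 shows it. -/
lemma ae_lt_top (H : IsHomogeneousPair ρ T m u W) (hρ : 0 < ρ) :
    ∀ᵐ t ∂(volume.restrict (Ioc 0 T)), ∫⁻ s in Ioo 0 t, ENNReal.ofReal ((t - s) ^ (ρ - 1)) *
      eLpNorm (fun x => W x s) 2 (volume : Measure V) < ∞ := by
  have hω := measurable_eLpNorm_two H.measurable
  have h1 := lintegral_exp_mul_fractionalIntegral_le hρ one_pos T hω
  have h2 : ∫⁻ s in Ioc 0 T, ENNReal.ofReal (Real.exp (-(1 * s))) *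
      eLpNorm (fun x => W x s) 2 (volume : Measure V) < ∞ := by
    refine lt_of_le_of_lt (setLIntegral_mono' measurableSet_Ioc fun s hs => ?_) H.lintegral_lt_top
    refine mul_le_of_le_one_left' ?_
    rw [ENNReal.ofReal_le_one, Real.exp_le_one_iff]
    linarith [hs.1]
  have h3 := (h1.trans_lt (ENNReal.mul_lt_top ENNReal.ofReal_lt_top h2)).ne
  have hm : Measurable fun t => ∫⁻ s in Ioo 0 t, ENNReal.ofReal ((t - s) ^ (ρ - 1)) *
      eLpNorm (fun x => W x s) 2 (volume : Measure V) := by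
    have h4 : ∀ t, ∫⁻ s in Ioo 0 t, ENNReal.ofReal ((t - s) ^ (ρ - 1)) *
        eLpNorm (fun x => W x s) 2 (volume : Measure V) =
        ∫⁻ s, ({p : ℝ × ℝ | 0 < p.2 ∧ p.2 < p.1}.indicator fun p =>
          ENNReal.ofReal ((p.1 - p.2) ^ (ρ - 1)) *
            eLpNorm (fun x => W x p.2) 2 (volume : Measure V)) (t, s) := by
      intro t
      rw [← lintegral_indicator measurableSet_Ioo]
      rfl
    simp_rw [h4]
    refine Measurable.lintegral_prod_right' (Measurable.indicator ?_ ?_)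
    · exact (ENNReal.measurable_ofReal.comp
        ((measurable_fst.sub measurable_snd).pow_const _)).mul (hω.comp measurable_snd)
    · exact (measurableSet_lt measurable_const measurable_snd).inter
        (measurableSet_lt measurable_snd measurable_fst)
  have h5 := ae_lt_top' ((ENNReal.measurable_ofReal.comp (by fun_prop :
    Measurable fun t : ℝ => Real.exp (-(1 * t)))).mul hm).aemeasurable h3
  filter_upwards [h5] with t ht
  refine lt_top_iff_ne_top.2 fun h => ?_
  simp only [Pi.mul_apply, Function.comp_apply, h] at ht
  rw [ENNReal.mul_top (by simpa using Real.exp_pos _)] at ht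
  exact lt_irrefl _ ht

lemma lintegral_pairing_le (H : IsHomogeneousPair ρ T m u W) (hρ : 0 < ρ) {μ : ℝ} (hμ : 0 < μ)
    {b b' : Lp ℂ 2 (volume : Measure V)} (hb : b' =ᵐ[volume] fun η => (m η : ℂ) * b η) :
    ∫⁻ t in Ioc 0 T, ENNReal.ofReal (Real.exp (-(μ * t))) * ‖pairing W b t‖ₑ ≤
      ENNReal.ofReal (μ ^ (-ρ)) *
        ∫⁻ t in Ioc 0 T, ENNReal.ofReal (Real.exp (-(μ * t))) * ‖pairing W b' t‖ₑ := by
  have hΓ := Real.Gamma_pos_of_pos hρ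
  calc _ ≤ ∫⁻ t in Ioc 0 T, ENNReal.ofReal (Real.Gamma ρ)⁻¹ *
        (ENNReal.ofReal (Real.exp (-(μ * t))) *
          ∫⁻ s in Ioo 0 t, ENNReal.ofReal ((t - s) ^ (ρ - 1)) * ‖pairing W b' s‖ₑ) := by
        refine lintegral_mono_ae ?_
        filter_upwards [H.ae_lt_top hρ, ae_restrict_mem measurableSet_Ioc] with t h1 ht
        rw [mul_left_comm]
        gcongr
        exact H.enorm_pairing_le_of_lt_top hρ hb ht h1
    _ ≤ ENNReal.ofReal (Real.Gamma ρ)⁻¹ * (ENNReal.ofReal (μ ^ (-ρ) * Real.Gamma ρ) *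
        ∫⁻ t in Ioc 0 T, ENNReal.ofReal (Real.exp (-(μ * t))) * ‖pairing W b' t‖ₑ) := by
        rw [lintegral_const_mul' _ _ ENNReal.ofReal_ne_top]
        gcongr
        exact lintegral_exp_mul_fractionalIntegral_le hρ hμ T
          (measurable_pairing H.measurable b').enorm
    _ = _ := by
        rw [← mul_assoc, ← ENNReal.ofReal_mul (inv_nonneg.2 hΓ.le)]
        congr 2
        field_simp

/-- The part of `β` at frequencies with `m ≤ R`, multiplied by `m ^ n`. -/
lemma exists_truncation (hm : Measurable m) (hm0 : ∀ η, 0 ≤ m η) {R : ℝ} (hR : 0 ≤ R)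
    (β : Lp ℂ 2 (volume : Measure V)) (n : ℕ) :
    ∃ b : Lp ℂ 2 (volume : Measure V),
      (b =ᵐ[volume] fun η => (({η | m η ≤ R}.indicator (fun η => m η ^ n) η : ℝ) : ℂ) * β η) ∧
      ‖b‖ₑ ≤ ENNReal.ofReal (R ^ n) * ‖β‖ₑ := by
  set f : V → ℂ := fun η => (({η | m η ≤ R}.indicator (fun η => m η ^ n) η : ℝ) : ℂ) * β η with hf
  have hfm : AEStronglyMeasurable f volume := by
    refine AEStronglyMeasurable.mul ?_ (Lp.aestronglyMeasurable _)
    exact (Complex.measurable_ofReal.comp ((hm.pow_const n).indicator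
      (measurableSet_le hm measurable_const))).aestronglyMeasurable
  have hle : ∀ᵐ η ∂(volume : Measure V), ‖f η‖ ≤ R ^ n * ‖β η‖ := by
    refine Eventually.of_forall fun η => ?_
    rw [hf, norm_mul, Complex.norm_real]
    gcongr
    by_cases h : η ∈ {η | m η ≤ R}
    · rw [indicator_of_mem h, norm_pow, Real.norm_of_nonneg (hm0 η)]
      exact pow_le_pow_left₀ (hm0 η) h n
    · rw [indicator_of_notMem h, norm_zero]
      positivity
  have hfL : MemLp f 2 volume := (Lp.memLp β).of_le_mul hfm hle
  refine ⟨hfL.toLp f, hfL.coeFn_toLp, ?_⟩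
  rw [Lp.enorm_toLp, Lp.enorm_def]
  exact eLpNorm_le_mul_eLpNorm_of_ae_le_mul hle 2

/-- With b n the truncation of m^n β, n steps bound the weighted norm for b 0 by (2R)^{-n} times
that for b n, which is at most R^n ‖β‖ C. The product is a multiple of 2^{-n}. -/
lemma ae_pairing_eq_zero (H : IsHomogeneousPair ρ T m u W) (hρ : 0 < ρ) (hm : Measurable m)
    (hm0 : ∀ η, 0 ≤ m η) {R : ℝ} (hR : 0 < R) (β : Lp ℂ 2 (volume : Measure V)) :
    ∃ b : Lp ℂ 2 (volume : Measure V),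
      (b =ᵐ[volume] fun η => (({η | m η ≤ R}.indicator (fun _ => 1) η : ℝ) : ℂ) * β η) ∧
      ∀ᵐ t ∂(volume.restrict (Ioc 0 T)), pairing W b t = 0 := by
  choose b hb hbn using fun n => exists_truncation hm hm0 hR.le β n
  refine ⟨b 0, by simpa using hb 0, ?_⟩
  have hsucc : ∀ n, b (n + 1) =ᵐ[volume] fun η => (m η : ℂ) * b n η := by
    intro n
    filter_upwards [hb n, hb (n + 1)] with η h1 h2
    rw [h1, h2]
    by_cases h : η ∈ {η | m η ≤ R}
    · rw [indicator_of_mem h, indicator_of_mem h]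
      push_cast
      ring
    · rw [indicator_of_notMem h, indicator_of_notMem h]
      simp
  set μ : ℝ := (2 * R) ^ (1 / ρ) with hμdef
  have hμ : 0 < μ := by positivity
  have hμρ : μ ^ (-ρ) = (2 * R)⁻¹ := by
    rw [hμdef, ← Real.rpow_mul (by positivity), mul_neg, one_div_mul_cancel hρ.ne', Real.rpow_neg_one]
  set I : ℕ → ℝ≥0∞ := fun n =>
    ∫⁻ t in Ioc 0 T, ENNReal.ofReal (Real.exp (-(μ * t))) * ‖pairing W (b n) t‖ₑ with hI
  set C : ℝ≥0∞ := ∫⁻ t in Ioc 0 T, eLpNorm (fun x => W x t) 2 (volume : Measure V) with hC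
  have hI1 : ∀ n, I 0 ≤ ENNReal.ofReal ((2 * R)⁻¹) ^ n * I n := by
    intro n
    induction n with
    | zero => simp
    | succ n ih =>
      refine ih.trans ?_
      rw [pow_succ, mul_assoc, ← hμρ]
      gcongr
      exact H.lintegral_pairing_le hρ hμ (hsucc n)
  have hI2 : ∀ n, I n ≤ ENNReal.ofReal (R ^ n) * (‖β‖ₑ * C) := by
    intro n
    rw [← mul_assoc, hC, ← lintegral_const_mul' _ _
      (ENNReal.mul_ne_top ENNReal.ofReal_ne_top enorm_ne_top)]
    refine setLIntegral_mono' measurableSet_Ioc fun t ht => ?_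
    calc _ ≤ 1 * ‖pairing W (b n) t‖ₑ := by
          gcongr
          rw [ENNReal.ofReal_le_one, Real.exp_le_one_iff]
          nlinarith [ht.1]
      _ ≤ _ := by
          rw [one_mul]
          refine (enorm_pairing_le H.measurable (b n) t).trans ?_
          gcongr
          exact hbn n
  have hI3 : ∀ n : ℕ, I 0 ≤ ENNReal.ofReal (2⁻¹) ^ n * (‖β‖ₑ * C) := by
    intro n
    refine (hI1 n).trans ((mul_le_mul_right (hI2 n) _).trans (le_of_eq ?_))
    rw [ENNReal.ofReal_pow hR.le, ← mul_assoc, ← mul_pow, ← ENNReal.ofReal_mul (by positivity)]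
    congr 3
    field_simp
  have hI0 : I 0 = 0 := by
    have hlim : Tendsto (fun n : ℕ => ENNReal.ofReal (2⁻¹) ^ n * (‖β‖ₑ * C)) atTop (𝓝 0) := by
      have h1 : Tendsto (fun n : ℕ => ENNReal.ofReal (2⁻¹) ^ n) atTop (𝓝 0) :=
        ENNReal.tendsto_pow_atTop_nhds_zero_of_lt_one (by
          rw [← ENNReal.ofReal_one, ENNReal.ofReal_lt_ofReal_iff one_pos]; norm_num)
      simpa using ENNReal.Tendsto.mul_const h1
        (Or.inr (ENNReal.mul_ne_top enorm_ne_top H.lintegral_lt_top.ne))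
    exact le_antisymm (ge_of_tendsto' hlim hI3) zero_le
  rw [hI, lintegral_eq_zero_iff] at hI0
  · filter_upwards [hI0] with t ht
    simpa [(Real.exp_pos (-(μ * t))).not_ge] using ht
  · exact (ENNReal.measurable_ofReal.comp (by fun_prop)).mul
      (measurable_pairing H.measurable _).enorm

/-- Countably many levels k + 1 and a dense sequence of β give one null set of times. Outside it
every truncation of the transform of W is orthogonal to a dense set, hence zero. -/
theorem ae_eq_zero (H : IsHomogeneousPair ρ T m u W) (hρ : 0 < ρ) (hm : Measurable m)
    (hm0 : ∀ η, 0 ≤ m η) :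
    ∀ᵐ t ∂(volume.restrict (Ioc 0 T)), (fun x => W x t) =ᵐ[volume] 0 := by
  have : Fact ((2 : ℝ≥0∞) ≠ ⊤) := ⟨ENNReal.ofNat_ne_top⟩
  set β : ℕ → Lp ℂ 2 (volume : Measure V) := TopologicalSpace.denseSeq _ with hβ
  choose b hb hb0 using fun p : ℕ × ℕ =>
    H.ae_pairing_eq_zero hρ hm hm0 (Nat.cast_add_one_pos (α := ℝ) p.1) (β p.2)
  filter_upwards [ae_all_iff.2 hb0, ae_restrict_mem measurableSet_Ioc] with t h0 ht
  have hW := H.memLp_right t ht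
  set F : Lp ℂ 2 (volume : Measure V) := 𝓕 (hW.toLp _) with hF
  have htrunc : ∀ k : ℕ, ∀ᵐ η ∂(volume : Measure V), m η ≤ k + 1 → F η = 0 := by
    intro k
    obtain ⟨Fk, hFk, -⟩ := exists_truncation hm hm0 (Nat.cast_add_one_pos (α := ℝ) k).le F 0
    have hk : Fk = 0 := by
      refine (TopologicalSpace.denseRange_denseSeq
        (Lp ℂ 2 (volume : Measure V))).eq_zero_of_inner_right ℂ ?_
      intro j
      have h1 := h0 (k, j)
      rw [pairing_eq_inner _ hW, L2.inner_def] at h1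
      -- The cut-off is real, so it may sit on either side of the inner product: truncating F or
      -- truncating β gives the same pairing.
      rw [L2.inner_def, ← h1]
      refine integral_congr_ae ?_
      filter_upwards [hFk, hb (k, j)] with η h2 h3
      rw [h2, h3]
      simp only [RCLike.inner_apply, map_mul, Complex.conj_ofReal, pow_zero]
      ring
    have hk' : Fk =ᵐ[volume] 0 := by
      rw [hk]; exact Lp.coeFn_zero _ _ _
    filter_upwards [hFk, hk'] with η h1 h2 h3
    rw [h2, indicator_of_mem (show η ∈ {η | m η ≤ (k : ℝ) + 1} from h3)] at h1
    simpa using h1.symm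
  have hF0 : F = 0 := by
    refine (Lp.eq_zero_iff_ae_eq_zero).2 ?_
    filter_upwards [ae_all_iff.2 htrunc] with η h
    obtain ⟨k, hk⟩ := exists_nat_ge (m η)
    exact h k (by linarith)
  have hW0 : hW.toLp _ = 0 := by
    rw [← norm_eq_zero, ← Lp.norm_fourier_eq, ← hF, hF0, norm_zero]
  exact hW.coeFn_toLp.symm.trans (by rw [hW0]; exact Lp.coeFn_zero _ _ _)

end IsHomogeneousPair

end Uniqueness

/-! ### Uniqueness of solutions of (1). -/

section

variable {N : ℕ} {A : MvPolynomial (Fin N) ℝ} {ρ σ T : ℝ}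
  {f g f' g' : EuclideanSpace ℝ (Fin N) → ℂ}

lemma IsFractionalPower.fourier_eq (h : IsFractionalPower A σ f g) (hf : MemLp f 2 volume)
    (hg : MemLp g 2 volume) :
    (𝓕 (hg.toLp g) : Lp ℂ 2 (volume : Measure (EuclideanSpace ℝ (Fin N)))) =ᵐ[volume] fun η =>
      (powerSymbol A σ η : ℂ) *
        (𝓕 (hf.toLp f) : Lp ℂ 2 (volume : Measure (EuclideanSpace ℝ (Fin N)))) η := by
  have h1 := (Measure.quasiMeasurePreserving_smul
    (volume : Measure (EuclideanSpace ℝ (Fin N)))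
    (mul_ne_zero two_ne_zero Real.pi_ne_zero)).ae_eq_comp h.2.2
  filter_upwards [h1] with η hη
  rw [fourier_eq_hat hf, fourier_eq_hat hg]
  simp only [Function.comp_apply] at hη
  rw [hη, mul_smul_comm, powerSymbol]

lemma hat_sub (hf : MemLp f 2 volume) (hf' : MemLp f' 2 volume) :
    hat (f - f') =ᵐ[volume] hat f - hat f' := by
  have h1 := (Measure.quasiMeasurePreserving_smul
    (volume : Measure (EuclideanSpace ℝ (Fin N))) two_pi_inv_ne_zero).ae_eq_comp
    (Lp.coeFn_sub (𝓕 (hf.toLp f) : Lp ℂ 2 volume) (𝓕 (hf'.toLp f') : Lp ℂ 2 volume))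
  filter_upwards [h1] with ξ hξ
  simp only [Function.comp_apply, Pi.sub_apply] at hξ
  rw [hat_of_memLp (hf.sub hf'), Pi.sub_apply, hat_of_memLp hf, hat_of_memLp hf', 
    MemLp.toLp_sub hf hf', sub_eq_add_neg, FourierTransform.fourier_add,
    FourierTransform.fourier_neg, ← sub_eq_add_neg, hξ, smul_sub]

lemma IsFractionalPower.sub (h : IsFractionalPower A σ f g) (h' : IsFractionalPower A σ f' g') :
    IsFractionalPower A σ (f - f') (g - g') := by
  refine ⟨h.1.sub h'.1, h.2.1.sub h'.2.1, ?_⟩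
  filter_upwards [hat_sub h.1 h'.1, hat_sub h.2.1 h'.2.1, h.2.2, h'.2.2] with ξ h1 h2 h3 h4
  rw [h1, h2, Pi.sub_apply, Pi.sub_apply, h3, h4, mul_sub]

/-- A function with Caputo derivative `-w` differs from its initial value by a fractional
integral. -/
lemma HasCaputo.eq_integral (hρ : ρ ∈ Ioo (0 : ℝ) 1) {h w : ℝ → ℂ} (H : HasCaputo ρ T h)
    (hw : ∀ t ∈ Ioc 0 T, caputo ρ h t + w t = 0) {t : ℝ} (ht : t ∈ Ioc 0 T) :
    IntegrableOn (fun s => ((t - s) ^ (ρ - 1) : ℝ) • w s) (Ioo 0 t) ∧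
    h t - h 0 = -(((Real.Gamma ρ)⁻¹ : ℝ) • ∫ s in Ioo 0 t, ((t - s) ^ (ρ - 1) : ℝ) • w s) := by
  obtain ⟨h1, h2⟩ := integral_caputo hρ H ht
  have h3 : EqOn (fun s => ((t - s) ^ (ρ - 1) : ℝ) • caputo ρ h s)
      (fun s => -(((t - s) ^ (ρ - 1) : ℝ) • w s)) (Ioo 0 t) := by
    intro s hs
    simp only
    rw [eq_neg_of_add_eq_zero_left (hw s ⟨hs.1, hs.2.le.trans ht.2⟩), smul_neg]
  constructor
  · simpa using (h1.congr_fun h3 measurableSet_Ioo).neg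
  · rw [← h2, setIntegral_congr_fun measurableSet_Ioo h3, integral_neg, smul_neg]

theorem IsSolution.eq {φ : EuclideanSpace ℝ (Fin N) → ℂ}
    {v v' : EuclideanSpace ℝ (Fin N) → ℝ → ℂ}
    (hρ : ρ ∈ Ioo (0 : ℝ) 1) (hσ : 0 ≤ σ) (hA0 : ∀ ξ, 0 ≤ symbol A ξ)
    (hv : IsSolution A ρ σ T φ v) (hv' : IsSolution A ρ σ T φ v')
    (x : EuclideanSpace ℝ (Fin N)) {t : ℝ} (ht : t ∈ Icc 0 T) : v x t = v' x t := by
  obtain ⟨w, hwc, hwA, hwi, hw⟩ := hv.equation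
  obtain ⟨w', hwc', hwA', hwi', hw'⟩ := hv'.equation
  classical
  -- Continuity of w and w' is known only for t in (0, T]; extension by zero makes the difference
  -- jointly measurable.
  set W : EuclideanSpace ℝ (Fin N) → ℝ → ℂ := fun x t =>
    if t ∈ Ioc 0 T then w x t - w' x t else 0 with hW
  have hWt : ∀ t ∈ Ioc 0 T, (fun x => W x t) = (fun x => w x t) - fun x => w' x t := by
    intro t ht
    ext x
    simp only [hW, if_pos ht, Pi.sub_apply]
  have hA : ∀ t ∈ Ioc 0 T, IsFractionalPower A σ (fun x => v x t - v' x t) (fun x => W x t) := by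
    intro t ht
    rw [hWt t ht]
    exact (hwA t ht).sub (hwA' t ht)
  have hWm : Measurable fun p : EuclideanSpace ℝ (Fin N) × ℝ => W p.1 p.2 := by
    have h1 := ContinuousOn.measurable_piecewise (s := univ ×ˢ Ioc 0 T) (hwc.sub hwc')
      (continuousOn_const (c := (0 : ℂ))) (MeasurableSet.univ.prod measurableSet_Ioc)
    convert h1 using 1
    ext p
    simp [hW, Set.piecewise]
  have hWint : ∫⁻ t in Ioc 0 T, eLpNorm (fun x => W x t) 2 volume < ∞ := by
    have hm : ∀ {w : EuclideanSpace ℝ (Fin N) → ℝ → ℂ}, ContinuousOn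
        (fun p : EuclideanSpace ℝ (Fin N) × ℝ => w p.1 p.2) (univ ×ˢ Ioc 0 T) →
        AEMeasurable (fun t => eLpNorm (fun x => w x t) 2 volume) (volume.restrict (Ioc 0 T)) := by
      intro w hc
      have h1 := measurable_eLpNorm_two (V := EuclideanSpace ℝ (Fin N))
        (W := fun x t => (univ ×ˢ Ioc 0 T).piecewise
          (fun p : EuclideanSpace ℝ (Fin N) × ℝ => w p.1 p.2) (fun _ => 0) (x, t))
        (ContinuousOn.measurable_piecewise hc continuousOn_const
          (MeasurableSet.univ.prod measurableSet_Ioc))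
      refine h1.aemeasurable.congr ?_
      filter_upwards [ae_restrict_mem measurableSet_Ioc] with t ht
      congr 1
      ext x
      simp [Set.piecewise, ht.1, ht.2]
    refine lt_of_le_of_lt (setLIntegral_mono' measurableSet_Ioc fun t ht => ?_)
      ((lintegral_add_left' (hm hwc) _).trans_lt (ENNReal.add_lt_top.2 ⟨hwi, hwi'⟩))
    rw [hWt t ht]
    exact eLpNorm_sub_le (hwA t ht).2.1.1 (hwA' t ht).2.1.1 (by norm_num)
  have hpair : IsHomogeneousPair ρ T (powerSymbol A σ) (fun x t => v x t - v' x t) W := by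
    refine ⟨hWm, fun t ht => (hA t ht).1, fun t ht => (hA t ht).2.1,
      fun t ht => (hA t ht).fourier_eq _ _, hWint, fun x t ht => ?_⟩
    obtain ⟨h1, h2⟩ := (hv.hasCaputo x).eq_integral hρ (hw x) ht
    obtain ⟨h3, h4⟩ := (hv'.hasCaputo x).eq_integral hρ (hw' x) ht
    have h5 : EqOn (fun s => ((t - s) ^ (ρ - 1) : ℝ) • W x s)
        (fun s => ((t - s) ^ (ρ - 1) : ℝ) • w x s - ((t - s) ^ (ρ - 1) : ℝ) • w' x s)
        (Ioo 0 t) := by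
      intro s hs
      simp only [hW, if_pos (show s ∈ Ioc 0 T from ⟨hs.1, hs.2.le.trans ht.2⟩), smul_sub]
    rw [setIntegral_congr_fun measurableSet_Ioo h5, integral_sub h1 h3, smul_sub]
    rw [hv.initial] at h2
    rw [hv'.initial] at h4
    linear_combination h2 - h4
  have hae : ∀ᵐ t ∂(volume.restrict (Ioc 0 T)), ∀ x, w x t = w' x t := by
    filter_upwards [hpair.ae_eq_zero hρ.1 (continuous_powerSymbol hσ).measurable
      (powerSymbol_nonneg hA0 σ), ae_restrict_mem measurableSet_Ioc] with t h1 ht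
    rw [hWt t ht] at h1
    have hc : ∀ {w : EuclideanSpace ℝ (Fin N) → ℝ → ℂ}, ContinuousOn
        (fun p : EuclideanSpace ℝ (Fin N) × ℝ => w p.1 p.2) (univ ×ˢ Ioc 0 T) →
        Continuous fun x => w x t := fun hc =>
      hc.comp_continuous (f := fun x => (x, t)) (by fun_prop) fun x => ⟨mem_univ _, ht⟩
    have h2 := (((hc hwc).sub (hc hwc')).ae_eq_iff_eq volume continuous_zero).1 h1
    exact fun x => sub_eq_zero.1 (congrFun h2 x)
  -- Continuity, first in x and then in t, removes both exceptional null sets.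
  have hww : EqOn (w x) (w' x) (Ioc 0 T) := by
    have hc : ∀ {w : EuclideanSpace ℝ (Fin N) → ℝ → ℂ}, ContinuousOn
        (fun p : EuclideanSpace ℝ (Fin N) × ℝ => w p.1 p.2) (univ ×ˢ Ioc 0 T) →
        ContinuousOn (w x) (Ioc 0 T) := fun hc =>
      hc.comp (f := fun t => (x, t)) (by fun_prop) fun t ht => ⟨mem_univ _, ht⟩
    refine Measure.eqOn_Ioc_of_ae_eq volume ?_ (hc hwc) (hc hwc')
    filter_upwards [hae] with t h using h x
  rcases ht.1.eq_or_lt with h0 | h0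
  · rw [← h0, hv.initial, hv'.initial]
  · have ht' : t ∈ Ioc 0 T := ⟨h0, ht.2⟩
    obtain ⟨-, h2⟩ := (hv.hasCaputo x).eq_integral hρ (hw x) ht'
    -- Both solutions now have the same Caputo derivative -w and the same initial value, and Abel
    -- inversion expresses each through these two.
    obtain ⟨-, h4⟩ := (hv'.hasCaputo x).eq_integral hρ (w := w x)
      (fun t ht => by rw [hww ht]; exact hw' x t ht) ht'
    rw [hv.initial, ← h4, hv'.initial] at h2
    exact sub_left_injective h2

end

/-! ### Observations as scalar equations, and the thresholds. -/

section

variable {N : ℕ} {A : MvPolynomial (Fin N) ℝ} {ρ σ T : ℝ}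

/-- The existential over solutions collapses by uniqueness to the explicit evolution, and the one
over values by uniqueness of Lebesgue values. -/
lemma observed_iff {τ : ℝ} (hτ : (N : ℝ) / 2 < τ) {φ : EuclideanSpace ℝ (Fin N) → ℂ}
    (hφc : Continuous φ) (hφ : MemSobolevClass τ φ) (hρ : ρ ∈ Ioo (0 : ℝ) 1) (hσ : 0 ≤ σ)
    (hA0 : ∀ ξ, 0 ≤ symbol A ξ) {ξ : EuclideanSpace ℝ (Fin N)} {c : ℂ}
    (hc : HasLebesgueValue (hat φ) ξ c) {t : ℝ} (ht : t ∈ Ioc 0 T) (d : ℝ) :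
    Observed A ρ σ T φ ξ t d ↔ mode ρ (symbol A ξ ^ σ) t * ‖c‖ = d := by
  obtain ⟨a, ha, ha2, hφa, hhat⟩ := exists_eq_fourierInv hτ hφc hφ
  have hsol : IsSolution A ρ σ T φ (evolution ρ (powerSymbol A σ) a) := by
    rw [hφa]
    exact isSolution_evolution hρ hσ hA0 ha ha2 (ht.1.trans_le ht.2)
  have hm0 : ∀ η, 0 ≤ symbol A η ^ σ := fun η => Real.rpow_nonneg (hA0 η) σ
  have hcont : Continuous fun η => (mode ρ (symbol A η ^ σ) t : ℂ) :=
    Complex.continuous_ofReal.comp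
      (continuous_mode hρ ((continuous_symbol A).rpow_const fun _ => Or.inr hσ) hm0 ht.1.le)
  have hval : HasLebesgueValue (hat fun x => evolution ρ (powerSymbol A σ) a x t) ξ
      ((mode ρ (symbol A ξ ^ σ) t : ℂ) * c) := by
    have hle : ∀ η, ‖(mode ρ (symbol A η ^ σ) t : ℂ)‖ ≤ 1 := by
      intro η
      rw [Complex.norm_real, Real.norm_of_nonneg (mode_pos hρ (hm0 η) ht.1.le).le]
      exact mode_le_one hρ (hm0 η) ht.1.le
    have hmul := HasLebesgueValue.mul (g := fun η => (mode ρ (symbol A η ^ σ) t : ℂ))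
      (aestronglyMeasurable_hat hφ.1) hc hcont.continuousAt hle
    refine hmul.congr ?_
    filter_upwards [hat_evolution hρ hσ hA0 ha ha2 ht.1.le] with η hη
    rw [hη, hhat]
  have hnorm : ‖(mode ρ (symbol A ξ ^ σ) t : ℂ) * c‖ = mode ρ (symbol A ξ ^ σ) t * ‖c‖ := by
    rw [norm_mul, Complex.norm_real, Real.norm_of_nonneg (mode_pos hρ (hm0 ξ) ht.1.le).le]
  constructor
  · rintro ⟨v, hv, c', hc', rfl⟩
    have hvt : (fun x => v x t) = fun x => evolution ρ (powerSymbol A σ) a x t :=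
      funext fun x => hv.eq hρ hσ hA0 hsol x ⟨ht.1.le, ht.2⟩
    rw [hvt] at hc'
    have hmem : MemLp (fun x => evolution ρ (powerSymbol A σ) a x t) 2 volume := by
      obtain ⟨w, -, hw, -⟩ := hsol.equation
      exact (hw t ht).1
    rw [hc'.unique (aestronglyMeasurable_hat hmem) hval, hnorm]
  · intro h
    exact ⟨_, hsol, _, hval, hnorm.trans h⟩

/-- The maximum in the threshold is positive, so k ≥ 0. This is what monotonicity in the order
needs. -/
lemma one_le_of_isTimeThreshold {ρ₀ T₀ : ℝ} (hρ₀ : 0 < ρ₀) (h : IsTimeThreshold 1 ρ₀ T₀) :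
    1 ≤ T₀ := by
  rcases h with ⟨k, rfl, hk⟩ | ⟨-, rfl⟩
  · refine Real.one_le_exp (le_trans ?_ hk)
    exact mul_nonneg (by positivity) (le_max_of_le_left (by norm_num))
  · norm_num

/-- Γ > 1 on (0, 1), so log(5Γ(1 - ρ)) > 0. A base above 1 makes lam^σ increase with σ. -/
lemma one_lt_of_isSymbolThreshold {σ₀ Λ₁ : ℝ} (hρ : ρ ∈ Ioo (0 : ℝ) 1) (hσ₀ : 0 < σ₀)
    (h : IsSymbolThreshold ρ σ₀ Λ₁) : 1 < Λ₁ := by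
  obtain ⟨n, rfl, hn⟩ := h
  have hΓ : 1 < Real.Gamma (1 - ρ) := by
    have h1 : 1 - ρ ∈ Ioc (0 : ℝ) 1 := ⟨by linarith [hρ.2], by linarith [hρ.1]⟩
    have h2 := Real.Gamma_strictAntiOn_Ioc h1 ⟨one_pos, le_rfl⟩ (by linarith [hρ.1])
    rwa [Real.Gamma_one] at h2
  exact Real.one_lt_exp_iff.2 ((div_pos (Real.log_pos (by linarith)) hσ₀).trans_le hn)

lemma mode_one (ρ t : ℝ) : mode ρ 1 t = relaxation ρ t := by
  rw [mode, Real.one_rpow, one_mul]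

lemma strictAnti_mode_rpow (hρ : ρ ∈ Ioo (0 : ℝ) 1) {lam t : ℝ} (hlam : 1 < lam) (ht : 0 < t) :
    StrictAnti fun σ : ℝ => mode ρ (lam ^ σ) t := by
  intro σ σ' h
  have h0 : 0 < lam := by linarith
  refine strictAntiOn_relaxation hρ ?_ ?_ ?_
  · exact mem_Ici.2 (by positivity)
  · exact mem_Ici.2 (by positivity)
  · have h1 := Real.rpow_lt_rpow_of_exponent_lt hlam h
    have h2 := Real.rpow_lt_rpow (by positivity) h1 (one_div_pos.2 hρ.1)
    exact mul_lt_mul_of_pos_right h2 ht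

lemma continuous_mode_rpow (hρ : ρ ∈ Ioo (0 : ℝ) 1) {lam t : ℝ} (hlam : 0 < lam) (ht : 0 ≤ t) :
    Continuous fun σ : ℝ => mode ρ (lam ^ σ) t := by
  have h1 : Continuous fun σ : ℝ => (lam ^ σ) ^ (1 / ρ) * t :=
    ((Real.continuous_const_rpow hlam.ne').rpow_const
      fun σ => Or.inl (Real.rpow_pos_of_pos hlam σ).ne').mul continuous_const
  exact (continuousOn_relaxation hρ).comp_continuous h1 fun σ => mem_Ici.2 (by positivity)

lemma exists_Ico_eq_iff {g : ℝ → ℝ} (hg : StrictAnti g) (hc : Continuous g) {a b : ℝ} (hab : a < b)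
    (r : ℝ) : (∃ x ∈ Ico a b, g x = r) ↔ g b < r ∧ r ≤ g a := by
  constructor
  · rintro ⟨x, hx, rfl⟩
    exact ⟨hg hx.2, hg.antitone hx.1⟩
  · intro h
    obtain ⟨x, hx, h⟩ := intermediate_value_Ico' hab.le hc.continuousOn h
    exact ⟨x, hx, h⟩

lemma exists_Ioo_eq_iff {g : ℝ → ℝ} (hg : StrictAnti g) (hc : Continuous g) {a b : ℝ} (hab : a < b)
    (r : ℝ) : (∃ x ∈ Ioo a b, g x = r) ↔ g b < r ∧ r < g a := by
  constructor
  · rintro ⟨x, hx, rfl⟩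
    exact ⟨hg hx.2, hg hx.1⟩
  · intro h
    obtain ⟨x, hx, h⟩ := intermediate_value_Ioo' hab.le hc.continuousOn h
    exact ⟨x, hx, h⟩

end

end Subdiffusion

/-! ### The two inverse problems. -/

theorem theorem1p4 {N l : ℕ} (hl : 0 < l)
    (A : MvPolynomial (Fin N) ℝ) (hA : A.IsHomogeneous (2 * l))
    (hApos : ∀ ξ : EuclideanSpace ℝ (Fin N), ξ ≠ 0 → 0 < Subdiffusion.symbol A ξ)
    (τ : ℝ) (hτ : (N : ℝ) / 2 < τ)
    (φ : EuclideanSpace ℝ (Fin N) → ℂ) (hφc : Continuous φ)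
    (hφ : Subdiffusion.MemSobolevClass τ φ)
    (ρ₀ σ₀ : ℝ) (hρ₀ : ρ₀ ∈ Ioo (0 : ℝ) 1) (hσ₀ : σ₀ ∈ Ioo (0 : ℝ) 1)
    (T₀ t₀ T : ℝ) (hT₀ : Subdiffusion.IsTimeThreshold 1 ρ₀ T₀) (ht₀ : T₀ ≤ t₀) (hT : t₀ ≤ T)
    (ξ₀ : EuclideanSpace ℝ (Fin N)) (hξ₀ : Subdiffusion.symbol A ξ₀ = 1)
    (φ₀ : ℂ) (hφ₀ : Subdiffusion.HasLebesgueValue (Subdiffusion.hat φ) ξ₀ φ₀) (hφ₀_ne : φ₀ ≠ 0)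
    (d₀ : ℝ) :
    -- the forward problem has exactly one solution, so that the observations are well defined
    (∀ ρ ∈ Ico ρ₀ 1, ∀ σ ∈ Ioo (0 : ℝ) 1,
      (∃ v, Subdiffusion.IsSolution A ρ σ T φ v) ∧
      ∀ v v', Subdiffusion.IsSolution A ρ σ T φ v → Subdiffusion.IsSolution A ρ σ T φ v' →
        ∀ x, ∀ t ∈ Icc 0 T, v x t = v' x t) ∧
    -- the first observation does not depend on `σ`
    (∀ ρ ∈ Ico ρ₀ 1, ∀ σ ∈ Ioo (0 : ℝ) 1, ∀ σ' ∈ Ioo (0 : ℝ) 1,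
      Subdiffusion.Observed A ρ σ T φ ξ₀ t₀ d₀ → Subdiffusion.Observed A ρ σ' T φ ξ₀ t₀ d₀) ∧
    -- the order in time
    (∀ σ ∈ Ioo (0 : ℝ) 1,
      ((∃! ρ : ℝ, ρ ∈ Ico ρ₀ 1 ∧ Subdiffusion.Observed A ρ σ T φ ξ₀ t₀ d₀) ↔
        Real.exp (-t₀) < d₀ / ‖φ₀‖ ∧
          d₀ / ‖φ₀‖ ≤ Subdiffusion.mittagLeffler ρ₀ (-t₀ ^ ρ₀)) ∧
      ((∃ ρ : ℝ, ρ ∈ Ico ρ₀ 1 ∧ Subdiffusion.Observed A ρ σ T φ ξ₀ t₀ d₀) ↔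
        Real.exp (-t₀) < d₀ / ‖φ₀‖ ∧
          d₀ / ‖φ₀‖ ≤ Subdiffusion.mittagLeffler ρ₀ (-t₀ ^ ρ₀))) ∧
    -- the power of the elliptic operator
    (∀ ρs ∈ Ico ρ₀ 1,
      (∃ σ ∈ Ioo (0 : ℝ) 1, Subdiffusion.Observed A ρs σ T φ ξ₀ t₀ d₀) →
      ∀ (ξ₁ : EuclideanSpace ℝ (Fin N)) (lam₁ Λ₁ t₁ d₁ : ℝ) (φ₁ : ℂ),
        Subdiffusion.symbol A ξ₁ = lam₁ → Subdiffusion.IsSymbolThreshold ρs σ₀ Λ₁ → Λ₁ ≤ lam₁ →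
        t₁ ∈ Ioc 0 T →
        Subdiffusion.HasLebesgueValue (Subdiffusion.hat φ) ξ₁ φ₁ → φ₁ ≠ 0 →
        ((∃ σ : ℝ, σ ∈ Ico σ₀ 1 ∧ Subdiffusion.Observed A ρs σ T φ ξ₁ t₁ d₁) ↔
          Subdiffusion.mittagLeffler ρs (-(lam₁ * t₁ ^ ρs)) < d₁ / ‖φ₁‖ ∧
            d₁ / ‖φ₁‖ ≤ Subdiffusion.mittagLeffler ρs (-(lam₁ ^ σ₀ * t₁ ^ ρs))) ∧
        ((∃ σ : ℝ, σ ∈ Ioo σ₀ 1 ∧ Subdiffusion.Observed A ρs σ T φ ξ₁ t₁ d₁) ↔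
          Subdiffusion.mittagLeffler ρs (-(lam₁ * t₁ ^ ρs)) < d₁ / ‖φ₁‖ ∧
            d₁ / ‖φ₁‖ < Subdiffusion.mittagLeffler ρs (-(lam₁ ^ σ₀ * t₁ ^ ρs))) ∧
        (∀ σ ∈ Ico σ₀ 1, ∀ σ' ∈ Ico σ₀ 1,
          Subdiffusion.Observed A ρs σ T φ ξ₁ t₁ d₁ →
          Subdiffusion.Observed A ρs σ' T φ ξ₁ t₁ d₁ → σ = σ')) := by
  open Subdiffusion in
  have hA0 := symbol_nonneg hl hA hApos
  have h1T₀ : 1 ≤ T₀ := one_le_of_isTimeThreshold hρ₀.1 hT₀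
  have h1t₀ : 1 ≤ t₀ := h1T₀.trans ht₀
  have htT : t₀ ∈ Ioc 0 T := ⟨by linarith, hT⟩
  have hρI : ∀ ρ ∈ Ico ρ₀ 1, ρ ∈ Ioo (0 : ℝ) 1 := fun ρ h => ⟨hρ₀.1.trans_le h.1, h.2⟩
  have hn₀ : 0 < ‖φ₀‖ := norm_pos_iff.2 hφ₀_ne
  -- Since A(ξ₀) = 1, the power 1^σ = 1 removes σ from the first observation.
  have hobs : ∀ ρ ∈ Ico ρ₀ 1, ∀ σ ∈ Ioo (0 : ℝ) 1,
      (Observed A ρ σ T φ ξ₀ t₀ d₀ ↔ relaxation ρ t₀ = d₀ / ‖φ₀‖) := by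
    intro ρ hρ σ hσ
    rw [observed_iff hτ hφc hφ (hρI ρ hρ) hσ.1.le hA0 hφ₀ htT, hξ₀, Real.one_rpow, mode_one,
      eq_div_iff hn₀.ne']
  refine ⟨fun ρ hρ σ hσ => ⟨?_, fun v v' hv hv' x t ht =>
    hv.eq (hρI ρ hρ) hσ.1.le hA0 hv' x ht⟩, fun ρ hρ σ hσ σ' hσ' h =>
    (hobs ρ hρ σ' hσ').2 ((hobs ρ hρ σ hσ).1 h), fun σ hσ => ?_, ?_⟩
  · obtain ⟨a, ha, ha2, hφa, -⟩ := exists_eq_fourierInv hτ hφc hφ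
    rw [hφa]
    exact ⟨_, isSolution_evolution (hρI ρ hρ) hσ.1.le hA0 ha ha2 (htT.1.trans_le htT.2)⟩
  · have hex : (∃ ρ : ℝ, ρ ∈ Ico ρ₀ 1 ∧ Observed A ρ σ T φ ξ₀ t₀ d₀) ↔
        Real.exp (-t₀) < d₀ / ‖φ₀‖ ∧ d₀ / ‖φ₀‖ ≤ mittagLeffler ρ₀ (-t₀ ^ ρ₀) := by
      rw [mittagLeffler_neg_rpow hρ₀ htT.1.le, ← exists_order_iff h1t₀ hρ₀]
      exact exists_congr fun ρ => and_congr_right fun hρ => hobs ρ hρ σ hσ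
    refine ⟨⟨fun h => hex.1 h.exists, fun h => existsUnique_of_exists_of_unique (hex.2 h) ?_⟩, hex⟩
    rintro ρ ρ' ⟨hρ, h1⟩ ⟨hρ', h2⟩
    exact (strictAntiOn_relaxation_order h1t₀).injOn (hρI ρ hρ) (hρI ρ' hρ')
      (((hobs ρ hρ σ hσ).1 h1).trans ((hobs ρ' hρ' σ hσ).1 h2).symm)
  · intro ρ hρ' _ ξ₁ lam₁ Λ₁ t₁ d₁ φ₁ hξ₁ hΛ₁ hlam₁ ht₁ hφ₁ hφ₁_ne
    have hρ := hρI ρ hρ'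
    have hlam : 1 < lam₁ := (one_lt_of_isSymbolThreshold hρ hσ₀.1 hΛ₁).trans_le hlam₁
    have hlam0 : 0 < lam₁ := by linarith
    have hn₁ : 0 < ‖φ₁‖ := norm_pos_iff.2 hφ₁_ne
    have hobs₁ : ∀ σ ∈ Ico σ₀ 1,
        (Observed A ρ σ T φ ξ₁ t₁ d₁ ↔ mode ρ (lam₁ ^ σ) t₁ = d₁ / ‖φ₁‖) := by
      intro σ hσ
      rw [observed_iff hτ hφc hφ hρ (hσ₀.1.le.trans hσ.1) hA0 hφ₁ ht₁, hξ₁, eq_div_iff hn₁.ne']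
    have hanti := strictAnti_mode_rpow hρ hlam ht₁.1
    have hcont := continuous_mode_rpow hρ hlam0 ht₁.1.le
    -- The lower bound is the value at the excluded endpoint σ = 1, where the mode is still
    -- continuous.
    have hend : mittagLeffler ρ (-(lam₁ * t₁ ^ ρ)) = mode ρ (lam₁ ^ (1 : ℝ)) t₁ := by
      rw [Real.rpow_one, mode_eq_mittagLeffler hρ hlam0.le ht₁.1.le]
    have hstart := mode_eq_mittagLeffler hρ (Real.rpow_nonneg hlam0.le σ₀) ht₁.1.le
    rw [hend, ← hstart]
    refine ⟨?_, ?_, fun σ hσ σ' hσ' h h' => hanti.injective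
      (((hobs₁ σ hσ).1 h).trans ((hobs₁ σ' hσ').1 h').symm)⟩
    · rw [← exists_Ico_eq_iff hanti hcont hσ₀.2]
      exact exists_congr fun σ => and_congr_right fun hσ => hobs₁ σ hσ
    · rw [← exists_Ioo_eq_iff hanti hcont hσ₀.2]
      exact exists_congr fun σ => and_congr_right fun hσ => hobs₁ σ ⟨hσ.1.le, hσ.2⟩
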